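/- **Setting.** Consider a discounted Markov decision process with finite state, action and reward sets $\mathcal S$, $\mathcal A$, $\mathcal R\subset\mathbb R$, transition law $P(s'|s,a)$, reward law $P(r|s,a)$ ($s'$ and $r$ are independent given $(s,a)$), and discount factor $\gamma\in(0,1)$. For a policy $\pi$ let $P^\pi(s,s')=\sum_a\pi(a|s)P(s'|s,a)$, $\xi^\pi(s)=\sum_{a,r}\pi(a|s)P(r|s,a)\,r$, and $V^\pi(s)=\mathbb E_s^\pi\sum_{t\ge0}\gamma^t r(s_t,a_t)$. A policy $b$ (the behavior policy) generates the data; $\mu^b$ is its stationary distribution. $\Pi$ is a set of admissible policies that contains an optimal policy $\pi^*$; $V^*=V^{\pi^*}$, and $\mu^*$ is a stationary distribution of $P^{\pi^*}$. Values are parameterized by $V_\theta(s)=\varphi(s)^T\theta$ with features $\varphi:\mathcal S\to\mathbb R^d$, and $\mathcal C\subset\mathbb R^d$ is a compact convex set with Euclidean projection $\mathbf P_{\mathcal C}$. Put $\phi^\pi(s)=\sum_{s'}P^\pi(s,s')\varphi(s')$, $\delta(\theta,s)=\xi^\pi(s)+(\gamma\phi^\pi(s)-\varphi(s))^T\theta$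 and $l(\theta)=\sum_s\mu^b(s)\,\tfrac12\delta(\theta,s)^2$. **Policy evaluation (Algorithm 1).** From samples $z_t=(s_t,a_t,r_t,s_t')$, $0\le t\le T$, with $s_{t+1}=s_t'$, start at $\theta_1=\theta_0\in\mathcal C$, iterate $\theta_{t+1}=\mathbf P_{\mathcal C}(\theta_t-\eta_t\hat g_t(\theta_t,z_t))$ for $t\ge1$, and return $\bar\theta_T=\frac1{T+1}\sum_{t=0}^T\theta_t$. Here $\hat g_t$ is obtained from one of the directions $g$, with $z=(s,a,r,s')$, - direct-SGD: $\delta(\theta,s)(\gamma\phi^\pi(s)-\varphi(s))$, - TD-SGD: $\frac{\pi(a|s)}{b(a|s)}\delta(\theta,s)(\gamma\varphi(s')-\varphi(s))$, - TD(0): $-\frac1{\mu^b(s)}\frac{\pi(a|s)}{b(a|s)}\bigl(r+\gamma\varphi(s')^T\theta-\varphi(s)^T\theta\bigr)\varphi(s)$, by replacing the laws $p(s'|s)=\sum_a\pi(a|s)P(s'|s,a)$ and $p(r|s)=\sum_a\pi(a|s)P(r|s,a)$ and the distribution $\mu^b$ by the sample averages $\hat p_t(\cdot|s)=\sum_a\pi(a|s)\frac{\#\{l\le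 t:\ s_l=s,\ a_l=a,\ \text{outcome}_l=\cdot\}}{\#\{l\le t:\ s_l=s,\ a_l=a\}}$ and $\hat\mu^b_t(s)=\frac1t\sum_{l=1}^t1_{s_l=s}$. Direct-SGD and TD-SGD are the SGD-based updates. Let $\bar g(\theta)=\sum_{s,a,r,s'}\mu^b(s)b(a|s)P(s'|s,a)P(r|s,a)\,g(\theta,(s,a,r,s'))$. **Policy iteration.** Starting from $\pi_0\in\Pi$, for $0\le k<K$ let $\widehat V^{\pi_k}=V_{\bar\theta_T}$ be the output of Algorithm 1 for $\pi_k$, run on the $k$-th batch of $T+1$ samples, and let $\pi_{k+1}\in\Pi$ maximize $\xi^\pi(s)+\gamma\sum_{s'}P^\pi(s,s')\widehat V^{\pi_k}(s')$ over $\pi\in\Pi$, for every $s$. Given the past, each batch is a trajectory under $b$ (from any initial state), and $\pi_k$ depends only on the data before batch $k$. The total number of samples is $N=K(T+1)$, and $\epsilon$-accuracy means $\mathbb E\sum_s\mu^*(s)(V^*(s)-V^{\pi_K}(s))\le\epsilon$. **Assumptions.** (1) $|\mathcal R|\le n$, $|r|<\tilde M$ almost surely, $\|\varphi(s)\|\le\tilde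 C_0$ for all $s$, $\mathcal C\subset\{\|\theta\|\le\tilde C_1\}$; for every $\pi\in\Pi$ there is $\theta^*\in\mathcal C$ such that $V_{\theta^*}$ solves the Bellman equation of $\pi$. (2) The chain $P^b$ is irreducible and $\|(P^b)^\tau(s,\cdot)-\mu^b\|_{TV}\le\frac14$ for all $s$. (3) In each evaluation and for $1\le t\le T$ there is a random variable $\tilde e_t$ with $\mathbb E\tilde e_t^2\le B/t$ that almost surely bounds $\|\hat p_t(\cdot|s_t)-p(\cdot|s_t)\|_\infty$ (for next states and for rewards) and $|1/\hat\mu^b_t(s_t)-1/\mu^b(s_t)|$. (4) For all $\pi\in\Pi$: $\pi(a|s)\le C\mu^b(s)b(a|s)$, and $\mu(s)\le C\mu^b(s)$ for every stationary distribution $\mu$ of $P^\pi$. **Claim.** There is an absolute $p\in\mathbb N$ such that for all $n,\tilde M,\tilde C_0,\tilde C_1,C,\tau,B$, all $\eta_0>0$ and all $c>0$ there is a constant $K_0$ such that, with $\Lambda=\bigl(1+\log(1+\tfrac1\epsilon)\bigr)\bigl(1+\log\tfrac1{1-\gamma}\bigr)$, the following holds for all $\gamma\in(0,1)$ and $\epsilon>0$.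 1. There are $T,K$ with $$N=K(T+1)\le K_0\,\frac{\Lambda^p}{(1-\gamma)^9\epsilon^4}$$ such that policy iteration with either of the SGD-based updates and step sizes $\eta_t=\eta_0t^{-1/2}$ achieves $\epsilon$-accuracy for every problem that satisfies (1)–(4) with these constants. 2. There are $T,K$ with $$N=K(T+1)\le K_0\,\frac{\Lambda^p}{(1-\gamma)^5\epsilon^2}$$ such that, with any step sizes satisfying $\eta_1\in[1/c,2/c]$ and $\eta_{t+1}=e^{-c\eta_t/2}\eta_t$ for $t\ge1$, policy iteration achieves $\epsilon$-accuracy for every problem that satisfies (1)–(4) with these constants, provided that either an SGD-based update is used and $l$ is $c$-strongly convex for every $\pi\in\Pi$, or TD(0) is used and for every $\pi\in\Pi$ the field $\bar g$ is a $c$-contraction towards a $\theta^*\in\mathcal C$ for which $V_{\theta^*}$ solves the Bellman equation of $\pi$, i.e. $\langle\theta-\theta^*,\bar g(\theta)\rangle\ge c\|\theta-\theta^*\|^2$ for all $\theta$ and $\bar g(\theta^*)=0$. In short, the sample complexity is $\tilde O(\epsilon^{-4}(1-\gamma)^{-9})$ in general and $\tilde O(\epsilon^{-2}(1-\gamma)^{-5})$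 under strong convexity or a TD(0) contraction. -/

import Mathlib

open MeasureTheory ProbabilityTheory

universe u v w

noncomputable section

namespace OfflineRL

/-- A Markov decision process with state space `S`, action space `A` and set of reward values `R`.
Given `(s, a)`, the reward has law `rew s a` and, independently, the next state has law `P s a`. -/
structure MDP (S A : Type*) [Fintype S] (R : Finset ℝ) where
  P : S → A → S → ℝ
  P_nonneg : ∀ s a s', 0 ≤ P s a s'
  P_sum : ∀ s a, ∑ s', P s a s' = 1
  rew : S → A → R → ℝ
  rew_nonneg : ∀ s a r, 0 ≤ rew s a r
  rew_sum : ∀ s a, ∑ r, rew s a r = 1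

/-- One observation `z = (s, a, r, s')`. -/
structure Sample (S A : Type*) (R : Finset ℝ) where
  s : S
  a : A
  r : R
  s' : S

/-- A (stationary, randomized) policy, `π s a = π(a|s)`. -/
structure IsPolicy {S A : Type*} [Fintype A] (π : S → A → ℝ) : Prop where
  nonneg : ∀ s a, 0 ≤ π s a
  sum_one : ∀ s, ∑ a, π s a = 1

/-- `μ` is a stationary distribution of the transition matrix `Q`. -/
structure IsStationary {S : Type*} [Fintype S] (Q : Matrix S S ℝ) (μ : S → ℝ) : Prop where
  nonneg : ∀ s, 0 ≤ μ s
  sum_one : ∑ s, μ s = 1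
  invariant : ∀ s', ∑ s, μ s * Q s s' = μ s'

section Model

variable {S A : Type*} [Fintype S] [DecidableEq S] [Fintype A] [DecidableEq A] {R : Finset ℝ}
  {d : ℕ}

/-- The transition matrix `P^π`. -/
def MDP.trans (M : MDP S A R) (π : S → A → ℝ) : Matrix S S ℝ :=
  Matrix.of fun s s' => ∑ a, π s a * M.P s a s'

/-- The conditional mean reward `ξ^π(s) = E^π_s[r]`. -/
def MDP.meanReward (M : MDP S A R) (π : S → A → ℝ) (s : S) : ℝ :=
  ∑ a, ∑ r : R, π s a * M.rew s a r * (r : ℝ)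

/-- The discounted value `V^π(s) = ∑ₜ γᵗ E^π_s[r(sₜ, aₜ)]`. -/
def MDP.value (M : MDP S A R) (γ : ℝ) (π : S → A → ℝ) (s : S) : ℝ :=
  ∑' t : ℕ, γ ^ t * ∑ x, (M.trans π ^ t) s x * M.meanReward π x

/-- The Bellman operator of the policy `π`. -/
def MDP.bellman (M : MDP S A R) (γ : ℝ) (π : S → A → ℝ) (v : S → ℝ) (s : S) : ℝ :=
  M.meanReward π s + γ * ∑ s', M.trans π s s' * v s'

/-- `π` is optimal among all policies. -/
def MDP.IsOptimal (M : MDP S A R) (γ : ℝ) (π : S → A → ℝ) : Prop :=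
  IsPolicy π ∧ ∀ σ, IsPolicy σ → ∀ s, M.value γ σ s ≤ M.value γ π s

/-- `σ = argmax_{π ∈ Adm} (E^π r + γ ∑ P^π v)`, simultaneously at every state. -/
def MDP.IsGreedy (M : MDP S A R) (γ : ℝ) (Adm : Set (S → A → ℝ)) (v : S → ℝ)
    (σ : S → A → ℝ) : Prop :=
  σ ∈ Adm ∧ ∀ π ∈ Adm, ∀ s, M.bellman γ π v s ≤ M.bellman γ σ v s

/-- The chain generated by `b` is irreducible, with `τ` as a mixing time towards `μ`
(total variation distance at most `1/4` after `τ` steps, from every initial state). -/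
def MDP.IsMixing (M : MDP S A R) (b : S → A → ℝ) (μ : S → ℝ) (τ : ℕ) : Prop :=
  (∀ s s', ∃ n : ℕ, 0 < (M.trans b ^ n) s s') ∧
  ∀ s, (1 / 2) * ∑ s', |(M.trans b ^ τ) s s' - μ s'| ≤ 1 / 4

/-- Linear parameterization `V_θ(s) = φ(s)ᵀ θ`. -/
def linValue (φ : S → EuclideanSpace ℝ (Fin d)) (θ : EuclideanSpace ℝ (Fin d)) (s : S) : ℝ :=
  inner ℝ (φ s) θ

/-- `V_θ` solves the Bellman equation of `π`. -/
def MDP.SolvesBellman (M : MDP S A R) (γ : ℝ) (φ : S → EuclideanSpace ℝ (Fin d))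
    (π : S → A → ℝ) (θ : EuclideanSpace ℝ (Fin d)) : Prop :=
  ∀ s, linValue φ θ s = M.bellman γ π (linValue φ θ) s

/-- The mean feature after one transition, `φ^π(s) = E^π_s[φ(s')]`. -/
def MDP.nextFeature (M : MDP S A R) (φ : S → EuclideanSpace ℝ (Fin d)) (π : S → A → ℝ) (s : S) :
    EuclideanSpace ℝ (Fin d) :=
  ∑ s', M.trans π s s' • φ s'

/-- The Bellman residual `δ(θ, s) = ξ(s) + (γ ψ(s) - φ(s))ᵀ θ`, for a mean reward `ξ` and a mean
feature after transition `ψ`, which may be the exact or the estimated ones. -/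
def residual (γ : ℝ) (φ : S → EuclideanSpace ℝ (Fin d)) (ξ : S → ℝ)
    (ψ : S → EuclideanSpace ℝ (Fin d)) (θ : EuclideanSpace ℝ (Fin d)) (s : S) : ℝ :=
  ξ s + inner ℝ (γ • ψ s - φ s) θ

/-- The loss `l(θ) = E_μ[L(θ, s)]`, `L(θ, s) = δ(θ, s)² / 2`. -/
def MDP.loss (M : MDP S A R) (γ : ℝ) (φ : S → EuclideanSpace ℝ (Fin d)) (μ : S → ℝ)
    (π : S → A → ℝ) (θ : EuclideanSpace ℝ (Fin d)) : ℝ :=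
  ∑ s, μ s * ((1 / 2) * residual γ φ (M.meanReward π) (M.nextFeature φ π) θ s ^ 2)

/-- The three update rules. -/
inductive Method
  | directSGD
  | tdSGD
  | td0

/-- The SGD-based updates. -/
def Method.IsSGD : Method → Prop
  | .directSGD => True
  | .tdSGD => True
  | .td0 => False

/-- The update direction `g(θ, z)`, given a mean reward `ξ`, a mean feature after transition `ψ`
and a stationary distribution `μ`, which may be the exact or the estimated ones. -/
def direction (m : Method) (γ : ℝ) (φ : S → EuclideanSpace ℝ (Fin d)) (b π : S → A → ℝ)
    (ξ : S → ℝ) (ψ : S → EuclideanSpace ℝ (Fin d)) (μ : S → ℝ)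
    (θ : EuclideanSpace ℝ (Fin d)) (z : Sample S A R) : EuclideanSpace ℝ (Fin d) :=
  match m with
  | .directSGD => residual γ φ ξ ψ θ z.s • (γ • ψ z.s - φ z.s)
  | .tdSGD => (π z.s z.a / b z.s z.a * residual γ φ ξ ψ θ z.s) • (γ • φ z.s' - φ z.s)
  | .td0 =>
      -((1 / μ z.s * (π z.s z.a / b z.s z.a) *
          ((z.r : ℝ) + γ * linValue φ θ z.s' - linValue φ θ z.s)) • φ z.s)

/-- The stationary average `ḡ(θ)` of the exact direction. -/
def MDP.meanDirection (M : MDP S A R) (m : Method) (γ : ℝ) (φ : S → EuclideanSpace ℝ (Fin d))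
    (b : S → A → ℝ) (μ : S → ℝ) (π : S → A → ℝ) (θ : EuclideanSpace ℝ (Fin d)) :
    EuclideanSpace ℝ (Fin d) :=
  ∑ s, ∑ a, ∑ r : R, ∑ s', (μ s * b s a * M.P s a s' * M.rew s a r) •
    direction m γ φ b π (M.meanReward π) (M.nextFeature φ π) μ θ ⟨s, a, r, s'⟩

/-- The vector field `h` generates a `c`-contraction towards `θs`. -/
def IsContraction (c : ℝ) (h : EuclideanSpace ℝ (Fin d) → EuclideanSpace ℝ (Fin d))
    (θs : EuclideanSpace ℝ (Fin d)) : Prop :=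
  (∀ θ, c * ‖θ - θs‖ ^ 2 ≤ inner ℝ (θ - θs) (h θ)) ∧ h θs = 0

/-- Euclidean projection onto `C`. -/
def proj (C : Set (EuclideanSpace ℝ (Fin d))) (x : EuclideanSpace ℝ (Fin d)) :
    EuclideanSpace ℝ (Fin d) :=
  open Classical in
  if h : ∃ y ∈ C, ∀ w ∈ C, ‖x - y‖ ≤ ‖x - w‖ then h.choose else x

/-! Sample-average estimators computed from a data sequence `z₀, z₁, …`. -/

/-- Number of `l ≤ t` with `s_l = s`, `a_l = a`. -/
def visits (z : ℕ → Sample S A R) (t : ℕ) (s : S) (a : A) : ℝ :=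
  ∑ l ∈ Finset.range (t + 1), if (z l).s = s ∧ (z l).a = a then 1 else 0

/-- The estimate `p̂ₜ(s'|s)` of the transition probability under `π`. -/
def estTrans (z : ℕ → Sample S A R) (π : S → A → ℝ) (t : ℕ) (s s' : S) : ℝ :=
  ∑ a, π s a * ((∑ l ∈ Finset.range (t + 1),
    if (z l).s = s ∧ (z l).a = a ∧ (z l).s' = s' then 1 else 0) / visits z t s a)

/-- The estimate `p̂ₜ(r|s)` of the reward probability under `π`. -/
def estRew (z : ℕ → Sample S A R) (π : S → A → ℝ) (t : ℕ) (s : S) (r : R) : ℝ :=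
  ∑ a, π s a * ((∑ l ∈ Finset.range (t + 1),
    if (z l).s = s ∧ (z l).a = a ∧ (z l).r = r then 1 else 0) / visits z t s a)

/-- The estimate `μ̂ₜ(s)` of the stationary distribution of the data. -/
def estStat (z : ℕ → Sample S A R) (t : ℕ) (s : S) : ℝ :=
  (1 / (t : ℝ)) * ∑ l ∈ Finset.Icc 1 t, if (z l).s = s then 1 else 0

/-- The approximate direction `ĝₜ(θ, zₜ)`. -/
def estDirection (m : Method) (γ : ℝ) (φ : S → EuclideanSpace ℝ (Fin d)) (b π : S → A → ℝ)
    (z : ℕ → Sample S A R) (t : ℕ) (θ : EuclideanSpace ℝ (Fin d)) : EuclideanSpace ℝ (Fin d) :=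
  direction m γ φ b π (fun s => ∑ r : R, (r : ℝ) * estRew z π t s r)
    (fun s => ∑ s', estTrans z π t s s' • φ s') (estStat z t) θ (z t)

/-- The iterates of the policy evaluation algorithm. The loop runs over `t = 1, 2, …`, with
`θ₁ = θ₀` the initial parameter. -/
def evalIterate (m : Method) (γ : ℝ) (φ : S → EuclideanSpace ℝ (Fin d)) (b π : S → A → ℝ)
    (C : Set (EuclideanSpace ℝ (Fin d))) (η : ℕ → ℝ) (θ₀ : EuclideanSpace ℝ (Fin d))
    (z : ℕ → Sample S A R) : ℕ → EuclideanSpace ℝ (Fin d)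
  | 0 => θ₀
  | 1 => θ₀
  | t + 2 =>
      let θ := evalIterate m γ φ b π C η θ₀ z (t + 1)
      proj C (θ - η (t + 1) • estDirection m γ φ b π z (t + 1) θ)

/-- The output `θ̄_T` of the policy evaluation algorithm. -/
def evalOutput (m : Method) (γ : ℝ) (φ : S → EuclideanSpace ℝ (Fin d)) (b π : S → A → ℝ)
    (C : Set (EuclideanSpace ℝ (Fin d))) (η : ℕ → ℝ) (θ₀ : EuclideanSpace ℝ (Fin d))
    (z : ℕ → Sample S A R) (T : ℕ) : EuclideanSpace ℝ (Fin d) :=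
  (1 / ((T : ℝ) + 1)) • ∑ t ∈ Finset.range (T + 1), evalIterate m γ φ b π C η θ₀ z t

/-- The constants on which the hidden constants of the complexity bounds may depend. -/
structure Constants where
  /-- bound on the rewards -/
  rewardBound : ℝ
  /-- number of possible reward values -/
  rewardCard : ℕ
  /-- bound on the features -/
  featureBound : ℝ
  /-- radius of a ball containing the feasibility set -/
  radius : ℝ
  /-- bound on the distribution shift -/
  shift : ℝ
  /-- mixing time of the data generating chain -/
  mixingTime : ℕ
  /-- constant in the mean square accuracy of the estimators -/
  estError : ℝ
  radius_pos : 0 < radius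
  featureBound_pos : 0 < featureBound
  shift_pos : 0 < shift
  estError_pos : 0 < estError

/-- The standing assumptions: `b` is the behavior policy, with stationary distribution `μb`, `Adm`
is the set of admissible policies, `φ` is the feature function, `C` is the feasibility set. -/
structure Standing (κ : Constants) (M : MDP S A R) (γ : ℝ) (b : S → A → ℝ) (μb : S → ℝ)
    (Adm : Set (S → A → ℝ)) (φ : S → EuclideanSpace ℝ (Fin d))
    (C : Set (EuclideanSpace ℝ (Fin d))) : Prop where
  reward_card : R.card ≤ κ.rewardCard
  reward_bound : ∀ s a (r : R), 0 < M.rew s a r → |(r : ℝ)| < κ.rewardBound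
  feature_bound : ∀ s, ‖φ s‖ ≤ κ.featureBound
  compact : IsCompact C
  convex : Convex ℝ C
  bounded : ∀ θ ∈ C, ‖θ‖ ≤ κ.radius
  behavior : IsPolicy b
  stationary : IsStationary (M.trans b) μb
  mixing : M.IsMixing b μb κ.mixingTime
  admissible : ∀ π ∈ Adm, IsPolicy π
  realizable : ∀ π ∈ Adm, ∃ θs ∈ C, M.SolvesBellman γ φ π θs
  policy_shift : ∀ π ∈ Adm, ∀ s a, π s a ≤ κ.shift * μb s * b s a
  stationary_shift : ∀ π ∈ Adm, ∀ μ, IsStationary (M.trans π) μ → ∀ s, μ s ≤ κ.shift * μb s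

end Model

section Learning

variable {S A : Type*} [Fintype S] [DecidableEq S] [Fintype A] [DecidableEq A] {R : Finset ℝ}
  {d : ℕ} {Ω : Type*} {mΩ : MeasurableSpace Ω}

/-- The samples `z₀, …, z_{K(T+1)-1}` are generated under the behavior policy `b`, in `K`
consecutive batches of `T + 1` samples each. Within a batch they form one trajectory. The initial
state of a batch is arbitrary: it may continue the previous batch or be a fresh restart.
`ℱ n` is the information available before the action of sample `n` is taken. -/
structure IsOfflineData (M : MDP S A R) (b : S → A → ℝ) (T K : ℕ) (ρ : Measure Ω)
    (ℱ : Filtration ℕ mΩ) (z : ℕ → Ω → Sample S A R) : Prop where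
  state_adapted : ∀ n < K * (T + 1), ∀ x, MeasurableSet[ℱ n] {ω | (z n ω).s = x}
  sample_adapted : ∀ n < K * (T + 1), ∀ y, MeasurableSet[ℱ (n + 1)] {ω | z n ω = y}
  law : ∀ n < K * (T + 1), ∀ x a r y,
    ρ⟦{ω | z n ω = ⟨x, a, r, y⟩} | ℱ n⟧ =ᵐ[ρ]
      fun ω => if (z n ω).s = x then b x a * M.rew x a r * M.P x a y else 0
  continues : ∀ n, n + 1 < K * (T + 1) → ¬ (T + 1 ∣ n + 1) →
    ∀ᵐ ω ∂ρ, (z (n + 1) ω).s = (z n ω).s'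

/-- The `k`-th batch of `T + 1` samples. -/
def batch (z : ℕ → Ω → Sample S A R) (T k : ℕ) (ω : Ω) (t : ℕ) : Sample S A R :=
  z (k * (T + 1) + t) ω

/-- `π₀, …, π_K` are produced by policy iteration with approximate policy evaluation, where `π_k`
is evaluated by the update rule `m` on the `k`-th batch of data. -/
structure IsPolicyIteration (M : MDP S A R) (γ : ℝ) (b : S → A → ℝ) (Adm : Set (S → A → ℝ))
    (φ : S → EuclideanSpace ℝ (Fin d)) (C : Set (EuclideanSpace ℝ (Fin d)))
    (m : Method) (η : ℕ → ℝ) (θ₀ : ℕ → EuclideanSpace ℝ (Fin d)) (T K : ℕ) (ρ : Measure Ω)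
    (ℱ : Filtration ℕ mΩ) (z : ℕ → Ω → Sample S A R) (π : ℕ → Ω → S → A → ℝ) : Prop where
  initial_param : ∀ k, θ₀ k ∈ C
  adapted : ∀ k ≤ K, ∀ s a, Measurable[ℱ (k * (T + 1))] fun ω => π k ω s a
  initial : ∀ᵐ ω ∂ρ, π 0 ω ∈ Adm
  improve : ∀ k < K, ∀ᵐ ω ∂ρ, M.IsGreedy γ Adm
    (linValue φ (evalOutput m γ φ b (π k ω) C η (θ₀ k) (batch z T k ω) T)) (π (k + 1) ω)

/-- Accuracy of the estimators in every policy evaluation: the errors at time `t` are dominated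
by a random variable `e` with `E e² ≤ B / t`. -/
def AccurateEstimates (M : MDP S A R) (μb : S → ℝ) (T K : ℕ) (ρ : Measure Ω)
    (z : ℕ → Ω → Sample S A R) (π : ℕ → Ω → S → A → ℝ) (B : ℝ) : Prop :=
  ∀ k < K, ∀ t, 1 ≤ t → t ≤ T → ∃ e : Ω → ℝ, MemLp e 2 ρ ∧ ∫ ω, e ω ^ 2 ∂ρ ≤ B / t ∧
    ∀ᵐ ω ∂ρ,
      (∀ s', |estTrans (batch z T k ω) (π k ω) t (batch z T k ω t).s s'
        - M.trans (π k ω) (batch z T k ω t).s s'| ≤ e ω) ∧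
      (∀ r : R, |estRew (batch z T k ω) (π k ω) t (batch z T k ω t).s r
        - ∑ a, π k ω (batch z T k ω t).s a * M.rew (batch z T k ω t).s a r| ≤ e ω) ∧
      |1 / estStat (batch z T k ω) t (batch z T k ω t).s - 1 / μb (batch z T k ω t).s| ≤ e ω

/-- `E ∑ₛ μ*(s) (V*(s) - V^{σ}(s)) ≤ ε` for the random policy `σ`. -/
def MDP.IsAccurate (M : MDP S A R) (γ : ℝ) (πs : S → A → ℝ) (μs : S → ℝ) (ρ : Measure Ω)
    (σ : Ω → S → A → ℝ) (ε : ℝ) : Prop :=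
  Integrable (fun ω => ∑ s, μs s * (M.value γ πs s - M.value γ (σ ω) s)) ρ ∧
  ∫ ω, ∑ s, μs s * (M.value γ πs s - M.value γ (σ ω) s) ∂ρ ≤ ε

end Learning

/-- Step sizes used under a `c`-contraction. -/
def IsContractionStep (c : ℝ) (η : ℕ → ℝ) : Prop :=
  1 / c ≤ η 1 ∧ η 1 ≤ 2 / c ∧ ∀ t, 1 ≤ t → η (t + 1) = Real.exp (-(1 / 2) * c * η t) * η t

/-- The logarithmic factors hidden in `Õ`. -/
def logFactor (γ ε : ℝ) : ℝ :=
  (1 + Real.log (1 + 1 / ε)) * (1 + Real.log (1 / (1 - γ)))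

end OfflineRL

end

noncomputable section

namespace OfflineRL

set_option linter.unusedSectionVars false

/-! ### Stochastic matrices and mixing -/

section Stochastic

variable {S : Type*} [Fintype S]

/-! The proof balances three quantities: the error that policy iteration tolerates in each
evaluation, the rate at which one evaluation converges, and the number of evaluations.

Policy iteration. If the estimate `v` of the value has Bellman residual at most `ε'` at every state,
the maximum principle for the two Bellman equations puts the values of the old and of the new policy
within `ε' / (1 - γ)` of `v`, each on the side that matters. One greedy step therefore contracts the
gap to the comparison policy, averaged over its stationary distribution, by the factor `γ` and adds
`2 * ε' / (1 - γ)` (`MDP.policy_improvement`). After `K` steps this leaves `γ ^ K` times the initial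
gap plus an error of order `ε' / (1 - γ) ^ 2`. The initial gap is bounded independently of `γ`,
because every value function is realized by a parameter in the feasibility set. The shift assumption
gives `μb s ≥ 1 / κ.shift` at every state, so the squared residual is dominated by the loss, and a
mean loss of order `(1 - γ) ^ 4 * ε ^ 2` is enough (`IsPolicyIteration.isAccurate`).

Evaluation. Projection does not increase the distance to a solution `θs`, which gives the usual
recursion for the squared distance (`dist_sq_succ_le`): a stationary drift, a Markovian noise, an
estimation error and a squared step. By the Bellman equation the residual is linear in `θ - θs`. For
the SGD-based updates the drift is then exactly twice the loss, and under the stronger assumptions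
it dominates `c` times the squared distance (`Standing.exists_drift`). The noise is not centered,
since the iterate depends on the past of the trajectory. Replacing the iterate by the one a
logarithmic number of steps earlier makes its mean small by mixing; the replacement costs only the
movement of the iterates over that window (`abs_integral_noise_le`). Averaging the recursion gives a
mean loss of order `log T / √T`, and iterating it under the contraction gives `(log T) ^ 2 / T`.

Hence `T` is of order `(1 - γ) ^ (-8) * ε ^ (-4)` or `(1 - γ) ^ (-4) * ε ^ (-2)`, and `K` of order
`1 / (1 - γ)`, up to logarithms (`exists_sizes`).

A measurability issue shapes the statements. The solution belonging to a random policy need not be a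
measurable function of the sample point. The drift and the noise are therefore written in terms of
the value function, a measurable limit, and inequalities involving the solution itself are used
pathwise only. -/

/-- `Q` is a stochastic matrix. -/
structure IsStochastic (Q : Matrix S S ℝ) : Prop where
  nonneg : ∀ s s', 0 ≤ Q s s'
  sum_one : ∀ s, ∑ s', Q s s' = 1

lemma IsStochastic.mul {Q Q' : Matrix S S ℝ} (h : IsStochastic Q) (h' : IsStochastic Q') :
    IsStochastic (Q * Q') where
  nonneg s s' := by
    rw [Matrix.mul_apply]
    exact Finset.sum_nonneg fun x _ => mul_nonneg (h.nonneg _ _) (h'.nonneg _ _)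
  sum_one s := by
    simp_rw [Matrix.mul_apply]
    rw [Finset.sum_comm]
    simp_rw [← Finset.mul_sum, h'.sum_one, mul_one, h.sum_one]

lemma IsStochastic.pow [DecidableEq S] {Q : Matrix S S ℝ} (h : IsStochastic Q) (n : ℕ) :
    IsStochastic (Q ^ n) := by
  induction n with
  | zero =>
    refine ⟨fun s s' => ?_, fun s => ?_⟩
    · rw [pow_zero, Matrix.one_apply]; split_ifs <;> norm_num
    · simp [Matrix.one_apply]
  | succ n ih => rw [pow_succ]; exact ih.mul h

lemma IsStochastic.abs_sum_le {Q : Matrix S S ℝ} (h : IsStochastic Q) {v : S → ℝ} {L : ℝ}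
    (hv : ∀ s, |v s| ≤ L) (s : S) : |∑ s', Q s s' * v s'| ≤ L :=
  calc |∑ s', Q s s' * v s'| ≤ ∑ s', |Q s s' * v s'| := Finset.abs_sum_le_sum_abs _ _
    _ ≤ ∑ s', Q s s' * L := Finset.sum_le_sum fun s' _ => by
        rw [abs_mul, abs_of_nonneg (h.nonneg s s')]
        exact mul_le_mul_of_nonneg_left (hv s') (h.nonneg s s')
    _ = L := by rw [← Finset.sum_mul, h.sum_one, one_mul]

lemma IsStochastic.sum_abs_vecMul_le {Q : Matrix S S ℝ} (h : IsStochastic Q) (ν : S → ℝ) :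
    ∑ y, |∑ x, ν x * Q x y| ≤ ∑ x, |ν x| :=
  calc ∑ y, |∑ x, ν x * Q x y| ≤ ∑ y, ∑ x, |ν x| * Q x y :=
        Finset.sum_le_sum fun y _ => (Finset.abs_sum_le_sum_abs _ _).trans
          (Finset.sum_le_sum fun x _ => by rw [abs_mul, abs_of_nonneg (h.nonneg x y)])
    _ = ∑ x, |ν x| := by
        rw [Finset.sum_comm]
        simp_rw [← Finset.mul_sum, h.sum_one, mul_one]

/-- A stochastic matrix whose rows are `1/2`-close to one distribution contracts zero-sum
vectors. -/
lemma sum_abs_vecMul_le_half {Q : Matrix S S ℝ} {μ : S → ℝ}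
    (hQ : ∀ s, ∑ s', |Q s s' - μ s'| ≤ 1 / 2) {ν : S → ℝ} (hν : ∑ x, ν x = 0) :
    ∑ y, |∑ x, ν x * Q x y| ≤ (1 / 2) * ∑ x, |ν x| := by
  -- Since `ν` has total mass zero, the same vector `μ` may be subtracted from every row.
  have key : ∀ y, ∑ x, ν x * Q x y = ∑ x, ν x * (Q x y - μ y) := fun y => by
    simp_rw [mul_sub, Finset.sum_sub_distrib, ← Finset.sum_mul, hν, zero_mul, sub_zero]
  calc ∑ y, |∑ x, ν x * Q x y| ≤ ∑ y, ∑ x, |ν x| * |Q x y - μ y| :=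
        Finset.sum_le_sum fun y _ => by
          rw [key]
          exact (Finset.abs_sum_le_sum_abs _ _).trans (Finset.sum_le_sum fun x _ => (abs_mul _ _).le)
    _ = ∑ x, |ν x| * ∑ y, |Q x y - μ y| := by
        rw [Finset.sum_comm]; simp_rw [← Finset.mul_sum]
    _ ≤ ∑ x, |ν x| * (1 / 2) :=
        Finset.sum_le_sum fun x _ => mul_le_mul_of_nonneg_left (hQ x) (abs_nonneg _)
    _ = (1 / 2) * ∑ x, |ν x| := by rw [← Finset.sum_mul, mul_comm]

lemma IsStationary.pow [DecidableEq S] {Q : Matrix S S ℝ} {μ : S → ℝ} (h : IsStationary Q μ)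
    (n : ℕ) (s' : S) : ∑ s, μ s * (Q ^ n) s s' = μ s' := by
  induction n generalizing s' with
  | zero => simp [Matrix.one_apply]
  | succ n ih =>
    simp_rw [pow_succ, Matrix.mul_apply, Finset.mul_sum]
    rw [Finset.sum_comm]
    simp_rw [← mul_assoc, ← Finset.sum_mul, ih, h.invariant]

/-- Row minus `μ` is a zero-sum vector, so each block of `τ` steps halves its `ℓ¹` norm. Blocks of
length `τ + 1` are used so that the block length is positive even for `τ = 0`; the extra step does
no harm. -/
lemma IsStationary.sum_abs_pow_sub_le [DecidableEq S] {Q : Matrix S S ℝ} {μ : S → ℝ}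
    (h : IsStationary Q μ) (hQ : IsStochastic Q) {τ : ℕ}
    (hτ : ∀ s, (1 / 2) * ∑ s', |(Q ^ τ) s s' - μ s'| ≤ 1 / 4) (n : ℕ) (s : S) :
    ∑ s', |(Q ^ n) s s' - μ s'| ≤ 2 * (1 / 2) ^ (n / (τ + 1)) := by
  have step : ∀ i j : ℕ, ∀ y, (Q ^ (i + j)) s y - μ y
      = ∑ x, ((Q ^ i) s x - μ x) * (Q ^ j) x y := fun i j y => by
    simp_rw [sub_mul, Finset.sum_sub_distrib, h.pow, pow_add, Matrix.mul_apply]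
  have zero : ∀ i, ∑ x, ((Q ^ i) s x - μ x) = 0 := fun i => by
    rw [Finset.sum_sub_distrib, (hQ.pow i).sum_one, h.sum_one, sub_self]
  have base : ∀ i, ∑ y, |(Q ^ i) s y - μ y| ≤ 2 := fun i =>
    calc ∑ y, |(Q ^ i) s y - μ y| ≤ ∑ y, ((Q ^ i) s y + μ y) :=
          Finset.sum_le_sum fun y _ => abs_le.2
            ⟨by linarith [(hQ.pow i).nonneg s y, h.nonneg y],
             by linarith [(hQ.pow i).nonneg s y, h.nonneg y]⟩
      _ = 2 := by rw [Finset.sum_add_distrib, (hQ.pow i).sum_one, h.sum_one]; norm_num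
  have main : ∀ q r : ℕ, ∑ y, |(Q ^ (r + q * (τ + 1))) s y - μ y| ≤ 2 * (1 / 2) ^ q := by
    intro q r
    induction q with
    | zero => simpa using base r
    | succ q ih =>
      -- The block is split into `τ` steps, which halve the norm, and a single step, which does not
      -- increase it.
      have e1 : r + (q + 1) * (τ + 1) = ((r + q * (τ + 1)) + τ) + 1 := by ring
      rw [e1]
      calc _ ≤ ∑ x, |(Q ^ ((r + q * (τ + 1)) + τ)) s x - μ x| := by
            simp_rw [step _ 1]
            exact (hQ.pow 1).sum_abs_vecMul_le _
        _ ≤ (1 / 2) * ∑ x, |(Q ^ (r + q * (τ + 1))) s x - μ x| := by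
            simp_rw [step _ τ]
            exact sum_abs_vecMul_le_half (μ := μ) (fun x => by linarith [hτ x]) (zero _)
        _ ≤ (1 / 2) * (2 * (1 / 2) ^ q) := by gcongr
        _ = _ := by ring
  have := main (n / (τ + 1)) (n % (τ + 1))
  rwa [Nat.mod_add_div'] at this

end Stochastic

/-! ### Values and policy improvement -/

section Values

variable {S A : Type*} [Fintype S] [DecidableEq S] [Fintype A] {R : Finset ℝ}
  {d : ℕ}

lemma MDP.trans_isStochastic (M : MDP S A R) {π : S → A → ℝ} (hπ : IsPolicy π) :
    IsStochastic (M.trans π) where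
  nonneg s s' := Finset.sum_nonneg fun a _ => mul_nonneg (hπ.nonneg s a) (M.P_nonneg s a s')
  sum_one s := by
    simp only [MDP.trans, Matrix.of_apply]
    rw [Finset.sum_comm]
    simp_rw [← Finset.mul_sum, M.P_sum, mul_one, hπ.sum_one]

/-- Substituting the Bellman equation into itself `n` times leaves the discounted remainder. -/
lemma MDP.sum_pow_trans_bellman (M : MDP S A R) (γ : ℝ) (π : S → A → ℝ) {v : S → ℝ}
    (hv : ∀ s, v s = M.bellman γ π v s) (n : ℕ) (s : S) :
    ∑ t ∈ Finset.range n, γ ^ t * ∑ x, (M.trans π ^ t) s x * M.meanReward π x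
      = v s - γ ^ n * ∑ x, (M.trans π ^ n) s x * v x := by
  induction n with
  | zero => simp [Matrix.one_apply]
  | succ n ih =>
    rw [Finset.sum_range_succ, ih]
    have h1 : ∑ x, (M.trans π ^ n) s x * v x
        = ∑ x, (M.trans π ^ n) s x * M.meanReward π x
          + γ * ∑ x, (M.trans π ^ (n + 1)) s x * v x := by
      have : ∀ x, (M.trans π ^ n) s x * v x = (M.trans π ^ n) s x * M.meanReward π x
          + γ * ∑ y, (M.trans π ^ n) s x * M.trans π x y * v y := fun x => by
        conv_lhs => rw [hv x, MDP.bellman]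
        rw [mul_add, mul_left_comm, Finset.mul_sum]
        simp_rw [mul_assoc]
      simp_rw [this, Finset.sum_add_distrib, ← Finset.mul_sum]
      congr 2
      rw [Finset.sum_comm]
      simp_rw [← Finset.sum_mul, pow_succ, Matrix.mul_apply]
    rw [h1]; ring

lemma MDP.hasSum_value (M : MDP S A R) {γ : ℝ} (h0 : 0 ≤ γ) (h1 : γ < 1) {π : S → A → ℝ}
    (hπ : IsPolicy π) {v : S → ℝ} (hv : ∀ s, v s = M.bellman γ π v s) (s : S) :
    HasSum (fun t : ℕ => γ ^ t * ∑ x, (M.trans π ^ t) s x * M.meanReward π x) (v s) := by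
  have hP := M.trans_isStochastic hπ
  have bdd : ∀ w : S → ℝ, ∀ t : ℕ, ‖γ ^ t * ∑ x, (M.trans π ^ t) s x * w x‖
      ≤ γ ^ t * ∑ x, |w x| := fun w t => by
    rw [Real.norm_eq_abs, abs_mul, abs_of_nonneg (pow_nonneg h0 t)]
    exact mul_le_mul_of_nonneg_left ((hP.pow t).abs_sum_le (fun x =>
      Finset.single_le_sum (f := fun x => |w x|) (fun _ _ => abs_nonneg _) (Finset.mem_univ x)) s)
      (pow_nonneg h0 t)
  have hs : Summable fun t : ℕ => γ ^ t * ∑ x, (M.trans π ^ t) s x * M.meanReward π x :=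
    Summable.of_norm_bounded ((summable_geometric_of_lt_one h0 h1).mul_right _) (bdd _)
  rw [hs.hasSum_iff_tendsto_nat]
  simp_rw [M.sum_pow_trans_bellman γ π hv]
  have lim : Filter.Tendsto (fun n : ℕ => γ ^ n * ∑ x, (M.trans π ^ n) s x * v x) Filter.atTop
      (nhds 0) :=
    squeeze_zero_norm (bdd v) (by
      simpa using (tendsto_pow_atTop_nhds_zero_of_lt_one h0 h1).mul_const (∑ x, |v x|))
  simpa using lim.const_sub (v s)

/-- Bellman solutions are unique for `γ < 1`. Through this identification the norm bounds on the
feasibility set bound the values without a factor `1 / (1 - γ)`. -/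
lemma MDP.SolvesBellman.linValue_eq {M : MDP S A R} {γ : ℝ} (h0 : 0 ≤ γ) (h1 : γ < 1)
    {φ : S → EuclideanSpace ℝ (Fin d)} {π : S → A → ℝ} (hπ : IsPolicy π)
    {θ : EuclideanSpace ℝ (Fin d)} (h : M.SolvesBellman γ φ π θ) (s : S) :
    linValue φ θ s = M.value γ π s :=
  (M.hasSum_value h0 h1 hπ h s).tsum_eq.symm

/-- Maximum principle: at a maximizer of `w` the average on the right is at most `w` itself. -/
lemma IsStochastic.le_div_of_le [Nonempty S] {Q : Matrix S S ℝ} (hQ : IsStochastic Q) {γ : ℝ}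
    (h0 : 0 ≤ γ) (h1 : γ < 1) {w : S → ℝ} {ε : ℝ} (hw : ∀ s, w s ≤ γ * ∑ y, Q s y * w y + ε)
    (s : S) : w s ≤ ε / (1 - γ) := by
  obtain ⟨x, hx⟩ := Finite.exists_max w
  have h2 : ∑ y, Q x y * w y ≤ w x :=
    calc _ ≤ ∑ y, Q x y * w x := Finset.sum_le_sum fun y _ =>
          mul_le_mul_of_nonneg_left (hx y) (hQ.nonneg x y)
      _ = _ := by rw [← Finset.sum_mul, hQ.sum_one, one_mul]
  refine (hx s).trans ?_
  rw [le_div_iff₀ (by linarith)]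
  nlinarith [hw x, mul_le_mul_of_nonneg_left h2 h0]

lemma MDP.bellman_sub (M : MDP S A R) (γ : ℝ) (σ : S → A → ℝ) (v u : S → ℝ) (s : S) :
    M.bellman γ σ v s - M.bellman γ σ u s = γ * ∑ y, M.trans σ s y * (v y - u y) := by
  simp_rw [MDP.bellman, mul_sub, Finset.sum_sub_distrib]; ring

lemma MDP.bellman_sub_le (M : MDP S A R) {γ : ℝ} (h0 : 0 ≤ γ) {σ : S → A → ℝ} (hσ : IsPolicy σ)
    {v u : S → ℝ} {ε : ℝ} (h : ∀ s, v s ≤ u s + ε) (s : S) :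
    M.bellman γ σ v s ≤ M.bellman γ σ u s + γ * ε := by
  have hP := M.trans_isStochastic hσ
  have : ∑ y, M.trans σ s y * (v y - u y) ≤ ε :=
    calc _ ≤ ∑ y, M.trans σ s y * ε := Finset.sum_le_sum fun y _ =>
          mul_le_mul_of_nonneg_left (by linarith [h y]) (hP.nonneg s y)
      _ = _ := by rw [← Finset.sum_mul, hP.sum_one, one_mul]
  nlinarith [M.bellman_sub γ σ v u s, mul_le_mul_of_nonneg_left this h0]

/-- One step of policy iteration with a value estimate `v` of Bellman residual at most `ε`. -/
lemma MDP.policy_improvement [Nonempty S] (M : MDP S A R) {γ : ℝ} (h0 : 0 ≤ γ) (h1 : γ < 1)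
    {Adm : Set (S → A → ℝ)} {π πs σ : S → A → ℝ} (hπA : π ∈ Adm) (hsA : πs ∈ Adm)
    (hπ : IsPolicy π) (hs : IsPolicy πs) (hσ : IsPolicy σ) {u us uσ v : S → ℝ} {ε : ℝ}
    (hu : ∀ s, u s = M.bellman γ π u s) (hus : ∀ s, us s = M.bellman γ πs us s)
    (huσ : ∀ s, uσ s = M.bellman γ σ uσ s)
    (hv : ∀ s, |M.bellman γ π v s - v s| ≤ ε) (hg : M.IsGreedy γ Adm v σ)
    {μs : S → ℝ} (hμ : IsStationary (M.trans πs) μs) :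
    ∑ s, μs s * (us s - uσ s) ≤ γ * ∑ s, μs s * (us s - u s) + 2 * ε / (1 - γ) := by
  -- The estimate `v` is almost a subsolution for `π`, and by greediness also for `σ`; comparison
  -- with the fixed point `uσ` bounds it from above.
  have hlow : ∀ s, v s ≤ uσ s + ε / (1 - γ) := fun s => by
    have := (M.trans_isStochastic hσ).le_div_of_le h0 h1 (w := fun s => v s - uσ s) (ε := ε)
      (fun s => by
        rw [← M.bellman_sub, ← huσ]
        linarith [(abs_le.1 (hv s)).1, hg.2 π hπA s]) s
    linarith
  -- Here `v` is almost a supersolution for `π`, whose fixed point is `u`.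
  have hup : ∀ s, u s ≤ v s + ε / (1 - γ) := fun s => by
    have := (M.trans_isStochastic hπ).le_div_of_le h0 h1 (w := fun s => u s - v s) (ε := ε)
      (fun s => by
        rw [← M.bellman_sub, ← hu]
        linarith [(abs_le.1 (hv s)).2]) s
    linarith
  have hε : 0 ≤ ε / (1 - γ) :=
    div_nonneg ((abs_nonneg _).trans (hv (Classical.arbitrary S))) (by linarith)
  -- Chain: `uσ` is its own Bellman image under `σ`, replace `uσ` by `v`, use greediness against
  -- `πs`, then replace `v` by `u`. The two replacements cost `γ * ε / (1 - γ)` each.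
  have key : ∀ s, us s - uσ s
      ≤ γ * ∑ y, M.trans πs s y * (us y - u y) + 2 * ε / (1 - γ) := fun s => by
    have a1 := M.bellman_sub_le h0 hσ hlow s
    have a2 := M.bellman_sub_le h0 hs hup s
    have a3 := hg.2 πs hsA s
    have a4 := M.bellman_sub γ πs us u s
    have a5 : γ * (ε / (1 - γ)) ≤ ε / (1 - γ) := mul_le_of_le_one_left hε h1.le
    rw [← huσ] at a1
    rw [← hus] at a4
    rw [mul_div_assoc]
    linarith
  calc ∑ s, μs s * (us s - uσ s)
      ≤ ∑ s, μs s * (γ * ∑ y, M.trans πs s y * (us y - u y) + 2 * ε / (1 - γ)) :=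
        Finset.sum_le_sum fun s _ => mul_le_mul_of_nonneg_left (key s) (hμ.nonneg s)
    _ = γ * ∑ y, ∑ s, μs s * M.trans πs s y * (us y - u y) + 2 * ε / (1 - γ) := by
        simp_rw [mul_add, Finset.sum_add_distrib]
        rw [← Finset.sum_mul, hμ.sum_one, one_mul, Finset.sum_comm]
        simp_rw [Finset.mul_sum]
        congr 1
        refine Finset.sum_congr rfl fun s _ => Finset.sum_congr rfl fun y _ => by ring
    _ = _ := by simp_rw [← Finset.sum_mul, hμ.invariant]

end Values

/-! ### Euclidean projection -/

section Projection

variable {d : ℕ} {C : Set (EuclideanSpace ℝ (Fin d))}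

/-- Compactness provides a minimizer, so the fallback value in the definition of `proj` does not
occur. -/
lemma proj_spec (hC : IsCompact C) (hne : C.Nonempty) (x : EuclideanSpace ℝ (Fin d)) :
    proj C x ∈ C ∧ ∀ w ∈ C, ‖x - proj C x‖ ≤ ‖x - w‖ := by
  have h : ∃ y ∈ C, ∀ w ∈ C, ‖x - y‖ ≤ ‖x - w‖ :=
    hC.exists_isMinOn hne (continuous_const.sub continuous_id).norm.continuousOn
  rw [proj, dif_pos h]
  exact h.choose_spec

lemma inner_sub_proj_le (hC : IsCompact C) (hconv : Convex ℝ C) (hne : C.Nonempty)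
    (x : EuclideanSpace ℝ (Fin d)) {w : EuclideanSpace ℝ (Fin d)} (hw : w ∈ C) :
    inner ℝ (x - proj C x) (w - proj C x) ≤ 0 := by
  obtain ⟨h1, h2⟩ := proj_spec hC hne x
  have : Nonempty C := hne.to_subtype
  refine (norm_eq_iInf_iff_real_inner_le_zero hconv h1).1 ?_ w hw
  refine le_antisymm (le_ciInf fun w => h2 w w.2) ?_
  exact ciInf_le ⟨0, by rintro _ ⟨w, rfl⟩; exact norm_nonneg _⟩ (⟨_, h1⟩ : C)

/-- Adding the variational inequalities at the two projections gives firm nonexpansiveness, and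
Cauchy–Schwarz does the rest. -/
lemma norm_proj_sub_proj_le (hC : IsCompact C) (hconv : Convex ℝ C) (hne : C.Nonempty)
    (x y : EuclideanSpace ℝ (Fin d)) : ‖proj C x - proj C y‖ ≤ ‖x - y‖ := by
  have h1 := inner_sub_proj_le hC hconv hne x (proj_spec hC hne y).1
  have h2 := inner_sub_proj_le hC hconv hne y (proj_spec hC hne x).1
  have h3 : ‖proj C x - proj C y‖ ^ 2 ≤ inner ℝ (x - y) (proj C x - proj C y) := by
    rw [← real_inner_self_eq_norm_sq]
    have e : inner ℝ (x - y) (proj C x - proj C y) - inner ℝ (proj C x - proj C y)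
        (proj C x - proj C y) = -inner ℝ (x - proj C x) (proj C y - proj C x)
          - inner ℝ (y - proj C y) (proj C x - proj C y) := by
      simp only [inner_sub_left, inner_sub_right]; ring
    linarith
  have h4 := real_inner_le_norm (x - y) (proj C x - proj C y)
  by_contra hcon
  push Not at hcon
  nlinarith [norm_nonneg (x - y), norm_nonneg (proj C x - proj C y)]

lemma proj_of_mem (hC : IsCompact C) {x : EuclideanSpace ℝ (Fin d)} (hx : x ∈ C) :
    proj C x = x := by
  have h := (proj_spec hC ⟨x, hx⟩ x).2 x hx
  rw [sub_self, norm_zero] at h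
  exact (sub_eq_zero.1 (norm_le_zero_iff.1 h)).symm

lemma measurable_proj (hC : IsCompact C) (hconv : Convex ℝ C) (hne : C.Nonempty) :
    Measurable (proj C) := by
  refine (LipschitzWith.of_dist_le_mul (K := 1) fun x y => ?_).continuous.measurable
  simpa [dist_eq_norm] using norm_proj_sub_proj_le hC hconv hne x y

end Projection

/-! ### Consequences of the standing assumptions -/

section Bounds

variable {S A : Type*} [Fintype S] [DecidableEq S] [Fintype A] [DecidableEq A] {R : Finset ℝ}
  {d : ℕ} {κ : Constants} {M : MDP S A R} {γ : ℝ} {b : S → A → ℝ} {μb : S → ℝ}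
  {Adm : Set (S → A → ℝ)} {φ : S → EuclideanSpace ℝ (Fin d)}
  {C : Set (EuclideanSpace ℝ (Fin d))} {π : S → A → ℝ}

namespace Standing

/-- Summing the shift bound over the actions. This lower bound on `μb` is what turns a mean loss
into a bound at every state, and it also bounds the number of states by `κ.shift`. -/
lemma one_le_shift_mul (h : Standing κ M γ b μb Adm φ C) (hπ : π ∈ Adm) (s : S) :
    1 ≤ κ.shift * μb s :=
  calc (1 : ℝ) = ∑ a, π s a := ((h.admissible π hπ).sum_one s).symm
    _ ≤ ∑ a, κ.shift * μb s * b s a := Finset.sum_le_sum fun a _ => h.policy_shift π hπ s a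
    _ = _ := by rw [← Finset.mul_sum, h.behavior.sum_one, mul_one]

lemma stat_pos (h : Standing κ M γ b μb Adm φ C) (hπ : π ∈ Adm) (s : S) : 0 < μb s := by
  have := h.one_le_shift_mul hπ s
  by_contra hn
  nlinarith [κ.shift_pos]

lemma stat_le_one (h : Standing κ M γ b μb Adm φ C) (s : S) : μb s ≤ 1 := by
  rw [← h.stationary.sum_one]
  exact Finset.single_le_sum (fun s _ => h.stationary.nonneg s) (Finset.mem_univ s)

lemma card_le (h : Standing κ M γ b μb Adm φ C) (hπ : π ∈ Adm) :
    (Fintype.card S : ℝ) ≤ κ.shift :=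
  calc (Fintype.card S : ℝ) = ∑ _s : S, (1 : ℝ) := by simp
    _ ≤ ∑ s, κ.shift * μb s := Finset.sum_le_sum fun s _ => h.one_le_shift_mul hπ s
    _ = _ := by rw [← Finset.mul_sum, h.stationary.sum_one, mul_one]

lemma one_le_shift [Nonempty S] (h : Standing κ M γ b μb Adm φ C) (hπ : π ∈ Adm) :
    1 ≤ κ.shift := by
  obtain ⟨s⟩ := ‹Nonempty S›
  nlinarith [h.one_le_shift_mul hπ s, h.stat_le_one s, κ.shift_pos]

lemma ratio_nonneg (h : Standing κ M γ b μb Adm φ C) (hπ : π ∈ Adm) (s : S) (a : A) :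
    0 ≤ π s a / b s a :=
  div_nonneg ((h.admissible π hπ).nonneg s a) (h.behavior.nonneg s a)

lemma ratio_le (h : Standing κ M γ b μb Adm φ C) (hπ : π ∈ Adm) (s : S) (a : A) :
    π s a / b s a ≤ κ.shift * μb s :=
  div_le_of_le_mul₀ (h.behavior.nonneg s a)
    (mul_nonneg κ.shift_pos.le (h.stationary.nonneg s)) (h.policy_shift π hπ s a)

lemma ratio_le_shift (h : Standing κ M γ b μb Adm φ C) (hπ : π ∈ Adm) (s : S) (a : A) :
    π s a / b s a ≤ κ.shift :=
  (h.ratio_le hπ s a).trans (mul_le_of_le_one_right κ.shift_pos.le (h.stat_le_one s))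

/-- Where `b` vanishes so does `π`, by the shift bound; hence importance weighting is exact despite
division by zero. -/
lemma mul_ratio (h : Standing κ M γ b μb Adm φ C) (hπ : π ∈ Adm) (s : S) (a : A) :
    b s a * (π s a / b s a) = π s a := by
  by_cases hb : b s a = 0
  · have h1 := h.policy_shift π hπ s a
    rw [hb, mul_zero] at h1
    rw [hb, zero_mul]
    exact le_antisymm ((h.admissible π hπ).nonneg s a) h1
  · rw [mul_div_cancel₀ _ hb]

lemma rewardBound_pos [Nonempty S] (h : Standing κ M γ b μb Adm φ C) : 0 < κ.rewardBound := by
  obtain ⟨s⟩ := ‹Nonempty S›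
  obtain ⟨a, -, -⟩ := Finset.exists_ne_zero_of_sum_ne_zero
    (by rw [h.behavior.sum_one s]; exact one_ne_zero : ∑ a, b s a ≠ 0)
  obtain ⟨r, -, hr⟩ := Finset.exists_ne_zero_of_sum_ne_zero
    (by rw [M.rew_sum s a]; exact one_ne_zero : ∑ r, M.rew s a r ≠ 0)
  exact (abs_nonneg _).trans_lt (h.reward_bound s a r ((M.rew_nonneg s a r).lt_of_ne' hr))

lemma abs_meanReward_le [Nonempty S] (h : Standing κ M γ b μb Adm φ C) (hπ : π ∈ Adm) (s : S) :
    |M.meanReward π s| ≤ κ.rewardBound := by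
  have hp := h.admissible π hπ
  calc |M.meanReward π s| ≤ ∑ a, ∑ r : R, |π s a * M.rew s a r * (r : ℝ)| :=
        (Finset.abs_sum_le_sum_abs _ _).trans
          (Finset.sum_le_sum fun a _ => Finset.abs_sum_le_sum_abs _ _)
    _ ≤ ∑ a, ∑ r : R, π s a * M.rew s a r * κ.rewardBound := by
        refine Finset.sum_le_sum fun a _ => Finset.sum_le_sum fun r _ => ?_
        have h0 := mul_nonneg (hp.nonneg s a) (M.rew_nonneg s a r)
        rw [abs_mul, abs_of_nonneg h0]
        rcases (M.rew_nonneg s a r).eq_or_lt' with h1 | h1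
        · rw [h1]; simp
        · exact mul_le_mul_of_nonneg_left (h.reward_bound s a r h1).le h0
    _ = κ.rewardBound := by
        simp_rw [← Finset.sum_mul, ← Finset.mul_sum, M.rew_sum, mul_one, hp.sum_one, one_mul]

lemma norm_nextFeature_le (h : Standing κ M γ b μb Adm φ C) (hπ : π ∈ Adm) (s : S) :
    ‖M.nextFeature φ π s‖ ≤ κ.featureBound := by
  have hP := M.trans_isStochastic (h.admissible π hπ)
  calc ‖M.nextFeature φ π s‖ ≤ ∑ s', ‖M.trans π s s' • φ s'‖ := norm_sum_le _ _
    _ ≤ ∑ s', M.trans π s s' * κ.featureBound := Finset.sum_le_sum fun s' _ => by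
        rw [norm_smul, Real.norm_eq_abs, abs_of_nonneg (hP.nonneg s s')]
        exact mul_le_mul_of_nonneg_left (h.feature_bound s') (hP.nonneg s s')
    _ = _ := by rw [← Finset.sum_mul, hP.sum_one, one_mul]

end Standing

/-- Bound on the temporal differences. -/
def Constants.residualBound (κ : Constants) : ℝ :=
  κ.rewardBound + 2 * κ.featureBound * κ.radius

/-- Bound on the exact update directions. -/
def Constants.dirBound (κ : Constants) : ℝ :=
  2 * κ.shift * κ.residualBound * κ.featureBound

/-- Lipschitz constant of the exact update directions. -/
def Constants.dirLip (κ : Constants) : ℝ :=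
  4 * κ.shift * κ.featureBound ^ 2

/-- Lipschitz constant of the residual with respect to the estimation errors. -/
def Constants.residualErr (κ : Constants) : ℝ :=
  κ.rewardCard * κ.rewardBound + κ.shift * κ.featureBound * κ.radius

/-- Lipschitz constant of the update directions with respect to the estimation errors. -/
def Constants.dirErr (κ : Constants) : ℝ :=
  2 * κ.shift * (κ.residualErr + κ.residualBound) * κ.featureBound

lemma norm_smul_sub_le (h0 : 0 ≤ γ) (h1 : γ ≤ 1) {x y : EuclideanSpace ℝ (Fin d)} {K L : ℝ}
    (hx : ‖x‖ ≤ K) (hy : ‖y‖ ≤ L) : ‖γ • x - y‖ ≤ K + L := by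
  refine (norm_sub_le _ _).trans (add_le_add ?_ hy)
  rw [norm_smul, Real.norm_eq_abs, abs_of_nonneg h0]
  exact (mul_le_of_le_one_left (norm_nonneg _) h1).trans hx

lemma abs_inner_le_mul {x y : EuclideanSpace ℝ (Fin d)} {K L : ℝ}
    (hx : ‖x‖ ≤ K) (hy : ‖y‖ ≤ L) : |inner ℝ x y| ≤ K * L :=
  (abs_real_inner_le_norm x y).trans
    (mul_le_mul hx hy (norm_nonneg _) ((norm_nonneg _).trans hx))

lemma td_eq_inner (r : ℝ) (θ : EuclideanSpace ℝ (Fin d)) (s s' : S) :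
    r + γ * linValue φ θ s' - linValue φ θ s = r + inner ℝ (γ • φ s' - φ s) θ := by
  simp only [linValue, inner_sub_left, inner_smul_left, RCLike.conj_to_real]; ring

lemma abs_td_le (h0 : 0 ≤ γ) (h1 : γ ≤ 1) {r : ℝ}
    (hr : |r| ≤ κ.rewardBound) {θ x y : EuclideanSpace ℝ (Fin d)} (hθ : ‖θ‖ ≤ κ.radius)
    (hx : ‖x‖ ≤ κ.featureBound) (hy : ‖y‖ ≤ κ.featureBound) :
    |r + inner ℝ (γ • x - y) θ| ≤ κ.residualBound := by
  refine (abs_add_le _ _).trans (add_le_add hr ?_)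
  rw [two_mul]
  exact abs_inner_le_mul (norm_smul_sub_le h0 h1 hx hy) hθ

namespace Standing

variable [Nonempty S]

lemma residualBound_pos (h : Standing κ M γ b μb Adm φ C) : 0 < κ.residualBound :=
  add_pos h.rewardBound_pos (mul_pos (mul_pos two_pos κ.featureBound_pos) κ.radius_pos)

lemma dirBound_pos (h : Standing κ M γ b μb Adm φ C) : 0 < κ.dirBound :=
  mul_pos (mul_pos (mul_pos two_pos κ.shift_pos) h.residualBound_pos) κ.featureBound_pos

lemma residualErr_pos (h : Standing κ M γ b μb Adm φ C) : 0 < κ.residualErr :=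
  add_pos_of_nonneg_of_pos (mul_nonneg (Nat.cast_nonneg _) h.rewardBound_pos.le)
    (mul_pos (mul_pos κ.shift_pos κ.featureBound_pos) κ.radius_pos)

lemma dirErr_pos (h : Standing κ M γ b μb Adm φ C) : 0 < κ.dirErr :=
  mul_pos (mul_pos (mul_pos two_pos κ.shift_pos) (add_pos h.residualErr_pos h.residualBound_pos))
    κ.featureBound_pos

lemma abs_residual_le (h : Standing κ M γ b μb Adm φ C) (h0 : 0 ≤ γ) (h1 : γ ≤ 1) (hπ : π ∈ Adm)
    {θ : EuclideanSpace ℝ (Fin d)} (hθ : ‖θ‖ ≤ κ.radius) (s : S) :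
    |residual γ φ (M.meanReward π) (M.nextFeature φ π) θ s| ≤ κ.residualBound :=
  abs_td_le h0 h1 (h.abs_meanReward_le hπ s) hθ (h.norm_nextFeature_le hπ s) (h.feature_bound s)

/-- The exact direction is bounded, for parameters in the feasibility set. -/
lemma norm_direction_le (h : Standing κ M γ b μb Adm φ C) (h0 : 0 ≤ γ) (h1 : γ ≤ 1)
    (hπ : π ∈ Adm) (m : Method) {θ : EuclideanSpace ℝ (Fin d)} (hθ : ‖θ‖ ≤ κ.radius)
    {z : Sample S A R} (hz : |(z.r : ℝ)| ≤ κ.rewardBound) :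
    ‖direction m γ φ b π (M.meanReward π) (M.nextFeature φ π) μb θ z‖ ≤ κ.dirBound := by
  have hF := κ.featureBound_pos
  have hR := h.residualBound_pos
  have hres := h.abs_residual_le h0 h1 hπ hθ z.s
  have h1s := h.one_le_shift hπ
  have e : κ.dirBound = κ.shift * κ.residualBound * (κ.featureBound + κ.featureBound) := by
    rw [Constants.dirBound]; ring
  cases m with
  | directSGD =>
    rw [e, direction, norm_smul, Real.norm_eq_abs]
    refine mul_le_mul (hres.trans (le_mul_of_one_le_left hR.le h1s)) (norm_smul_sub_le h0 h1
      (h.norm_nextFeature_le hπ _) (h.feature_bound _)) (norm_nonneg _) (by positivity)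
  | tdSGD =>
    rw [e, direction, norm_smul, Real.norm_eq_abs, abs_mul,
      abs_of_nonneg (h.ratio_nonneg hπ _ _)]
    exact mul_le_mul (mul_le_mul (h.ratio_le_shift hπ _ _) hres (abs_nonneg _) κ.shift_pos.le)
      (norm_smul_sub_le h0 h1 (h.feature_bound _) (h.feature_bound _)) (norm_nonneg _)
      (mul_nonneg κ.shift_pos.le hR.le)
  | td0 =>
    rw [e, direction, norm_neg, norm_smul, Real.norm_eq_abs, abs_mul, td_eq_inner]
    -- The factor `μb` in the bound on the ratio cancels the weight `1 / μb`, so TD(0) obeys the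
    -- same bound as the other updates.
    have hw : |1 / μb z.s * (π z.s z.a / b z.s z.a)| ≤ κ.shift := by
      have hμ := h.stat_pos hπ z.s
      rw [abs_of_nonneg (mul_nonneg (one_div_nonneg.2 hμ.le) (h.ratio_nonneg hπ _ _)),
        one_div_mul_eq_div, div_le_iff₀ hμ]
      exact h.ratio_le hπ _ _
    refine mul_le_mul (mul_le_mul hw (abs_td_le h0 h1 hz hθ (h.feature_bound _)
      (h.feature_bound _)) (abs_nonneg _) κ.shift_pos.le) ?_ (norm_nonneg _)
      (mul_nonneg κ.shift_pos.le hR.le)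
    linarith [h.feature_bound z.s]

lemma norm_direction_sub_le (h : Standing κ M γ b μb Adm φ C) (h0 : 0 ≤ γ) (h1 : γ ≤ 1)
    (hπ : π ∈ Adm) (m : Method) (θ θ' : EuclideanSpace ℝ (Fin d)) (z : Sample S A R) :
    ‖direction m γ φ b π (M.meanReward π) (M.nextFeature φ π) μb θ z
      - direction m γ φ b π (M.meanReward π) (M.nextFeature φ π) μb θ' z‖
      ≤ κ.dirLip * ‖θ - θ'‖ := by
  have hF := κ.featureBound_pos
  have h1s := h.one_le_shift hπ
  have hC := κ.shift_pos
  have e : κ.dirLip * ‖θ - θ'‖ = κ.shift * ((κ.featureBound + κ.featureBound) * ‖θ - θ'‖)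
      * (κ.featureBound + κ.featureBound) := by
    rw [Constants.dirLip]; ring
  have aux : ∀ x y : EuclideanSpace ℝ (Fin d), ‖x‖ ≤ κ.featureBound → ‖y‖ ≤ κ.featureBound →
      |inner ℝ (γ • x - y) (θ - θ')| ≤ (κ.featureBound + κ.featureBound) * ‖θ - θ'‖ :=
    fun x y hx hy => abs_inner_le_mul (norm_smul_sub_le h0 h1 hx hy) le_rfl
  have hres : |residual γ φ (M.meanReward π) (M.nextFeature φ π) θ z.s
      - residual γ φ (M.meanReward π) (M.nextFeature φ π) θ' z.s|
        ≤ (κ.featureBound + κ.featureBound) * ‖θ - θ'‖ := by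
    rw [residual, residual, add_sub_add_left_eq_sub, ← inner_sub_right]
    exact aux _ _ (h.norm_nextFeature_le hπ _) (h.feature_bound _)
  cases m with
  | directSGD =>
    rw [e, direction, direction, ← sub_smul, norm_smul, Real.norm_eq_abs]
    refine mul_le_mul (hres.trans (le_mul_of_one_le_left (by positivity) h1s))
      (norm_smul_sub_le h0 h1 (h.norm_nextFeature_le hπ _) (h.feature_bound _)) (norm_nonneg _)
      (by positivity)
  | tdSGD =>
    rw [e, direction, direction, ← sub_smul, ← mul_sub, norm_smul, Real.norm_eq_abs, abs_mul,
      abs_of_nonneg (h.ratio_nonneg hπ _ _)]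
    exact mul_le_mul (mul_le_mul (h.ratio_le_shift hπ _ _) hres (abs_nonneg _) κ.shift_pos.le)
      (norm_smul_sub_le h0 h1 (h.feature_bound _) (h.feature_bound _)) (norm_nonneg _)
      (by positivity)
  | td0 =>
    rw [e, direction, direction, ← neg_sub_neg, neg_neg, neg_neg, ← sub_smul, ← mul_sub,
      norm_smul, Real.norm_eq_abs, abs_mul, td_eq_inner, td_eq_inner, add_sub_add_left_eq_sub,
      ← inner_sub_right, norm_sub_rev θ θ']
    have hw : |1 / μb z.s * (π z.s z.a / b z.s z.a)| ≤ κ.shift := by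
      have hμ := h.stat_pos hπ z.s
      rw [abs_of_nonneg (mul_nonneg (one_div_nonneg.2 hμ.le) (h.ratio_nonneg hπ _ _)),
        one_div_mul_eq_div, div_le_iff₀ hμ]
      exact h.ratio_le hπ _ _
    refine mul_le_mul (mul_le_mul hw (abs_inner_le_mul (norm_smul_sub_le h0 h1 (h.feature_bound _)
      (h.feature_bound _)) le_rfl) (abs_nonneg _) κ.shift_pos.le) ?_ (norm_nonneg _)
      (by positivity)
    linarith [h.feature_bound z.s]

/-- Effect of the estimation errors on the direction. -/
lemma norm_direction_sub_exact_le (h : Standing κ M γ b μb Adm φ C) (h0 : 0 ≤ γ) (h1 : γ ≤ 1)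
    (hπ : π ∈ Adm) (m : Method) {θ : EuclideanSpace ℝ (Fin d)} (hθ : ‖θ‖ ≤ κ.radius)
    {z : Sample S A R} (hz : |(z.r : ℝ)| ≤ κ.rewardBound) {ξ : S → ℝ}
    {ψ : S → EuclideanSpace ℝ (Fin d)} {μ : S → ℝ} {e : ℝ}
    (hξ : |ξ z.s - M.meanReward π z.s| ≤ κ.rewardCard * κ.rewardBound * e)
    (hψ : ‖ψ z.s - M.nextFeature φ π z.s‖ ≤ κ.shift * κ.featureBound * e)
    (hψ' : ‖ψ z.s‖ ≤ κ.shift * κ.featureBound) (hμ : |1 / μ z.s - 1 / μb z.s| ≤ e) :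
    ‖direction m γ φ b π ξ ψ μ θ z
      - direction m γ φ b π (M.meanReward π) (M.nextFeature φ π) μb θ z‖ ≤ κ.dirErr * e := by
  have hF := κ.featureBound_pos
  have h1s := h.one_le_shift hπ
  have hC := κ.shift_pos
  have hR := h.residualBound_pos
  have hE := h.residualErr_pos
  have he : 0 ≤ e := (abs_nonneg _).trans hμ
  have hres := h.abs_residual_le h0 h1 hπ hθ z.s
  have hd : |residual γ φ ξ ψ θ z.s - residual γ φ (M.meanReward π) (M.nextFeature φ π) θ z.s|
      ≤ κ.residualErr * e := by
    have e1 : residual γ φ ξ ψ θ z.s - residual γ φ (M.meanReward π) (M.nextFeature φ π) θ z.s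
        = (ξ z.s - M.meanReward π z.s) + inner ℝ (γ • (ψ z.s - M.nextFeature φ π z.s) - 0) θ := by
      simp only [residual, inner_sub_left, smul_sub, inner_zero_left]; ring
    have e2 : κ.residualErr * e = κ.rewardCard * κ.rewardBound * e
        + (κ.shift * κ.featureBound * e + 0) * κ.radius := by
      rw [Constants.residualErr]; ring
    rw [e1, e2]
    exact (abs_add_le _ _).trans (add_le_add hξ
      (abs_inner_le_mul (norm_smul_sub_le h0 h1 hψ norm_zero.le) hθ))
  cases m with
  | directSGD =>
    simp only [direction]
    -- Product rule: the residual error multiplies the estimated feature, and the exact residual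
    -- multiplies the feature error. The subtracted zero fits the format of `norm_smul_sub_le`.
    have e1 : residual γ φ ξ ψ θ z.s • (γ • ψ z.s - φ z.s)
        - residual γ φ (M.meanReward π) (M.nextFeature φ π) θ z.s
          • (γ • M.nextFeature φ π z.s - φ z.s)
        = (residual γ φ ξ ψ θ z.s - residual γ φ (M.meanReward π) (M.nextFeature φ π) θ z.s)
          • (γ • ψ z.s - φ z.s) + residual γ φ (M.meanReward π) (M.nextFeature φ π) θ z.s
          • (γ • (ψ z.s - M.nextFeature φ π z.s) - 0) := by
      module
    rw [e1]
    calc _ ≤ κ.residualErr * e * (κ.shift * κ.featureBound + κ.featureBound)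
          + κ.residualBound * (κ.shift * κ.featureBound * e + 0) := by
          refine (norm_add_le _ _).trans (add_le_add ?_ ?_) <;>
            rw [norm_smul, Real.norm_eq_abs]
          · exact mul_le_mul hd (norm_smul_sub_le h0 h1 hψ' (h.feature_bound _)) (norm_nonneg _)
              (by positivity)
          · exact mul_le_mul hres (norm_smul_sub_le h0 h1 hψ norm_zero.le) (norm_nonneg _) hR.le
      _ ≤ _ := by
          have a1 : κ.residualErr * e * κ.featureBound
              ≤ κ.shift * (κ.residualErr * e * κ.featureBound) :=
            le_mul_of_one_le_left (by positivity) h1s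
          have a2 : 0 ≤ κ.shift * κ.residualBound * κ.featureBound * e := by positivity
          rw [Constants.dirErr]
          linarith
  | tdSGD =>
    simp only [direction]
    rw [← sub_smul, ← mul_sub, norm_smul, Real.norm_eq_abs, abs_mul,
      abs_of_nonneg (h.ratio_nonneg hπ _ _)]
    calc _ ≤ κ.shift * (κ.residualErr * e) * (κ.featureBound + κ.featureBound) :=
          mul_le_mul (mul_le_mul (h.ratio_le_shift hπ _ _) hd (abs_nonneg _) hC.le)
            (norm_smul_sub_le h0 h1 (h.feature_bound _) (h.feature_bound _)) (norm_nonneg _)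
            (by positivity)
      _ ≤ _ := by
          have a2 : 0 ≤ κ.shift * κ.residualBound * κ.featureBound * e := by positivity
          rw [Constants.dirErr]
          linarith
  | td0 =>
    simp only [direction]
    rw [← neg_sub_neg, neg_neg, neg_neg, ← sub_smul, ← sub_mul, ← sub_mul, norm_smul,
      Real.norm_eq_abs, abs_mul, abs_mul, td_eq_inner, abs_sub_comm,
      abs_of_nonneg (h.ratio_nonneg hπ _ _)]
    calc _ ≤ e * κ.shift * κ.residualBound * κ.featureBound :=
          mul_le_mul (mul_le_mul (mul_le_mul hμ (h.ratio_le_shift hπ _ _)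
            (h.ratio_nonneg hπ _ _) he) (abs_td_le h0 h1 hz hθ (h.feature_bound _)
            (h.feature_bound _)) (abs_nonneg _) (by positivity)) (h.feature_bound _)
            (norm_nonneg _) (by positivity)
      _ ≤ _ := by
          have a1 : 0 ≤ κ.shift * κ.residualErr * κ.featureBound * e := by positivity
          have a2 : 0 ≤ κ.shift * κ.residualBound * κ.featureBound * e := by positivity
          rw [Constants.dirErr]
          linarith

end Standing

end Bounds

/-! ### Estimated directions -/

section Estimates

variable {S A : Type*} [Fintype S] [DecidableEq S] [Fintype A] [DecidableEq A] {R : Finset ℝ}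
  {d : ℕ} {κ : Constants} {M : MDP S A R} {γ : ℝ} {b : S → A → ℝ} {μb : S → ℝ}
  {Adm : Set (S → A → ℝ)} {φ : S → EuclideanSpace ℝ (Fin d)}
  {C : Set (EuclideanSpace ℝ (Fin d))} {π : S → A → ℝ}

lemma estTrans_nonneg (hπ : IsPolicy π) (z : ℕ → Sample S A R) (t : ℕ) (s s' : S) :
    0 ≤ estTrans z π t s s' :=
  Finset.sum_nonneg fun a _ => mul_nonneg (hπ.nonneg s a) (div_nonneg
    (Finset.sum_nonneg fun l _ => by split_ifs <;> norm_num)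
    (Finset.sum_nonneg fun l _ => by split_ifs <;> norm_num))

lemma estTrans_le_one (hπ : IsPolicy π) (z : ℕ → Sample S A R) (t : ℕ) (s s' : S) :
    estTrans z π t s s' ≤ 1 :=
  calc estTrans z π t s s' ≤ ∑ a, π s a * 1 := by
        refine Finset.sum_le_sum fun a _ => mul_le_mul_of_nonneg_left (div_le_one_of_le₀ ?_ ?_)
          (hπ.nonneg s a)
        · refine Finset.sum_le_sum fun l _ => ?_
          by_cases h1 : (z l).s = s <;> by_cases h2 : (z l).a = a <;>
            by_cases h3 : (z l).s' = s' <;> simp [h1, h2, h3]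
        · exact Finset.sum_nonneg fun l _ => by split_ifs <;> norm_num
    _ = 1 := by simp [hπ.sum_one]

/-- Passing from a uniform error in the transition probabilities to an error in the mean feature
costs the number of states, which is at most `κ.shift`. -/
lemma norm_sum_smul_feature_le (h : Standing κ M γ b μb Adm φ C) (hπ : π ∈ Adm) {q : S → ℝ}
    {e : ℝ} (he : 0 ≤ e) (hq : ∀ s, |q s| ≤ e) :
    ‖∑ s, q s • φ s‖ ≤ κ.shift * κ.featureBound * e :=
  calc ‖∑ s, q s • φ s‖ ≤ ∑ s, ‖q s • φ s‖ := norm_sum_le _ _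
    _ ≤ ∑ _s : S, e * κ.featureBound := Finset.sum_le_sum fun s _ => by
        rw [norm_smul, Real.norm_eq_abs]
        exact mul_le_mul (hq s) (h.feature_bound s) (norm_nonneg _) he
    _ = Fintype.card S * (e * κ.featureBound) := by simp
    _ ≤ κ.shift * (e * κ.featureBound) :=
        mul_le_mul_of_nonneg_right (h.card_le hπ) (mul_nonneg he κ.featureBound_pos.le)
    _ = _ := by ring

/-- The sum over rewards costs the cardinality of `R`. Elements of `R` need not satisfy the reward
bound, but those violating it contribute nothing. -/
lemma abs_sum_estRew_sub_le [Nonempty S] (h : Standing κ M γ b μb Adm φ C)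
    {z : ℕ → Sample S A R} {t : ℕ} (hz : ∀ l ≤ t, |((z l).r : ℝ)| < κ.rewardBound) {s : S} {e : ℝ}
    (he : 0 ≤ e) (hr : ∀ r : R, |estRew z π t s r - ∑ a, π s a * M.rew s a r| ≤ e) :
    |∑ r : R, (r : ℝ) * estRew z π t s r - M.meanReward π s|
      ≤ κ.rewardCard * κ.rewardBound * e := by
  have e1 : M.meanReward π s = ∑ r : R, (r : ℝ) * ∑ a, π s a * M.rew s a r := by
    rw [MDP.meanReward, Finset.sum_comm]
    refine Finset.sum_congr rfl fun r _ => ?_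
    rw [Finset.mul_sum]
    exact Finset.sum_congr rfl fun a _ => by ring
  rw [e1, ← Finset.sum_sub_distrib]
  calc _ ≤ ∑ r : R, |(r : ℝ) * estRew z π t s r - (r : ℝ) * ∑ a, π s a * M.rew s a r| :=
        Finset.abs_sum_le_sum_abs _ _
    _ ≤ ∑ _r : R, κ.rewardBound * e := by
        refine Finset.sum_le_sum fun r _ => ?_
        rw [← mul_sub, abs_mul]
        by_cases hr' : |(r : ℝ)| < κ.rewardBound
        · exact mul_le_mul hr'.le (hr r) (abs_nonneg _) h.rewardBound_pos.le
        -- A reward value outside the bound is never observed and has probability zero, so both its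
        -- estimate and its exact probability vanish.
        · have z1 : estRew z π t s r = 0 := by
            rw [estRew]
            refine Finset.sum_eq_zero fun a _ => ?_
            rw [Finset.sum_eq_zero, zero_div, mul_zero]
            intro l hl
            rw [if_neg]
            rintro ⟨-, -, h3⟩
            exact hr' (h3 ▸ hz l (Finset.mem_range_succ_iff.1 hl))
          have z2 : ∑ a, π s a * M.rew s a r = 0 := by
            refine Finset.sum_eq_zero fun a _ => ?_
            rcases (M.rew_nonneg s a r).eq_or_lt' with h1 | h1
            · rw [h1, mul_zero]
            · exact absurd (h.reward_bound s a r h1) hr'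
          rw [z1, z2, sub_zero, abs_zero, mul_zero]
          exact mul_nonneg h.rewardBound_pos.le he
    _ = R.card * (κ.rewardBound * e) := by simp
    _ ≤ κ.rewardCard * (κ.rewardBound * e) :=
        mul_le_mul_of_nonneg_right (by exact_mod_cast h.reward_card)
          (mul_nonneg h.rewardBound_pos.le he)
    _ = _ := by ring

lemma Standing.norm_estDirection_sub_le [Nonempty S] (h : Standing κ M γ b μb Adm φ C)
    (h0 : 0 ≤ γ) (h1 : γ ≤ 1) (hπ : π ∈ Adm) (m : Method) {θ : EuclideanSpace ℝ (Fin d)}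
    (hθ : ‖θ‖ ≤ κ.radius) {z : ℕ → Sample S A R} {t : ℕ}
    (hz : ∀ l ≤ t, |((z l).r : ℝ)| < κ.rewardBound) {e : ℝ}
    (hT : ∀ s', |estTrans z π t (z t).s s' - M.trans π (z t).s s'| ≤ e)
    (hR : ∀ r : R, |estRew z π t (z t).s r - ∑ a, π (z t).s a * M.rew (z t).s a r| ≤ e)
    (hμ : |1 / estStat z t (z t).s - 1 / μb (z t).s| ≤ e) :
    ‖estDirection m γ φ b π z t θ
      - direction m γ φ b π (M.meanReward π) (M.nextFeature φ π) μb θ (z t)‖ ≤ κ.dirErr * e := by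
  have he : 0 ≤ e := (abs_nonneg _).trans hμ
  refine h.norm_direction_sub_exact_le h0 h1 hπ m hθ (hz t le_rfl).le
    (abs_sum_estRew_sub_le h hz he hR) ?_ ?_ hμ
  · rw [MDP.nextFeature, ← Finset.sum_sub_distrib]
    simp_rw [← sub_smul]
    exact norm_sum_smul_feature_le h hπ he hT
  · have hp := h.admissible π hπ
    simpa using norm_sum_smul_feature_le h hπ zero_le_one fun s' => by
      rw [abs_of_nonneg (estTrans_nonneg hp z t (z t).s s')]
      exact estTrans_le_one hp z t (z t).s s'

end Estimates

/-! ### Averages over one transition, and the drift of the squared distance to a solution -/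

section Averages

variable {S A : Type*} [Fintype S] [Fintype A] {R : Finset ℝ} (M : MDP S A R) (b : S → A → ℝ)

/-- The conditional mean of `F(z)` given the state, when the action is drawn from `b`. -/
def MDP.condMean (F : Sample S A R → ℝ) (s : S) : ℝ :=
  ∑ a, ∑ r : R, ∑ s', (b s a * M.rew s a r * M.P s a s') * F ⟨s, a, r, s'⟩

/-- The mean of `F(z)` when the state has law `μ` and the action is drawn from `b`. -/
def MDP.stateMean (μ : S → ℝ) (F : Sample S A R → ℝ) : ℝ := ∑ s, μ s * M.condMean b F s

variable {b}

lemma MDP.sum_weights (hb : IsPolicy b) (s : S) :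
    ∑ a, ∑ r : R, ∑ s', b s a * M.rew s a r * M.P s a s' = 1 := by
  simp_rw [← Finset.mul_sum, M.P_sum, mul_one, ← Finset.mul_sum, M.rew_sum, mul_one, hb.sum_one]

lemma MDP.condMean_const (hb : IsPolicy b) (x : ℝ) (s : S) : M.condMean b (fun _ => x) s = x := by
  simp_rw [MDP.condMean, ← Finset.sum_mul, M.sum_weights hb, one_mul]

lemma MDP.abs_condMean_le (hb : IsPolicy b) {F : Sample S A R → ℝ} {L : ℝ} {s : S}
    (hF : ∀ a r s', 0 < M.rew s a r → |F ⟨s, a, r, s'⟩| ≤ L) : |M.condMean b F s| ≤ L := by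
  rw [← M.condMean_const hb L s, MDP.condMean, MDP.condMean]
  refine (Finset.abs_sum_le_sum_abs _ _).trans (Finset.sum_le_sum fun a _ => ?_)
  refine (Finset.abs_sum_le_sum_abs _ _).trans (Finset.sum_le_sum fun r _ => ?_)
  refine (Finset.abs_sum_le_sum_abs _ _).trans (Finset.sum_le_sum fun s' _ => ?_)
  have h0 : 0 ≤ b s a * M.rew s a r * M.P s a s' :=
    mul_nonneg (mul_nonneg (hb.nonneg s a) (M.rew_nonneg s a r)) (M.P_nonneg s a s')
  rw [abs_mul, abs_of_nonneg h0]
  rcases (M.rew_nonneg s a r).eq_or_lt' with h1 | h1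
  · rw [h1]; simp
  · exact mul_le_mul_of_nonneg_left (hF a r s' h1) h0

lemma MDP.condMean_sub (F G : Sample S A R → ℝ) (s : S) :
    M.condMean b (fun z => F z - G z) s = M.condMean b F s - M.condMean b G s := by
  simp_rw [MDP.condMean, mul_sub, Finset.sum_sub_distrib]

lemma MDP.stateMean_sub (μ : S → ℝ) (F G : Sample S A R → ℝ) :
    M.stateMean b μ (fun z => F z - G z) = M.stateMean b μ F - M.stateMean b μ G := by
  simp_rw [MDP.stateMean, M.condMean_sub, mul_sub, Finset.sum_sub_distrib]

lemma MDP.stateMean_const (hb : IsPolicy b) {μ : S → ℝ} (hμ : ∑ s, μ s = 1) (x : ℝ) :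
    M.stateMean b μ (fun _ => x) = x := by
  simp_rw [MDP.stateMean, M.condMean_const hb, ← Finset.sum_mul, hμ, one_mul]

lemma MDP.abs_stateMean_le (hb : IsPolicy b) {μ : S → ℝ} (hμ0 : ∀ s, 0 ≤ μ s) (hμ : ∑ s, μ s = 1)
    {F : Sample S A R → ℝ} {L : ℝ} (hF : ∀ z, 0 < M.rew z.s z.a z.r → |F z| ≤ L) :
    |M.stateMean b μ F| ≤ L :=
  calc |M.stateMean b μ F| ≤ ∑ s, |μ s * M.condMean b F s| := Finset.abs_sum_le_sum_abs _ _
    _ ≤ ∑ s, μ s * L := Finset.sum_le_sum fun s _ => by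
        rw [abs_mul, abs_of_nonneg (hμ0 s)]
        exact mul_le_mul_of_nonneg_left (M.abs_condMean_le hb fun a r s' h => hF _ h) (hμ0 s)
    _ = L := by rw [← Finset.sum_mul, hμ, one_mul]

end Averages

/-! ### Drift of the squared distance: exact form, bounds and centering. -/

section Pairing

variable {S A : Type*} [Fintype S] [DecidableEq S] [Fintype A] [DecidableEq A] {R : Finset ℝ}
  {d : ℕ} {κ : Constants} {M : MDP S A R} {γ : ℝ} {b : S → A → ℝ} {μb : S → ℝ}
  {Adm : Set (S → A → ℝ)} {φ : S → EuclideanSpace ℝ (Fin d)}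
  {C : Set (EuclideanSpace ℝ (Fin d))} {π : S → A → ℝ}

/-- The inner product of `θ - θ*` with the exact direction at `θ`, expressed through the values
`v = V_{θ*}`. -/
def MDP.pairing (M : MDP S A R) (m : Method) (γ : ℝ) (φ : S → EuclideanSpace ℝ (Fin d))
    (b : S → A → ℝ) (μ : S → ℝ) (π : S → A → ℝ) (v : S → ℝ) (θ : EuclideanSpace ℝ (Fin d))
    (z : Sample S A R) : ℝ :=
  match m with
  | .directSGD => residual γ φ (M.meanReward π) (M.nextFeature φ π) θ z.s *
      (γ * ∑ s', M.trans π z.s s' * (linValue φ θ s' - v s') - (linValue φ θ z.s - v z.s))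
  | .tdSGD => (π z.s z.a / b z.s z.a *
      residual γ φ (M.meanReward π) (M.nextFeature φ π) θ z.s) *
      (γ * (linValue φ θ z.s' - v z.s') - (linValue φ θ z.s - v z.s))
  | .td0 => -((1 / μ z.s * (π z.s z.a / b z.s z.a) *
      ((z.r : ℝ) + γ * linValue φ θ z.s' - linValue φ θ z.s)) * (linValue φ θ z.s - v z.s))

lemma inner_sub_feature (θ θs : EuclideanSpace ℝ (Fin d)) (s : S) :
    inner ℝ (θ - θs) (φ s) = linValue φ θ s - linValue φ θs s := by
  rw [real_inner_comm, inner_sub_right, linValue, linValue]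

lemma inner_sub_nextFeature (θ θs : EuclideanSpace ℝ (Fin d)) (s : S) :
    inner ℝ (θ - θs) (M.nextFeature φ π s)
      = ∑ s', M.trans π s s' * (linValue φ θ s' - linValue φ θs s') := by
  simp_rw [MDP.nextFeature, inner_sum, inner_smul_right, inner_sub_feature]

/-- The right side involves the solution only through its values `v`. This matters when the policy
is random: `v` can be taken measurable in the policy, while `θs` need not be. -/
lemma inner_direction_eq_pairing (m : Method) {θs : EuclideanSpace ℝ (Fin d)} {v : S → ℝ}
    (hv : ∀ s, linValue φ θs s = v s) (θ : EuclideanSpace ℝ (Fin d)) (z : Sample S A R) :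
    inner ℝ (θ - θs) (direction m γ φ b π (M.meanReward π) (M.nextFeature φ π) μb θ z)
      = M.pairing m γ φ b μb π v θ z := by
  cases m <;> simp only [direction, MDP.pairing, inner_neg_right, inner_smul_right,
    inner_sub_right (𝕜 := ℝ) (θ - θs)]
  · simp_rw [inner_sub_nextFeature, inner_sub_feature, hv]
  · simp_rw [inner_sub_feature, hv]
  · simp_rw [inner_sub_feature, hv]

lemma inner_meanDirection_eq_stateMean (m : Method) {θs : EuclideanSpace ℝ (Fin d)} {v : S → ℝ}
    (hv : ∀ s, linValue φ θs s = v s) (θ : EuclideanSpace ℝ (Fin d)) :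
    inner ℝ (θ - θs) (M.meanDirection m γ φ b μb π θ)
      = M.stateMean b μb (M.pairing m γ φ b μb π v θ) := by
  simp_rw [MDP.meanDirection, MDP.stateMean, MDP.condMean, inner_sum, inner_smul_right,
    inner_direction_eq_pairing m hv, Finset.mul_sum]
  refine Finset.sum_congr rfl fun s _ => Finset.sum_congr rfl fun a _ =>
    Finset.sum_congr rfl fun r _ => Finset.sum_congr rfl fun s' _ => by ring

/-- Subtracting the Bellman equation of `θs` removes the reward, so the residual becomes linear in
the value error. This is the reason why drift and loss agree up to a factor. -/
lemma residual_eq_of_solvesBellman {θs : EuclideanSpace ℝ (Fin d)}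
    (hs : M.SolvesBellman γ φ π θs) (θ : EuclideanSpace ℝ (Fin d)) (s : S) :
    residual γ φ (M.meanReward π) (M.nextFeature φ π) θ s
      = γ * ∑ s', M.trans π s s' * (linValue φ θ s' - linValue φ θs s')
        - (linValue φ θ s - linValue φ θs s) := by
  have h1 := hs s
  rw [MDP.bellman] at h1
  have h2 : inner ℝ (M.nextFeature φ π s) θ = ∑ s', M.trans π s s' * linValue φ θ s' := by
    simp_rw [MDP.nextFeature, sum_inner, real_inner_smul_left, linValue]
  rw [residual, inner_sub_left, real_inner_smul_left, h2]
  simp_rw [mul_sub, Finset.sum_sub_distrib]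
  have h3 : inner ℝ (φ s) θ = linValue φ θ s := rfl
  rw [h3]
  linarith

lemma residual_eq_bellman_sub (θ : EuclideanSpace ℝ (Fin d)) (s : S) :
    residual γ φ (M.meanReward π) (M.nextFeature φ π) θ s
      = M.bellman γ π (linValue φ θ) s - linValue φ θ s := by
  have h2 : inner ℝ (M.nextFeature φ π s) θ = ∑ s', M.trans π s s' * linValue φ θ s' := by
    simp_rw [MDP.nextFeature, sum_inner, real_inner_smul_left, linValue]
  rw [residual, inner_sub_left, real_inner_smul_left, h2, MDP.bellman, linValue]
  ring

/-- For the SGD-based updates the mean drift is twice the loss. -/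
lemma Standing.stateMean_pairing_eq (h : Standing κ M γ b μb Adm φ C) (hπ : π ∈ Adm) {m : Method}
    (hm : m.IsSGD) {θs : EuclideanSpace ℝ (Fin d)} (hs : M.SolvesBellman γ φ π θs) {v : S → ℝ}
    (hv : ∀ s, linValue φ θs s = v s) (θ : EuclideanSpace ℝ (Fin d)) :
    M.stateMean b μb (M.pairing m γ φ b μb π v θ) = 2 * M.loss γ φ μb π θ := by
  rw [MDP.loss, Finset.mul_sum, MDP.stateMean]
  refine Finset.sum_congr rfl fun s _ => ?_
  have hres := residual_eq_of_solvesBellman hs θ s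
  simp_rw [hv] at hres
  suffices h1 : M.condMean b (M.pairing m γ φ b μb π v θ) s
      = residual γ φ (M.meanReward π) (M.nextFeature φ π) θ s ^ 2 by
    rw [h1]; ring
  cases m with
  | td0 => exact hm.elim
  | directSGD =>
    rw [← M.condMean_const h.behavior (residual γ φ (M.meanReward π) (M.nextFeature φ π) θ s ^ 2) s]
    simp only [MDP.condMean, MDP.pairing, ← hres]
    simp_rw [sq]
  | tdSGD =>
    simp only [MDP.condMean, MDP.pairing]
    set δ := residual γ φ (M.meanReward π) (M.nextFeature φ π) θ s with hδ
    set W : S → ℝ := fun x => linValue φ θ x - v x with hW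
    have e1 : ∀ a, ∑ r : R, ∑ s', b s a * M.rew s a r * M.P s a s' *
        (π s a / b s a * δ * (γ * W s' - W s))
        = δ * (γ * ∑ s', π s a * M.P s a s' * W s' - π s a * W s) := fun a => by
      have e2 : ∀ (r : R) s', b s a * M.rew s a r * M.P s a s' *
          (π s a / b s a * δ * (γ * W s' - W s)) =
          M.rew s a r * (δ * (γ * (π s a * M.P s a s' * W s') - M.P s a s' * (π s a * W s))) :=
        fun r s' => by
          -- Importance sampling: `b` times the ratio is `π`, so the mean under `b` turns into a
          -- mean under `π`.
          conv_rhs => rw [← h.mul_ratio hπ s a]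
          ring
      simp_rw [e2, ← Finset.mul_sum, ← Finset.sum_mul, M.rew_sum, one_mul,
        Finset.sum_sub_distrib, ← Finset.mul_sum, ← Finset.sum_mul, M.P_sum, one_mul]
    simp_rw [show ∀ x, linValue φ θ x - v x = W x from fun _ => rfl] at hres ⊢
    simp_rw [e1, ← Finset.mul_sum, Finset.sum_sub_distrib, ← Finset.mul_sum, ← Finset.sum_mul,
      (h.admissible π hπ).sum_one, one_mul]
    rw [Finset.sum_comm]
    simp_rw [← Finset.sum_mul]
    rw [sq]
    congr 1
    exact hres.symm

variable [Nonempty S]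

lemma Standing.norm_sub_le_two_mul (h : Standing κ M γ b μb Adm φ C) {θ θs : EuclideanSpace ℝ (Fin d)}
    (hθ : θ ∈ C) (hs : θs ∈ C) : ‖θ - θs‖ ≤ 2 * κ.radius := by
  linarith [norm_sub_le θ θs, h.bounded θ hθ, h.bounded θs hs]

lemma Standing.abs_pairing_le (h : Standing κ M γ b μb Adm φ C) (h0 : 0 ≤ γ) (h1 : γ ≤ 1)
    (hπ : π ∈ Adm) (m : Method) {θs : EuclideanSpace ℝ (Fin d)} {v : S → ℝ} (hs : θs ∈ C)
    (hv : ∀ s, linValue φ θs s = v s) {θ : EuclideanSpace ℝ (Fin d)} (hθ : θ ∈ C)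
    {z : Sample S A R} (hz : |(z.r : ℝ)| ≤ κ.rewardBound) :
    |M.pairing m γ φ b μb π v θ z| ≤ 2 * κ.radius * κ.dirBound := by
  rw [← inner_direction_eq_pairing m hv]
  exact abs_inner_le_mul (h.norm_sub_le_two_mul hθ hs)
    (h.norm_direction_le h0 h1 hπ m (h.bounded θ hθ) hz)

/-- Lipschitz constant of the drift. -/
def Constants.pairingLip (κ : Constants) : ℝ := κ.dirBound + 2 * κ.radius * κ.dirLip

lemma Standing.abs_pairing_sub_le (h : Standing κ M γ b μb Adm φ C) (h0 : 0 ≤ γ) (h1 : γ ≤ 1)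
    (hπ : π ∈ Adm) (m : Method) {θs : EuclideanSpace ℝ (Fin d)} {v : S → ℝ} (hs : θs ∈ C)
    (hv : ∀ s, linValue φ θs s = v s) {θ θ' : EuclideanSpace ℝ (Fin d)} (hθ : θ ∈ C) (hθ' : θ' ∈ C)
    {z : Sample S A R} (hz : |(z.r : ℝ)| ≤ κ.rewardBound) :
    |M.pairing m γ φ b μb π v θ z - M.pairing m γ φ b μb π v θ' z|
      ≤ κ.pairingLip * ‖θ - θ'‖ := by
  rw [← inner_direction_eq_pairing m hv, ← inner_direction_eq_pairing m hv]
  set g := direction m γ φ b π (M.meanReward π) (M.nextFeature φ π) μb θ z with hg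
  set g' := direction m γ φ b π (M.meanReward π) (M.nextFeature φ π) μb θ' z with hg'
  have e1 : inner ℝ (θ - θs) g - inner ℝ (θ' - θs) g'
      = inner ℝ (θ - θ') g + inner ℝ (θ' - θs) (g - g') := by
    simp only [inner_sub_left, inner_sub_right]; ring
  have e2 : κ.pairingLip * ‖θ - θ'‖
      = ‖θ - θ'‖ * κ.dirBound + 2 * κ.radius * (κ.dirLip * ‖θ - θ'‖) := by
    rw [Constants.pairingLip]; ring
  rw [e1, e2]
  exact (abs_add_le _ _).trans (add_le_add
    (abs_inner_le_mul le_rfl (h.norm_direction_le h0 h1 hπ m (h.bounded θ hθ) hz))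
    (abs_inner_le_mul (h.norm_sub_le_two_mul hθ' hs) (h.norm_direction_sub_le h0 h1 hπ m θ θ' z)))

/-- The centered drift. -/
def MDP.noise (M : MDP S A R) (m : Method) (γ : ℝ) (φ : S → EuclideanSpace ℝ (Fin d))
    (b : S → A → ℝ) (μ : S → ℝ) (π : S → A → ℝ) (v : S → ℝ) (θ : EuclideanSpace ℝ (Fin d))
    (z : Sample S A R) : ℝ :=
  M.pairing m γ φ b μ π v θ z - M.stateMean b μ (M.pairing m γ φ b μ π v θ)

lemma Standing.stateMean_noise (h : Standing κ M γ b μb Adm φ C) (m : Method) (v : S → ℝ)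
    (θ : EuclideanSpace ℝ (Fin d)) : M.stateMean b μb (M.noise m γ φ b μb π v θ) = 0 := by
  unfold MDP.noise
  rw [M.stateMean_sub, M.stateMean_const h.behavior h.stationary.sum_one, sub_self]

lemma Standing.abs_noise_le (h : Standing κ M γ b μb Adm φ C) (h0 : 0 ≤ γ) (h1 : γ ≤ 1)
    (hπ : π ∈ Adm) (m : Method) {θs : EuclideanSpace ℝ (Fin d)} {v : S → ℝ} (hs : θs ∈ C)
    (hv : ∀ s, linValue φ θs s = v s) {θ : EuclideanSpace ℝ (Fin d)} (hθ : θ ∈ C)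
    {z : Sample S A R} (hz : |(z.r : ℝ)| ≤ κ.rewardBound) :
    |M.noise m γ φ b μb π v θ z| ≤ 4 * κ.radius * κ.dirBound := by
  have a1 := h.abs_pairing_le h0 h1 hπ m hs hv hθ hz
  have a2 := M.abs_stateMean_le h.behavior h.stationary.nonneg h.stationary.sum_one
    (F := M.pairing m γ φ b μb π v θ) fun z hz =>
      h.abs_pairing_le h0 h1 hπ m hs hv hθ (h.reward_bound _ _ _ hz).le
  rw [MDP.noise]
  linarith [abs_sub (M.pairing m γ φ b μb π v θ z)
    (M.stateMean b μb (M.pairing m γ φ b μb π v θ))]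

lemma Standing.abs_noise_sub_le (h : Standing κ M γ b μb Adm φ C) (h0 : 0 ≤ γ) (h1 : γ ≤ 1)
    (hπ : π ∈ Adm) (m : Method) {θs : EuclideanSpace ℝ (Fin d)} {v : S → ℝ} (hs : θs ∈ C)
    (hv : ∀ s, linValue φ θs s = v s) {θ θ' : EuclideanSpace ℝ (Fin d)} (hθ : θ ∈ C) (hθ' : θ' ∈ C)
    {z : Sample S A R} (hz : |(z.r : ℝ)| ≤ κ.rewardBound) :
    |M.noise m γ φ b μb π v θ z - M.noise m γ φ b μb π v θ' z|
      ≤ 2 * κ.pairingLip * ‖θ - θ'‖ := by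
  have a1 := h.abs_pairing_sub_le h0 h1 hπ m hs hv hθ hθ' hz
  have a2 := M.abs_stateMean_le h.behavior h.stationary.nonneg h.stationary.sum_one
    (F := fun z => M.pairing m γ φ b μb π v θ z - M.pairing m γ φ b μb π v θ' z) fun z hz =>
      h.abs_pairing_sub_le h0 h1 hπ m hs hv hθ hθ' (h.reward_bound _ _ _ hz).le
  rw [M.stateMean_sub] at a2
  have e : M.noise m γ φ b μb π v θ z - M.noise m γ φ b μb π v θ' z
      = (M.pairing m γ φ b μb π v θ z - M.pairing m γ φ b μb π v θ' z)
        - (M.stateMean b μb (M.pairing m γ φ b μb π v θ)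
          - M.stateMean b μb (M.pairing m γ φ b μb π v θ')) := by
    rw [MDP.noise, MDP.noise]; ring
  rw [e]
  linarith [abs_sub (M.pairing m γ φ b μb π v θ z - M.pairing m γ φ b μb π v θ' z)
    (M.stateMean b μb (M.pairing m γ φ b μb π v θ)
          - M.stateMean b μb (M.pairing m γ φ b μb π v θ'))]

end Pairing

/-! ### Laws of the data -/

section Data

variable {S A : Type*} [Fintype S] [DecidableEq S] [Fintype A] [DecidableEq A] {R : Finset ℝ}

/-- A sample as a tuple. -/
def Sample.equivProd : Sample S A R ≃ S × A × R × S where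
  toFun z := (z.s, z.a, z.r, z.s')
  invFun p := ⟨p.1, p.2.1, p.2.2.1, p.2.2.2⟩
  left_inv _ := rfl
  right_inv _ := rfl

instance : Fintype (Sample S A R) := Fintype.ofEquiv _ Sample.equivProd.symm

instance : MeasurableSpace (Sample S A R) := ⊤

instance : DiscreteMeasurableSpace (Sample S A R) := ⟨fun _ => trivial⟩

lemma Sample.sum_eq (F : Sample S A R → ℝ) :
    ∑ z, F z = ∑ s, ∑ a, ∑ r : R, ∑ s', F ⟨s, a, r, s'⟩ := by
  rw [← Equiv.sum_comp Sample.equivProd.symm F]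
  simp_rw [Fintype.sum_prod_type]
  rfl

lemma MDP.condMean_eq_sum (M : MDP S A R) (b : S → A → ℝ) (F : Sample S A R → ℝ) (s : S) :
    M.condMean b F s = ∑ z : Sample S A R,
      F z * (if s = z.s then b z.s z.a * M.rew z.s z.a z.r * M.P z.s z.a z.s' else 0) := by
  rw [Sample.sum_eq, Finset.sum_eq_single s, MDP.condMean]
  · simp [mul_comm]
  · intro x _ hx
    simp [hx.symm]
  · simp

/-- The pull-out property of conditional expectation, in the form needed to replace the indicator of
an event by its conditional probability. -/
lemma integral_mul_indicator_eq {Ω : Type*} {m mΩ : MeasurableSpace Ω} {ρ : Measure Ω}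
    [IsProbabilityMeasure ρ] (hm : m ≤ mΩ) {f w : Ω → ℝ} {L : ℝ}
    (hf : Measurable[m] f) (hL : ∀ᵐ ω ∂ρ, |f ω| ≤ L) {E : Set Ω} (hE : MeasurableSet E)
    (hw : ρ⟦E | m⟧ =ᵐ[ρ] w) :
    ∫ ω, f ω * E.indicator (fun _ => (1 : ℝ)) ω ∂ρ = ∫ ω, f ω * w ω ∂ρ := by
  have hfm : Measurable f := hf.mono hm le_rfl
  have hi : Integrable (E.indicator fun _ => (1 : ℝ)) ρ :=
    (integrable_const (1 : ℝ)).indicator hE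
  have hfi : Integrable (f * E.indicator fun _ => (1 : ℝ)) ρ :=
    hi.bdd_mul (c := L) hfm.aestronglyMeasurable hL
  calc ∫ ω, f ω * E.indicator (fun _ => (1 : ℝ)) ω ∂ρ
      = ∫ ω, (ρ[f * E.indicator fun _ => (1 : ℝ)|m]) ω ∂ρ := (integral_condExp hm).symm
    _ = ∫ ω, f ω * w ω ∂ρ := by
        refine integral_congr_ae ?_
        filter_upwards [condExp_mul_of_stronglyMeasurable_left hf.stronglyMeasurable hfi hi, hw]
          with ω h1 h2
        rw [h1, Pi.mul_apply, h2]

variable {Ω : Type*} {mΩ : MeasurableSpace Ω} {ρ : Measure Ω} [IsProbabilityMeasure ρ]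
  {M : MDP S A R} {b : S → A → ℝ} {T K : ℕ} {ℱ : Filtration ℕ mΩ}
  {z : ℕ → Ω → Sample S A R}

namespace IsOfflineData

lemma measurable_sample (h : IsOfflineData M b T K ρ ℱ z) {n : ℕ} (hn : n < K * (T + 1)) :
    Measurable[ℱ (n + 1)] (z n) :=
  @measurable_to_countable' _ _ _ _ (ℱ (n + 1)) _ fun y => h.sample_adapted n hn y

lemma measurableSet_state (h : IsOfflineData M b T K ρ ℱ z) {n : ℕ} (hn : n < K * (T + 1))
    (x : S) : MeasurableSet {ω | (z n ω).s = x} :=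
  ℱ.le n _ (h.state_adapted n hn x)

lemma measurable_sample' (h : IsOfflineData M b T K ρ ℱ z) {n : ℕ} (hn : n < K * (T + 1)) :
    Measurable (z n) :=
  (h.measurable_sample hn).mono (ℱ.le _) le_rfl

/-- Averaging over one sample. -/
lemma integral_sample (h : IsOfflineData M b T K ρ ℱ z) {n : ℕ} (hn : n < K * (T + 1))
    {F : Ω → Sample S A R → ℝ} (hF : ∀ y, Measurable[ℱ n] fun ω => F ω y) {L : ℝ}
    (hL : ∀ᵐ ω ∂ρ, ∀ y, |F ω y| ≤ L) :
    ∫ ω, F ω (z n ω) ∂ρ = ∫ ω, M.condMean b (F ω) (z n ω).s ∂ρ := by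
  classical
  have hFm : ∀ y, Measurable fun ω => F ω y := fun y => (hF y).mono (ℱ.le n) le_rfl
  have hset : ∀ y, MeasurableSet {ω | z n ω = y} := fun y =>
    ℱ.le _ _ (h.sample_adapted n hn y)
  have hLy : ∀ y, ∀ᵐ ω ∂ρ, |F ω y| ≤ L := fun y => hL.mono fun ω hω => hω y
  -- There are finitely many samples, so a function of the past and of `z n` is a finite sum of
  -- past-measurable functions times indicators.
  have e1 : ∀ ω, F ω (z n ω)
      = ∑ y, F ω y * {ω | z n ω = y}.indicator (fun _ => (1 : ℝ)) ω := fun ω => by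
    rw [Finset.sum_eq_single (z n ω)]
    · simp
    · intro y _ hy
      rw [Set.indicator_of_notMem, mul_zero]
      exact fun h => hy h.symm
    · simp
  have i1 : ∀ y, Integrable (fun ω => F ω y * {ω | z n ω = y}.indicator (fun _ => (1 : ℝ)) ω) ρ :=
    fun y => ((integrable_const (1 : ℝ)).indicator (hset y)).bdd_mul (c := L)
      (hFm y).aestronglyMeasurable (hLy y)
  have i2 : ∀ y : Sample S A R, Integrable (fun ω => F ω y *
      (if (z n ω).s = y.s then b y.s y.a * M.rew y.s y.a y.r * M.P y.s y.a y.s' else 0)) ρ := by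
    intro y
    refine Integrable.bdd_mul (c := L) ?_ (hFm y).aestronglyMeasurable (hLy y)
    exact (integrable_const (b y.s y.a * M.rew y.s y.a y.r * M.P y.s y.a y.s')).indicator
      (h.measurableSet_state hn y.s) |>.congr (ae_of_all _ fun ω => by
        simp [Set.indicator_apply])
  simp_rw [e1, M.condMean_eq_sum]
  rw [integral_finsetSum _ fun y _ => i1 y, integral_finsetSum _ fun y _ => i2 y]
  refine Finset.sum_congr rfl fun y _ => ?_
  exact integral_mul_indicator_eq (ℱ.le n) (hF y) (hLy y) (hset y)
    (h.law n hn y.s y.a y.r y.s')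

/-- Almost surely, the observed rewards have positive probability. -/
lemma ae_rew_pos (h : IsOfflineData M b T K ρ ℱ z) {n : ℕ} (hn : n < K * (T + 1)) :
    ∀ᵐ ω ∂ρ, 0 < M.rew (z n ω).s (z n ω).a (z n ω).r := by
  classical
  -- The test function is the indicator of an impossible reward, whose conditional mean is zero.
  have key := h.integral_sample hn (F := fun _ y => if 0 < M.rew y.s y.a y.r then 0 else 1)
    (fun y => measurable_const) (L := 1) (ae_of_all _ fun ω y => by split_ifs <;> norm_num)
  have z1 : ∀ s, M.condMean b
      (fun y : Sample S A R => if 0 < M.rew y.s y.a y.r then (0 : ℝ) else 1) s = 0 := fun s =>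
    Finset.sum_eq_zero fun a _ => Finset.sum_eq_zero fun r _ => Finset.sum_eq_zero fun s' _ => by
      rcases (M.rew_nonneg s a r).eq_or_lt' with h1 | h1
      · simp [h1]
      · simp [h1]
  simp_rw [z1, integral_zero] at key
  have hm : Measurable fun ω =>
      if 0 < M.rew (z n ω).s (z n ω).a (z n ω).r then (0 : ℝ) else 1 :=
    (measurable_of_countable fun y : Sample S A R =>
      if 0 < M.rew y.s y.a y.r then (0 : ℝ) else 1).comp (h.measurable_sample' hn)
  rw [integral_eq_zero_iff_of_nonneg (fun ω => by dsimp only; split_ifs <;> norm_num)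
    (Integrable.of_bound hm.aestronglyMeasurable 1 (ae_of_all _ fun ω => by
      split_ifs <;> norm_num))] at key
  filter_upwards [key] with ω hω
  by_contra hc
  simp [hc] at hω

end IsOfflineData

lemma Standing.ae_reward_lt {κ : Constants} {γ : ℝ} {μb : S → ℝ} {Adm : Set (S → A → ℝ)} {d : ℕ}
    {φ : S → EuclideanSpace ℝ (Fin d)} {C : Set (EuclideanSpace ℝ (Fin d))}
    (hst : Standing κ M γ b μb Adm φ C) (h : IsOfflineData M b T K ρ ℱ z) :
    ∀ᵐ ω ∂ρ, ∀ n < K * (T + 1), |((z n ω).r : ℝ)| < κ.rewardBound := by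
  rw [ae_all_iff]
  intro n
  by_cases hn : n < K * (T + 1)
  · filter_upwards [h.ae_rew_pos hn] with ω hω _
    exact hst.reward_bound _ _ _ hω
  · exact ae_of_all _ fun ω h => absurd h hn

/-- The filtration `ℱ` started at time `n`. -/
def shiftFiltration (ℱ : Filtration ℕ mΩ) (n : ℕ) : Filtration ℕ mΩ where
  seq t := ℱ (n + t)
  mono' _ _ h := ℱ.mono (Nat.add_le_add_left h n)
  le' _ := ℱ.le _

/-- A batch is a data set with a single batch for the shifted filtration; from here on one
trajectory can be treated in isolation. -/
lemma IsOfflineData.batch (h : IsOfflineData M b T K ρ ℱ z) {k : ℕ} (hk : k < K) :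
    IsOfflineData M b T 1 ρ (shiftFiltration ℱ (k * (T + 1)))
      (fun t ω => OfflineRL.batch z T k ω t) := by
  have lt : ∀ n, n < 1 * (T + 1) → k * (T + 1) + n < K * (T + 1) := fun n hn => by nlinarith
  refine ⟨fun n hn x => h.state_adapted _ (lt n hn) x, fun n hn y => h.sample_adapted _ (lt n hn) y,
    fun n hn x a r y => h.law _ (lt n hn) x a r y, fun n hn hd => ?_⟩
  refine h.continues _ (lt (n + 1) hn) ?_
  rw [Nat.add_eq, add_assoc, Nat.dvd_add_right (Dvd.intro_left k rfl)]
  exact hd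

namespace IsOfflineData

/-- The Markov property within one batch. -/
lemma integral_state (hb : IsPolicy b) (h : IsOfflineData M b T 1 ρ ℱ z) {j : ℕ} (i : ℕ)
    (hi : j + i ≤ T) {G : Ω → S → ℝ} (hG : ∀ x, Measurable[ℱ j] fun ω => G ω x) {L : ℝ}
    (hL : ∀ᵐ ω ∂ρ, ∀ x, |G ω x| ≤ L) :
    ∫ ω, G ω (z (j + i) ω).s ∂ρ
      = ∫ ω, ∑ y, (M.trans b ^ i) (z j ω).s y * G ω y ∂ρ := by
  induction i generalizing G with
  | zero => simp [Matrix.one_apply]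
  | succ i ih =>
    have hn : j + i < 1 * (T + 1) := by omega
    -- Within a batch the next state is the recorded successor `s'`; averaging over that sample
    -- lowers `i` by one and replaces `G` by its image under one transition.
    have e1 : ∫ ω, G ω (z (j + (i + 1)) ω).s ∂ρ = ∫ ω, G ω (z (j + i) ω).s' ∂ρ := by
      refine integral_congr_ae ?_
      have hd : ¬ (T + 1 ∣ j + i + 1) := Nat.not_dvd_of_pos_of_lt (by omega) (by omega)
      filter_upwards [h.continues (j + i) (by omega) hd] with ω hω
      rw [← add_assoc, hω]
    have hcm : ∀ (g : S → ℝ) x, M.condMean b (fun y : Sample S A R => g y.s') x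
        = ∑ y, M.trans b x y * g y := fun g x => by
      simp only [MDP.condMean, MDP.trans, Matrix.of_apply]
      simp_rw [Finset.sum_mul]
      rw [Finset.sum_comm (s := (Finset.univ : Finset S))]
      refine Finset.sum_congr rfl fun a _ => ?_
      rw [Finset.sum_comm]
      refine Finset.sum_congr rfl fun y _ => ?_
      simp_rw [← Finset.sum_mul, ← Finset.mul_sum, M.rew_sum, mul_one]
    have hst := M.trans_isStochastic hb
    rw [e1, h.integral_sample hn (F := fun ω y => G ω y.s')
      (fun y => (hG y.s').mono (ℱ.mono (by omega)) le_rfl) (hL.mono fun ω hω y => hω _)]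
    simp_rw [hcm]
    rw [ih (by omega) (G := fun ω x => ∑ y, M.trans b x y * G ω y)
      (fun x => Finset.measurable_sum _ fun y _ => (hG y).const_mul _)
      (hL.mono fun ω hω x => hst.abs_sum_le hω x)]
    refine integral_congr_ae (ae_of_all _ fun ω => ?_)
    dsimp only
    simp_rw [pow_succ, Matrix.mul_apply, Finset.sum_mul, Finset.mul_sum]
    rw [Finset.sum_comm]
    simp_rw [mul_assoc]

/-- Decay of correlations: a function of the sample `i` steps ahead whose stationary mean vanishes
has small expectation, even if the function depends on the past. -/
lemma abs_integral_le (hb : IsPolicy b) (h : IsOfflineData M b T 1 ρ ℱ z) {μ : S → ℝ}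
    (hμ : IsStationary (M.trans b) μ) {τ : ℕ} (hmix : M.IsMixing b μ τ) {j i : ℕ}
    (hi : j + i ≤ T) {F : Ω → Sample S A R → ℝ} (hF : ∀ y, Measurable[ℱ j] fun ω => F ω y) {L : ℝ}
    (hL : ∀ᵐ ω ∂ρ, ∀ y, 0 < M.rew y.s y.a y.r → |F ω y| ≤ L)
    (h0 : ∀ᵐ ω ∂ρ, M.stateMean b μ (F ω) = 0) :
    |∫ ω, F ω (z (j + i) ω) ∂ρ| ≤ 2 * L * (1 / 2) ^ (i / (τ + 1)) := by
  classical
  -- The bound on `F` holds only for rewards of positive probability. Truncating to these changes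
  -- neither the integral nor the conditional means and makes the bound hold for all samples.
  set F' : Ω → Sample S A R → ℝ := fun ω y => if 0 < M.rew y.s y.a y.r then F ω y else 0 with hF'
  have hn : j + i < 1 * (T + 1) := by omega
  have hL0 : ∀ᵐ ω ∂ρ, 0 ≤ L := by
    filter_upwards [hL, h.ae_rew_pos hn] with ω h1 h2
    exact (abs_nonneg _).trans (h1 _ h2)
  have hFm' : ∀ y, Measurable[ℱ j] fun ω => F' ω y := fun y => by
    by_cases hy : 0 < M.rew y.s y.a y.r
    · simpa [hF', hy] using hF y
    · simp [hF', hy]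
  have hcm : ∀ ω s, M.condMean b (F' ω) s = M.condMean b (F ω) s := fun ω s => by
    refine Finset.sum_congr rfl fun a _ => Finset.sum_congr rfl fun r _ =>
      Finset.sum_congr rfl fun s' _ => ?_
    rcases (M.rew_nonneg s a r).eq_or_lt' with h1 | h1
    · simp [h1]
    · simp [hF', h1]
  have hL' : ∀ᵐ ω ∂ρ, ∀ y, |F' ω y| ≤ L := by
    filter_upwards [hL, hL0] with ω h1 h2 y
    by_cases hy : 0 < M.rew y.s y.a y.r
    · simpa [hF', hy] using h1 y hy
    · simpa [hF', hy] using h2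
  have e1 : ∫ ω, F ω (z (j + i) ω) ∂ρ = ∫ ω, F' ω (z (j + i) ω) ∂ρ := by
    refine integral_congr_ae ?_
    filter_upwards [h.ae_rew_pos hn] with ω hω
    simp [hF', hω]
  rw [e1, h.integral_sample hn (fun y => (hFm' y).mono (ℱ.mono (by omega)) le_rfl) hL',
    h.integral_state hb i hi (G := fun ω x => M.condMean b (F' ω) x) (L := L)]
  · rw [← Real.norm_eq_abs]
    have := norm_integral_le_of_norm_le_const (μ := ρ) (C := 2 * L * (1 / 2) ^ (i / (τ + 1)))
      (f := fun ω => ∑ y, (M.trans b ^ i) (z j ω).s y * M.condMean b (F' ω) y) ?_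
    · simpa using this
    filter_upwards [h0, hL'] with ω h2 h3
    have h4 : ∑ y, μ y * M.condMean b (F' ω) y = 0 := by simp_rw [hcm]; exact h2
    -- The stationary mean vanishes, so `μ` may be subtracted from the `i`-step law, and the mixing
    -- estimate applies to the difference.
    have h5 : ∑ y, (M.trans b ^ i) (z j ω).s y * M.condMean b (F' ω) y
        = ∑ y, ((M.trans b ^ i) (z j ω).s y - μ y) * M.condMean b (F' ω) y := by
      simp_rw [sub_mul, Finset.sum_sub_distrib, h4, sub_zero]
    have h6 : ∀ y, |M.condMean b (F' ω) y| ≤ L := fun y =>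
      M.abs_condMean_le hb fun a r s' _ => h3 _
    have hL0 : 0 ≤ L := (abs_nonneg _).trans (h3 (z j ω))
    rw [h5, Real.norm_eq_abs]
    calc _ ≤ ∑ y, |(M.trans b ^ i) (z j ω).s y - μ y| * L :=
          (Finset.abs_sum_le_sum_abs _ _).trans (Finset.sum_le_sum fun y _ => by
            rw [abs_mul]; exact mul_le_mul_of_nonneg_left (h6 y) (abs_nonneg _))
      _ ≤ 2 * (1 / 2) ^ (i / (τ + 1)) * L := by
          rw [← Finset.sum_mul]
          exact mul_le_mul_of_nonneg_right
            (hμ.sum_abs_pow_sub_le (M.trans_isStochastic hb) hmix.2 i _) hL0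
      _ = _ := by ring
  · intro x
    exact Finset.measurable_sum _ fun a _ => Finset.measurable_sum _ fun r _ =>
      Finset.measurable_sum _ fun s' _ => (hFm' _).const_mul _
  · filter_upwards [hL'] with ω hω x
    exact M.abs_condMean_le hb fun a r s' _ => hω _

end IsOfflineData

end Data

/-! ### Measurability -/

section Measurability

variable {S A : Type*} [Fintype S] [DecidableEq S] [Fintype A] [DecidableEq A] {R : Finset ℝ}
  {d : ℕ} {Ω : Type*} [MeasurableSpace Ω] {π : Ω → S → A → ℝ} {z : ℕ → Ω → Sample S A R}
  {θ : Ω → EuclideanSpace ℝ (Fin d)}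

lemma measurable_apply_sample {E : Type*} [MeasurableSpace E] {F : Ω → Sample S A R → E}
    (hF : ∀ y, Measurable fun ω => F ω y) {y : Ω → Sample S A R} (hy : Measurable y) :
    Measurable fun ω => F ω (y ω) :=
  (measurable_from_prod_countable_left (f := fun p : Ω × Sample S A R => F p.1 p.2) hF).comp
    (measurable_id.prodMk hy)

lemma measurable_ite_sample {y : Ω → Sample S A R} (hy : Measurable y) (p : Sample S A R → Prop)
    [DecidablePred p] : Measurable fun ω => if p (y ω) then (1 : ℝ) else 0 :=
  (measurable_of_countable fun y => if p y then (1 : ℝ) else 0).comp hy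

lemma measurable_visits {t : ℕ} (hz : ∀ l ≤ t, Measurable (z l)) (s : S) (a : A) :
    Measurable fun ω => visits (fun l => z l ω) t s a :=
  Finset.measurable_sum _ fun l hl =>
    measurable_ite_sample (hz l (Finset.mem_range_succ_iff.1 hl)) fun y => y.s = s ∧ y.a = a

lemma measurable_estTrans (hπ : ∀ s a, Measurable fun ω => π ω s a) {t : ℕ}
    (hz : ∀ l ≤ t, Measurable (z l)) (s s' : S) :
    Measurable fun ω => estTrans (fun l => z l ω) (π ω) t s s' :=
  Finset.measurable_sum _ fun a _ => (hπ s a).mul ((Finset.measurable_sum _ fun l hl =>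
    measurable_ite_sample (hz l (Finset.mem_range_succ_iff.1 hl))
      fun y => y.s = s ∧ y.a = a ∧ y.s' = s').div (measurable_visits hz s a))

lemma measurable_estRew (hπ : ∀ s a, Measurable fun ω => π ω s a) {t : ℕ}
    (hz : ∀ l ≤ t, Measurable (z l)) (s : S) (r : R) :
    Measurable fun ω => estRew (fun l => z l ω) (π ω) t s r :=
  Finset.measurable_sum _ fun a _ => (hπ s a).mul ((Finset.measurable_sum _ fun l hl =>
    measurable_ite_sample (hz l (Finset.mem_range_succ_iff.1 hl))
      fun y => y.s = s ∧ y.a = a ∧ y.r = r).div (measurable_visits hz s a))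

lemma measurable_estStat {t : ℕ} (hz : ∀ l ≤ t, Measurable (z l)) (s : S) :
    Measurable fun ω => estStat (fun l => z l ω) t s :=
  (Finset.measurable_sum _ fun l hl =>
    measurable_ite_sample (hz l (Finset.mem_Icc.1 hl).2) fun y => y.s = s).const_mul _

lemma measurable_linValue (φ : S → EuclideanSpace ℝ (Fin d)) (hθ : Measurable θ) (s : S) :
    Measurable fun ω => linValue φ (θ ω) s :=
  measurable_const.inner hθ

lemma measurable_residual (γ : ℝ) (φ : S → EuclideanSpace ℝ (Fin d)) {ξ : Ω → S → ℝ}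
    (hξ : ∀ s, Measurable fun ω => ξ ω s) {ψ : Ω → S → EuclideanSpace ℝ (Fin d)}
    (hψ : ∀ s, Measurable fun ω => ψ ω s) (hθ : Measurable θ) (s : S) :
    Measurable fun ω => residual γ φ (ξ ω) (ψ ω) (θ ω) s :=
  (hξ s).add ((((hψ s).const_smul γ).sub_const (φ s)).inner hθ)

lemma measurable_direction (m : Method) (γ : ℝ) (φ : S → EuclideanSpace ℝ (Fin d))
    (b : S → A → ℝ) (hπ : ∀ s a, Measurable fun ω => π ω s a) {ξ : Ω → S → ℝ}
    (hξ : ∀ s, Measurable fun ω => ξ ω s) {ψ : Ω → S → EuclideanSpace ℝ (Fin d)}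
    (hψ : ∀ s, Measurable fun ω => ψ ω s) {μ : Ω → S → ℝ} (hμ : ∀ s, Measurable fun ω => μ ω s)
    (hθ : Measurable θ) (y : Sample S A R) :
    Measurable fun ω => direction m γ φ b (π ω) (ξ ω) (ψ ω) (μ ω) (θ ω) y := by
  have hres := measurable_residual γ φ hξ hψ hθ y.s
  cases m with
  | directSGD => exact hres.smul (((hψ y.s).const_smul γ).sub_const (φ y.s))
  | tdSGD => exact (((hπ y.s y.a).div_const _).mul hres).smul_const _
  | td0 =>
    exact (((((hμ y.s).const_div 1).mul ((hπ y.s y.a).div_const _)).mul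
      ((((measurable_linValue φ hθ y.s').const_mul γ).const_add _).sub
        (measurable_linValue φ hθ y.s))).smul_const _).neg

lemma measurable_estDirection (m : Method) (γ : ℝ) (φ : S → EuclideanSpace ℝ (Fin d))
    (b : S → A → ℝ) (hπ : ∀ s a, Measurable fun ω => π ω s a) {t : ℕ}
    (hz : ∀ l ≤ t, Measurable (z l)) (hθ : Measurable θ) :
    Measurable fun ω => estDirection m γ φ b (π ω) (fun l => z l ω) t (θ ω) :=
  measurable_apply_sample (measurable_direction m γ φ b hπ
    (fun s => Finset.measurable_sum _ fun r _ => (measurable_estRew hπ hz s r).const_mul _)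
    (fun s => Finset.measurable_sum _ fun s' _ => (measurable_estTrans hπ hz s s').smul_const _)
    (measurable_estStat hz) hθ) (hz t le_rfl)

lemma measurable_evalIterate (m : Method) (γ : ℝ) (φ : S → EuclideanSpace ℝ (Fin d))
    (b : S → A → ℝ) (hπ : ∀ s a, Measurable fun ω => π ω s a)
    {C : Set (EuclideanSpace ℝ (Fin d))} (hC : IsCompact C) (hconv : Convex ℝ C)
    (η : ℕ → ℝ) {θ₀ : EuclideanSpace ℝ (Fin d)} (hθ₀ : θ₀ ∈ C) {t : ℕ}
    (hz : ∀ l < t, Measurable (z l)) :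
    Measurable fun ω => evalIterate m γ φ b (π ω) C η θ₀ (fun l => z l ω) t := by
  induction t using Nat.twoStepInduction with
  | zero => exact measurable_const
  | one => exact measurable_const
  | more t _ ih =>
    have ih' := ih fun l hl => hz l (by omega)
    have hz' : ∀ l ≤ t + 1, Measurable (z l) := fun l hl => hz l (by omega)
    exact (measurable_proj hC hconv ⟨_, hθ₀⟩).comp (ih'.sub
      ((measurable_estDirection m γ φ b hπ hz' ih').const_smul (η (t + 1))))

lemma measurable_evalOutput (m : Method) (γ : ℝ) (φ : S → EuclideanSpace ℝ (Fin d))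
    (b : S → A → ℝ) (hπ : ∀ s a, Measurable fun ω => π ω s a)
    {C : Set (EuclideanSpace ℝ (Fin d))} (hC : IsCompact C) (hconv : Convex ℝ C)
    (η : ℕ → ℝ) {θ₀ : EuclideanSpace ℝ (Fin d)} (hθ₀ : θ₀ ∈ C) {T : ℕ}
    (hz : ∀ l ≤ T, Measurable (z l)) :
    Measurable fun ω => evalOutput m γ φ b (π ω) C η θ₀ (fun l => z l ω) T :=
  (Finset.measurable_sum (Finset.range (T + 1)) fun _ ht =>
    measurable_evalIterate m γ φ b hπ hC hconv η hθ₀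
      fun l hl => hz l (hl.le.trans (Finset.mem_range_succ_iff.1 ht))).const_smul (1 / ((T : ℝ) + 1))

variable (M : MDP S A R)

lemma MDP.measurable_trans (hπ : ∀ s a, Measurable fun ω => π ω s a) (s s' : S) :
    Measurable fun ω => M.trans (π ω) s s' :=
  Finset.measurable_sum _ fun a _ => (hπ s a).mul_const _

lemma MDP.measurable_trans_pow (hπ : ∀ s a, Measurable fun ω => π ω s a) (n : ℕ) (s s' : S) :
    Measurable fun ω => (M.trans (π ω) ^ n) s s' := by
  induction n generalizing s' with
  | zero => simp only [pow_zero]; exact measurable_const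
  | succ n ih =>
    simp_rw [pow_succ, Matrix.mul_apply]
    exact Finset.measurable_sum _ fun x _ => (ih x).mul (M.measurable_trans hπ x s')

lemma MDP.measurable_meanReward (hπ : ∀ s a, Measurable fun ω => π ω s a) (s : S) :
    Measurable fun ω => M.meanReward (π ω) s :=
  Finset.measurable_sum _ fun a _ => Finset.measurable_sum _ fun _ _ =>
    ((hπ s a).mul_const _).mul_const _

lemma MDP.measurable_nextFeature (φ : S → EuclideanSpace ℝ (Fin d))
    (hπ : ∀ s a, Measurable fun ω => π ω s a) (s : S) :
    Measurable fun ω => M.nextFeature φ (π ω) s :=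
  Finset.measurable_sum _ fun s' _ => (M.measurable_trans hπ s s').smul_const _

/-- The value of a policy as an upper limit, which is measurable in the policy without any
assumption. -/
def MDP.valueLimsup (M : MDP S A R) (γ : ℝ) (π : S → A → ℝ) (s : S) : ℝ :=
  Filter.limsup (fun n : ℕ => ∑ t ∈ Finset.range n,
    γ ^ t * ∑ x, (M.trans π ^ t) s x * M.meanReward π x) Filter.atTop

lemma MDP.measurable_valueLimsup (γ : ℝ) (hπ : ∀ s a, Measurable fun ω => π ω s a) (s : S) :
    Measurable fun ω => M.valueLimsup γ (π ω) s :=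
  Measurable.limsup fun _ => Finset.measurable_sum _ fun t _ =>
    (Finset.measurable_sum _ fun x _ =>
      (M.measurable_trans_pow hπ t s x).mul (M.measurable_meanReward hπ x)).const_mul _

/-- For admissible policies the measurable upper limit is the genuine value, so it may stand in for
the unknown solution in the drift and the noise. -/
lemma MDP.SolvesBellman.linValue_eq_limsup {M : MDP S A R} {γ : ℝ} (h0 : 0 ≤ γ) (h1 : γ < 1)
    {φ : S → EuclideanSpace ℝ (Fin d)} {π : S → A → ℝ} (hπ : IsPolicy π)
    {θ : EuclideanSpace ℝ (Fin d)} (h : M.SolvesBellman γ φ π θ) (s : S) :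
    linValue φ θ s = M.valueLimsup γ π s :=
  (M.hasSum_value h0 h1 hπ h s).tendsto_sum_nat.limsup_eq.symm

lemma MDP.measurable_pairing (m : Method) (γ : ℝ) (φ : S → EuclideanSpace ℝ (Fin d))
    (b : S → A → ℝ) (μ : S → ℝ) (hπ : ∀ s a, Measurable fun ω => π ω s a) {v : Ω → S → ℝ}
    (hv : ∀ s, Measurable fun ω => v ω s) (hθ : Measurable θ) (y : Sample S A R) :
    Measurable fun ω => M.pairing m γ φ b μ (π ω) (v ω) (θ ω) y := by
  have hres := measurable_residual γ φ (M.measurable_meanReward hπ)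
    (M.measurable_nextFeature φ hπ) hθ y.s
  have hW : ∀ s, Measurable fun ω => linValue φ (θ ω) s - v ω s := fun s =>
    (measurable_linValue φ hθ s).sub (hv s)
  cases m with
  | directSGD =>
    exact hres.mul (((Finset.measurable_sum _ fun s' _ =>
      (M.measurable_trans hπ y.s s').mul (hW s')).const_mul _).sub (hW _))
  | tdSGD =>
    exact (((hπ y.s y.a).div_const _).mul hres).mul (((hW _).const_mul _).sub (hW _))
  | td0 =>
    exact (((((hπ y.s y.a).div_const _).const_mul _).mul
      ((((measurable_linValue φ hθ y.s').const_mul γ).const_add _).sub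
        (measurable_linValue φ hθ y.s))).mul (hW _)).neg

lemma MDP.measurable_stateMean (b : S → A → ℝ) (μ : S → ℝ) {F : Ω → Sample S A R → ℝ}
    (hF : ∀ y, Measurable fun ω => F ω y) : Measurable fun ω => M.stateMean b μ (F ω) :=
  Finset.measurable_sum _ fun s _ => (Finset.measurable_sum _ fun a _ =>
    Finset.measurable_sum _ fun r _ => Finset.measurable_sum _ fun s' _ =>
      (hF ⟨s, a, r, s'⟩).const_mul _).const_mul _

lemma MDP.measurable_noise (m : Method) (γ : ℝ) (φ : S → EuclideanSpace ℝ (Fin d))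
    (b : S → A → ℝ) (μ : S → ℝ) (hπ : ∀ s a, Measurable fun ω => π ω s a) {v : Ω → S → ℝ}
    (hv : ∀ s, Measurable fun ω => v ω s) (hθ : Measurable θ) (y : Sample S A R) :
    Measurable fun ω => M.noise m γ φ b μ (π ω) (v ω) (θ ω) y :=
  (M.measurable_pairing m γ φ b μ hπ hv hθ y).sub
    (M.measurable_stateMean b μ (M.measurable_pairing m γ φ b μ hπ hv hθ))

lemma MDP.measurable_loss (γ : ℝ) (φ : S → EuclideanSpace ℝ (Fin d)) (μ : S → ℝ)
    (hπ : ∀ s a, Measurable fun ω => π ω s a) (hθ : Measurable θ) :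
    Measurable fun ω => M.loss γ φ μ (π ω) (θ ω) :=
  Finset.measurable_sum _ fun s _ => (((measurable_residual γ φ (M.measurable_meanReward hπ)
    (M.measurable_nextFeature φ hπ) hθ s).pow_const 2).const_mul _).const_mul _

end Measurability

/-! ### One policy evaluation -/

section Evaluation

variable {S A : Type*} [Fintype S] [DecidableEq S] [Fintype A] [DecidableEq A] {R : Finset ℝ}
  {d : ℕ} {Ω : Type*} {mΩ : MeasurableSpace Ω}

/-- The assumptions on one policy evaluation: `z₀, …, z_T` is a trajectory under `b`, the policy
`π` is determined before it starts, and `e t` bounds the estimation errors. -/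
structure IsEvaluation (κ : Constants) (M : MDP S A R) (γ : ℝ) (b : S → A → ℝ) (μb : S → ℝ)
    (Adm : Set (S → A → ℝ)) (φ : S → EuclideanSpace ℝ (Fin d))
    (C : Set (EuclideanSpace ℝ (Fin d))) (η : ℕ → ℝ) (θ₀ : EuclideanSpace ℝ (Fin d)) (T : ℕ)
    (ρ : Measure Ω) (ℱ : Filtration ℕ mΩ) (z : ℕ → Ω → Sample S A R) (π : Ω → S → A → ℝ)
    (e : ℕ → Ω → ℝ) : Prop where
  standing : Standing κ M γ b μb Adm φ C
  discount_nonneg : 0 ≤ γ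
  discount_lt : γ < 1
  data : IsOfflineData M b T 1 ρ ℱ z
  init_mem : θ₀ ∈ C
  policy_measurable : ∀ s a, Measurable[ℱ 0] fun ω => π ω s a
  policy_mem : ∀ᵐ ω ∂ρ, π ω ∈ Adm
  step_nonneg : ∀ t, 1 ≤ t → 0 ≤ η t
  error_memLp : ∀ t, 1 ≤ t → t ≤ T → MemLp (e t) 2 ρ
  error_sq : ∀ t, 1 ≤ t → t ≤ T → ∫ ω, e t ω ^ 2 ∂ρ ≤ κ.estError / t
  error_bound : ∀ t, 1 ≤ t → t ≤ T → ∀ᵐ ω ∂ρ,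
    (∀ s', |estTrans (fun l => z l ω) (π ω) t (z t ω).s s' - M.trans (π ω) (z t ω).s s'| ≤ e t ω) ∧
    (∀ r : R, |estRew (fun l => z l ω) (π ω) t (z t ω).s r
      - ∑ a, π ω (z t ω).s a * M.rew (z t ω).s a r| ≤ e t ω) ∧
    |1 / estStat (fun l => z l ω) t (z t ω).s - 1 / μb (z t ω).s| ≤ e t ω

/-- The number of steps after which the data have forgotten the past up to an error `1 / T`. -/
def Constants.lag (κ : Constants) (T : ℕ) : ℕ := (κ.mixingTime + 1) * (Nat.log 2 T + 1)

/-- Bound on the mean length of the update directions. -/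
def Constants.meanDirBound (κ : Constants) : ℝ := κ.dirBound + κ.dirErr * ((1 + κ.estError) / 2)

/-- Constant in the bound on the mean of the noise. -/
def Constants.noiseConst (κ : Constants) (H : ℝ) : ℝ :=
  2 * κ.pairingLip * H * κ.meanDirBound + 8 * κ.radius * κ.dirBound

variable {κ : Constants} {M : MDP S A R} {γ : ℝ} {b : S → A → ℝ} {μb : S → ℝ}
  {Adm : Set (S → A → ℝ)} {φ : S → EuclideanSpace ℝ (Fin d)}
  {C : Set (EuclideanSpace ℝ (Fin d))} {η : ℕ → ℝ} {θ₀ : EuclideanSpace ℝ (Fin d)} {T : ℕ}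
  {ρ : Measure Ω} [IsProbabilityMeasure ρ] {ℱ : Filtration ℕ mΩ} {z : ℕ → Ω → Sample S A R}
  {π : Ω → S → A → ℝ} {e : ℕ → Ω → ℝ} {m : Method}

lemma evalIterate_mem (hC : IsCompact C) (h0 : θ₀ ∈ C) (π : S → A → ℝ) (z : ℕ → Sample S A R)
    (t : ℕ) : evalIterate m γ φ b π C η θ₀ z t ∈ C := by
  match t with
  | 0 => exact h0
  | 1 => exact h0
  | t + 2 => exact (proj_spec hC ⟨_, h0⟩ _).1

lemma evalIterate_succ (π : S → A → ℝ) (z : ℕ → Sample S A R) {t : ℕ} (ht : 1 ≤ t) :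
    evalIterate m γ φ b π C η θ₀ z (t + 1) = proj C (evalIterate m γ φ b π C η θ₀ z t
      - η t • estDirection m γ φ b π z t (evalIterate m γ φ b π C η θ₀ z t)) := by
  obtain ⟨t, rfl⟩ := Nat.exists_eq_add_of_le' ht
  rfl

namespace IsEvaluation

lemma ae_reward_lt (h : IsEvaluation κ M γ b μb Adm φ C η θ₀ T ρ ℱ z π e) :
    ∀ᵐ ω ∂ρ, ∀ t ≤ T, |((z t ω).r : ℝ)| < κ.rewardBound := by
  filter_upwards [h.standing.ae_reward_lt h.data] with ω hω t ht
  exact hω t (by omega)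

variable [Nonempty S]

lemma ae_direction (h : IsEvaluation κ M γ b μb Adm φ C η θ₀ T ρ ℱ z π e) (m : Method) {t : ℕ}
    (h1 : 1 ≤ t) (hT : t ≤ T) : ∀ᵐ ω ∂ρ, 0 ≤ e t ω ∧ ∀ θ ∈ C,
      ‖estDirection m γ φ b (π ω) (fun l => z l ω) t θ
        - direction m γ φ b (π ω) (M.meanReward (π ω)) (M.nextFeature φ (π ω)) μb θ (z t ω)‖
        ≤ κ.dirErr * e t ω ∧
      ‖estDirection m γ φ b (π ω) (fun l => z l ω) t θ‖ ≤ κ.dirBound + κ.dirErr * e t ω := by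
  filter_upwards [h.ae_reward_lt, h.policy_mem, h.error_bound t h1 hT] with ω h2 h3 h4
  refine ⟨(abs_nonneg _).trans h4.2.2, fun θ hθ => ?_⟩
  have a1 := h.standing.norm_estDirection_sub_le h.discount_nonneg h.discount_lt.le h3 m
    (h.standing.bounded θ hθ) (z := fun l => z l ω) (fun l hl => h2 l (hl.trans hT)) h4.1 h4.2.1
    h4.2.2
  refine ⟨a1, ?_⟩
  have a2 := h.standing.norm_direction_le h.discount_nonneg h.discount_lt.le h3 m
    (h.standing.bounded θ hθ) (h2 t hT).le
  have a3 := norm_sub_norm_le (estDirection m γ φ b (π ω) (fun l => z l ω) t θ)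
    (direction m γ φ b (π ω) (M.meanReward (π ω)) (M.nextFeature φ (π ω)) μb θ (z t ω))
  linarith

/-- The current iterate lies in `C` and equals its own projection, so nonexpansiveness bounds the
move by the length of the unprojected step. -/
lemma norm_step_le (h : IsEvaluation κ M γ b μb Adm φ C η θ₀ T ρ ℱ z π e) (m : Method) {t : ℕ}
    (h1 : 1 ≤ t) (hT : t ≤ T) : ∀ᵐ ω ∂ρ,
      ‖evalIterate m γ φ b (π ω) C η θ₀ (fun l => z l ω) (t + 1)
        - evalIterate m γ φ b (π ω) C η θ₀ (fun l => z l ω) t‖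
      ≤ η t * (κ.dirBound + κ.dirErr * e t ω) := by
  filter_upwards [h.ae_direction m h1 hT] with ω hω
  have hmem := evalIterate_mem (m := m) (γ := γ) (φ := φ) (b := b) (η := η) h.standing.compact
    h.init_mem (π ω) (fun l => z l ω) t
  rw [evalIterate_succ _ _ h1]
  set θ := evalIterate m γ φ b (π ω) C η θ₀ (fun l => z l ω) t with hθ
  have h2 := norm_proj_sub_proj_le h.standing.compact h.standing.convex ⟨_, h.init_mem⟩
    (θ - η t • estDirection m γ φ b (π ω) (fun l => z l ω) t θ) θ
  rw [proj_of_mem h.standing.compact hmem, sub_sub_cancel_left, norm_neg, norm_smul,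
    Real.norm_eq_abs, abs_of_nonneg (h.step_nonneg t h1)] at h2
  exact h2.trans (mul_le_mul_of_nonneg_left (hω.2 θ hmem).2 (h.step_nonneg t h1))

/-- The basic recursion for the squared distance to a solution of the Bellman equation. -/
lemma dist_sq_succ_le (h : IsEvaluation κ M γ b μb Adm φ C η θ₀ T ρ ℱ z π e) (m : Method) {t : ℕ}
    (h1 : 1 ≤ t) (hT : t ≤ T) : ∀ᵐ ω ∂ρ, ∀ θs ∈ C, M.SolvesBellman γ φ (π ω) θs →
      ‖evalIterate m γ φ b (π ω) C η θ₀ (fun l => z l ω) (t + 1) - θs‖ ^ 2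
      ≤ ‖evalIterate m γ φ b (π ω) C η θ₀ (fun l => z l ω) t - θs‖ ^ 2
        - 2 * η t * (M.stateMean b μb (M.pairing m γ φ b μb (π ω) (M.valueLimsup γ (π ω))
              (evalIterate m γ φ b (π ω) C η θ₀ (fun l => z l ω) t))
            + M.noise m γ φ b μb (π ω) (M.valueLimsup γ (π ω))
              (evalIterate m γ φ b (π ω) C η θ₀ (fun l => z l ω) t) (z t ω))
        + 2 * η t * (‖evalIterate m γ φ b (π ω) C η θ₀ (fun l => z l ω) t - θs‖
            * (κ.dirErr * e t ω))
        + η t ^ 2 * (2 * κ.dirBound ^ 2 + 2 * κ.dirErr ^ 2 * e t ω ^ 2) := by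
  filter_upwards [h.ae_direction m h1 hT, h.policy_mem] with ω hω hπ θs hs hB
  have hmem := evalIterate_mem (m := m) (γ := γ) (φ := φ) (b := b) (η := η) h.standing.compact
    h.init_mem (π ω) (fun l => z l ω) t
  rw [evalIterate_succ _ _ h1]
  set θ := evalIterate m γ φ b (π ω) C η θ₀ (fun l => z l ω) t with hθ
  set g := direction m γ φ b (π ω) (M.meanReward (π ω)) (M.nextFeature φ (π ω)) μb θ (z t ω)
    with hg
  set ĝ := estDirection m γ φ b (π ω) (fun l => z l ω) t θ with hĝ
  have hη := h.step_nonneg t h1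
  obtain ⟨he, hω⟩ := hω
  obtain ⟨b1, b2⟩ := hω θ hmem
  -- The solution `θs` lies in `C` and is fixed by the projection, so projecting can only bring the
  -- iterate closer to it.
  have h2 := norm_proj_sub_proj_le h.standing.compact h.standing.convex ⟨_, h.init_mem⟩
    (θ - η t • ĝ) θs
  rw [proj_of_mem h.standing.compact hs, sub_right_comm] at h2
  have h3 : ‖θ - θs - η t • ĝ‖ ^ 2
      = ‖θ - θs‖ ^ 2 - 2 * η t * inner ℝ (θ - θs) ĝ + η t ^ 2 * ‖ĝ‖ ^ 2 := by
    rw [norm_sub_sq_real, inner_smul_right, norm_smul, Real.norm_eq_abs, mul_pow, sq_abs]; ring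
  have h4 : inner ℝ (θ - θs) ĝ = inner ℝ (θ - θs) g + inner ℝ (θ - θs) (ĝ - g) := by
    rw [inner_sub_right]; ring
  have hpol := h.standing.admissible _ hπ
  have h5 : inner ℝ (θ - θs) g = M.pairing m γ φ b μb (π ω) (M.valueLimsup γ (π ω)) θ (z t ω) :=
    inner_direction_eq_pairing m
      (hB.linValue_eq_limsup h.discount_nonneg h.discount_lt hpol) θ (z t ω)
  have h6 : M.stateMean b μb (M.pairing m γ φ b μb (π ω) (M.valueLimsup γ (π ω)) θ)
      + M.noise m γ φ b μb (π ω) (M.valueLimsup γ (π ω)) θ (z t ω) = inner ℝ (θ - θs) g := by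
    rw [h5, MDP.noise]; ring
  have h7 : -(‖θ - θs‖ * (κ.dirErr * e t ω)) ≤ inner ℝ (θ - θs) (ĝ - g) :=
    (abs_le.1 (abs_inner_le_mul le_rfl b1)).1
  have h8 : ‖ĝ‖ ^ 2 ≤ 2 * κ.dirBound ^ 2 + 2 * κ.dirErr ^ 2 * e t ω ^ 2 := by
    have := pow_le_pow_left₀ (norm_nonneg _) b2 2
    nlinarith [sq_nonneg (κ.dirBound - κ.dirErr * e t ω)]
  have h9 := pow_le_pow_left₀ (norm_nonneg _) h2 2
  rw [h6]
  rw [h3, h4] at h9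
  nlinarith [mul_le_mul_of_nonneg_left h8 (sq_nonneg (η t)), mul_le_mul_of_nonneg_left h7 hη]

lemma integrable_error (h : IsEvaluation κ M γ b μb Adm φ C η θ₀ T ρ ℱ z π e) {t : ℕ}
    (h1 : 1 ≤ t) (hT : t ≤ T) : Integrable (e t) ρ :=
  (h.error_memLp t h1 hT).integrable (by norm_num)

lemma integrable_error_sq (h : IsEvaluation κ M γ b μb Adm φ C η θ₀ T ρ ℱ z π e) {t : ℕ}
    (h1 : 1 ≤ t) (hT : t ≤ T) : Integrable (fun ω => e t ω ^ 2) ρ :=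
  (h.error_memLp t h1 hT).integrable_sq

/-- The pointwise inequality `e ≤ √t / 2 * e ^ 2 + 1 / (2 * √t)` trades the first moment for the
second. -/
lemma integral_error_le (h : IsEvaluation κ M γ b μb Adm φ C η θ₀ T ρ ℱ z π e) {t : ℕ}
    (h1 : 1 ≤ t) (hT : t ≤ T) : ∫ ω, e t ω ∂ρ ≤ (1 + κ.estError) / 2 / Real.sqrt t := by
  have ht : (0 : ℝ) < t := by exact_mod_cast h1
  set q := Real.sqrt t with hq
  have hq0 : 0 < q := Real.sqrt_pos.2 ht
  have hqq : q * q = t := Real.mul_self_sqrt ht.le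
  have h2 : ∫ ω, e t ω ∂ρ ≤ ∫ ω, (q / 2 * e t ω ^ 2 + 1 / (2 * q)) ∂ρ := by
    refine integral_mono (h.integrable_error h1 hT)
      (((h.integrable_error_sq h1 hT).const_mul _).add (integrable_const _)) fun ω => ?_
    have : q / 2 * e t ω ^ 2 + 1 / (2 * q) - e t ω = (q * e t ω - 1) ^ 2 / (2 * q) := by
      field_simp; ring
    have h3 : 0 ≤ (q * e t ω - 1) ^ 2 / (2 * q) := by positivity
    dsimp only
    linarith
  rw [integral_add ((h.integrable_error_sq h1 hT).const_mul _) (integrable_const _),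
    integral_const_mul] at h2
  refine h2.trans ?_
  have h4 := mul_le_mul_of_nonneg_left (h.error_sq t h1 hT) (by positivity : 0 ≤ q / 2)
  have h5 : q / 2 * (κ.estError / t) = κ.estError / (2 * q) := by
    rw [← hqq]; field_simp
  have h6 : (1 + κ.estError) / 2 / q = κ.estError / (2 * q) + 1 / (2 * q) := by
    field_simp; ring
  rw [h6, ← h5]
  simpa using h4

lemma integral_error_le_const (h : IsEvaluation κ M γ b μb Adm φ C η θ₀ T ρ ℱ z π e) {t : ℕ}
    (h1 : 1 ≤ t) (hT : t ≤ T) : ∫ ω, e t ω ∂ρ ≤ (1 + κ.estError) / 2 :=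
  (h.integral_error_le h1 hT).trans (div_le_self (by linarith [κ.estError_pos])
    (Real.one_le_sqrt.2 (by exact_mod_cast h1)))

lemma norm_sub_le_sum (h : IsEvaluation κ M γ b μb Adm φ C η θ₀ T ρ ℱ z π e) (m : Method) {j t : ℕ}
    (h1 : 1 ≤ j) (hj : j ≤ t) (hT : t ≤ T) : ∀ᵐ ω ∂ρ,
      ‖evalIterate m γ φ b (π ω) C η θ₀ (fun l => z l ω) t
        - evalIterate m γ φ b (π ω) C η θ₀ (fun l => z l ω) j‖
      ≤ ∑ l ∈ Finset.Ico j t, η l * (κ.dirBound + κ.dirErr * e l ω) := by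
  induction t, hj using Nat.le_induction with
  | base => simp
  | succ t hj ih =>
    filter_upwards [ih (by omega), h.norm_step_le m (h1.trans hj) (by omega)] with ω a1 a2
    rw [Finset.sum_Ico_succ_top hj]
    linarith [norm_sub_le_norm_sub_add_norm_sub
      (evalIterate m γ φ b (π ω) C η θ₀ (fun l => z l ω) (t + 1))
      (evalIterate m γ φ b (π ω) C η θ₀ (fun l => z l ω) t)
      (evalIterate m γ φ b (π ω) C η θ₀ (fun l => z l ω) j)]

lemma measurable_iterate (h : IsEvaluation κ M γ b μb Adm φ C η θ₀ T ρ ℱ z π e) (m : Method)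
    {t : ℕ} (hT : t ≤ T + 1) : Measurable[ℱ t] fun ω =>
      evalIterate m γ φ b (π ω) C η θ₀ (fun l => z l ω) t :=
  @measurable_evalIterate _ _ _ _ _ _ _ _ _ (ℱ t) _ _ m γ φ b
    (fun s a => (h.policy_measurable s a).mono (ℱ.mono (Nat.zero_le t)) le_rfl) C
    h.standing.compact h.standing.convex η θ₀ h.init_mem t fun l hl =>
      (h.data.measurable_sample (by omega)).mono (ℱ.mono hl) le_rfl

lemma measurable_noise (h : IsEvaluation κ M γ b μb Adm φ C η θ₀ T ρ ℱ z π e) (m : Method)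
    {j : ℕ} (hT : j ≤ T + 1) (y : Sample S A R) : Measurable[ℱ j] fun ω =>
      M.noise m γ φ b μb (π ω) (M.valueLimsup γ (π ω))
        (evalIterate m γ φ b (π ω) C η θ₀ (fun l => z l ω) j) y := by
  have hπ : ∀ s a, Measurable[ℱ j] fun ω => π ω s a := fun s a =>
    (h.policy_measurable s a).mono (ℱ.mono (Nat.zero_le j)) le_rfl
  exact @MDP.measurable_noise _ _ _ _ _ _ _ _ _ (ℱ j) _ _ M m γ φ b μb hπ _
    (@MDP.measurable_valueLimsup _ _ _ _ _ _ _ _ (ℱ j) _ M γ hπ) (h.measurable_iterate m hT) y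

lemma integrable_noise (h : IsEvaluation κ M γ b μb Adm φ C η θ₀ T ρ ℱ z π e) (m : Method)
    {j t : ℕ} (hj : j ≤ T) (ht : t ≤ T) : Integrable (fun ω =>
      M.noise m γ φ b μb (π ω) (M.valueLimsup γ (π ω))
        (evalIterate m γ φ b (π ω) C η θ₀ (fun l => z l ω) j) (z t ω)) ρ := by
  refine Integrable.of_bound (measurable_apply_sample (fun y =>
    (h.measurable_noise m (hj.trans (Nat.le_succ T)) y).mono (ℱ.le j) le_rfl)
    (h.data.measurable_sample' (by omega))).aestronglyMeasurable (4 * κ.radius * κ.dirBound) ?_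
  filter_upwards [h.policy_mem, h.ae_reward_lt] with ω hπ hr
  obtain ⟨θs, hs, hB⟩ := h.standing.realizable _ hπ
  exact h.standing.abs_noise_le h.discount_nonneg h.discount_lt.le hπ m hs
    (hB.linValue_eq_limsup h.discount_nonneg h.discount_lt (h.standing.admissible _ hπ))
    (evalIterate_mem h.standing.compact h.init_mem _ _ j) (hr t ht).le

/-- The noise at time `t` is compared with the same noise evaluated at the iterate `κ.lag T` steps
earlier. That iterate is determined before the lag starts, so mixing makes the mean small; the
replacement costs the Lipschitz constant times the movement of the iterates over the window. The
sequence `β` abstracts the step size decay, `1 / √t` or `1 / t`, and `H` absorbs the variation of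
the steps over a window with `t ≤ 2 * l`. -/
lemma abs_integral_noise_le (h : IsEvaluation κ M γ b μb Adm φ C η θ₀ T ρ ℱ z π e) (m : Method)
    {H : ℝ} {β : ℕ → ℝ} (hH : 0 ≤ H) (hβ : ∀ t : ℕ, 1 ≤ t → 1 / (t : ℝ) ≤ β t)
    (hη : ∀ l t : ℕ, 1 ≤ l → l ≤ t → t ≤ 2 * l → η l ≤ H * β t) {t : ℕ} (h1 : 1 ≤ t) (hT : t ≤ T) :
    |∫ ω, M.noise m γ φ b μb (π ω) (M.valueLimsup γ (π ω))
        (evalIterate m γ φ b (π ω) C η θ₀ (fun l => z l ω) t) (z t ω) ∂ρ|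
      ≤ κ.noiseConst H * κ.lag T * β t := by
  have hst := h.standing
  have hG := hst.dirBound_pos
  have hE := hst.dirErr_pos
  have hr := κ.radius_pos
  have hB := κ.estError_pos
  have ht : (0 : ℝ) < t := by exact_mod_cast h1
  have hβ0 : 0 < β t := lt_of_lt_of_le (by positivity) (hβ t h1)
  have hL : 0 ≤ κ.pairingLip := add_nonneg hG.le (mul_nonneg (by positivity)
    (mul_nonneg (mul_nonneg (by norm_num) κ.shift_pos.le) (sq_nonneg _)))
  have hD : 0 ≤ κ.meanDirBound := by rw [Constants.meanDirBound]; positivity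
  have hlag : 1 ≤ κ.lag T := Nat.mul_pos (Nat.succ_pos _) (Nat.succ_pos _)
  have hlag' : (1 : ℝ) ≤ κ.lag T := by exact_mod_cast hlag
  have bound : ∀ j ≤ T, ∀ᵐ ω ∂ρ, ∀ y : Sample S A R, |(y.r : ℝ)| ≤ κ.rewardBound →
      |M.noise m γ φ b μb (π ω) (M.valueLimsup γ (π ω))
        (evalIterate m γ φ b (π ω) C η θ₀ (fun l => z l ω) j) y| ≤ 4 * κ.radius * κ.dirBound := by
    intro j _
    filter_upwards [h.policy_mem] with ω hπ y hy
    obtain ⟨θs, hs, hB⟩ := h.standing.realizable _ hπ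
    exact hst.abs_noise_le h.discount_nonneg h.discount_lt.le hπ m hs
      (hB.linValue_eq_limsup h.discount_nonneg h.discount_lt (hst.admissible _ hπ))
      (evalIterate_mem hst.compact h.init_mem _ _ j) hy
  -- For early times the uniform bound suffices, because `2 * κ.lag T * β t ≥ 1`. For later times
  -- the window reaches back at most to `t / 2`, where the steps are still comparable with `β t`.
  by_cases hcase : t < 2 * κ.lag T
  · have a1 : |∫ ω, M.noise m γ φ b μb (π ω) (M.valueLimsup γ (π ω))
        (evalIterate m γ φ b (π ω) C η θ₀ (fun l => z l ω) t) (z t ω) ∂ρ|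
        ≤ 4 * κ.radius * κ.dirBound := by
      have := norm_integral_le_of_norm_le_const (μ := ρ) (C := 4 * κ.radius * κ.dirBound)
        (f := fun ω => M.noise m γ φ b μb (π ω) (M.valueLimsup γ (π ω))
        (evalIterate m γ φ b (π ω) C η θ₀ (fun l => z l ω) t) (z t ω)) (by
          filter_upwards [bound t hT, h.ae_reward_lt] with ω a1 a2
          exact a1 _ (a2 t hT).le)
      simpa using this
    have a2 : 1 ≤ 2 * (κ.lag T * β t) := by
      have b1 : (t : ℝ) ≤ 2 * κ.lag T := by exact_mod_cast hcase.le
      have b2 : 1 ≤ (t : ℝ) * β t := by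
        have := hβ t h1
        rwa [div_le_iff₀' ht] at this
      nlinarith
    have a3 : 0 ≤ 2 * κ.pairingLip * H * κ.meanDirBound * (κ.lag T * β t) := by positivity
    have a4 : 0 ≤ 4 * κ.radius * κ.dirBound := by positivity
    rw [Constants.noiseConst]
    nlinarith [mul_le_mul_of_nonneg_left a2 a4]
  · push Not at hcase
    set i := κ.lag T with hi
    set j := t - i with hj
    have hji : j + i = t := by omega
    have hj1 : 1 ≤ j := by omega
    have hjt : j ≤ t := by omega
    have c1 : |∫ ω, M.noise m γ φ b μb (π ω) (M.valueLimsup γ (π ω))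
        (evalIterate m γ φ b (π ω) C η θ₀ (fun l => z l ω) j) (z t ω) ∂ρ|
        ≤ 8 * κ.radius * κ.dirBound * β t := by
      have a1 := h.data.abs_integral_le (j := j) (i := i) hst.behavior hst.stationary hst.mixing
        (by omega) (F := fun ω y => M.noise m γ φ b μb (π ω) (M.valueLimsup γ (π ω))
          (evalIterate m γ φ b (π ω) C η θ₀ (fun l => z l ω) j) y)
        (h.measurable_noise m (by omega)) (L := 4 * κ.radius * κ.dirBound)
        ((bound j (by omega)).mono fun ω a y hy => a y (hst.reward_bound _ _ _ hy).le)
        (ae_of_all _ fun ω => hst.stateMean_noise m _ _)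
      rw [hji, hi, Constants.lag, Nat.mul_div_cancel_left _ (Nat.succ_pos _)] at a1
      refine a1.trans ?_
      -- The lag consists of `Nat.log 2 T + 1` mixing blocks, so the remaining dependence is below
      -- `1 / T ≤ 1 / t`.
      have a2 : ((1 : ℝ) / 2) ^ (Nat.log 2 T + 1) ≤ β t := by
        refine le_trans ?_ (hβ t h1)
        rw [one_div_pow]
        refine one_div_le_one_div_of_le ht ?_
        have : T < 2 ^ (Nat.log 2 T + 1) := Nat.lt_pow_succ_log_self (by norm_num) T
        exact_mod_cast (hT.trans this.le)
      have a3 : 0 ≤ 8 * κ.radius * κ.dirBound := by positivity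
      nlinarith [mul_le_mul_of_nonneg_left a2 a3]
    -- The movement over the window is at most `i` steps, each of mean length at most `H * β t *
    -- κ.meanDirBound`.
    have c2 : |∫ ω, M.noise m γ φ b μb (π ω) (M.valueLimsup γ (π ω))
          (evalIterate m γ φ b (π ω) C η θ₀ (fun l => z l ω) t) (z t ω) ∂ρ
        - ∫ ω, M.noise m γ φ b μb (π ω) (M.valueLimsup γ (π ω))
          (evalIterate m γ φ b (π ω) C η θ₀ (fun l => z l ω) j) (z t ω) ∂ρ|
        ≤ 2 * κ.pairingLip * (i * (H * β t * κ.meanDirBound)) := by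
      rw [← integral_sub (h.integrable_noise m hT hT) (h.integrable_noise m (by omega) hT)]
      have hintegrable : ∀ l ∈ Finset.Ico j t,
          Integrable (fun ω => η l * (κ.dirBound + κ.dirErr * e l ω)) ρ := fun l hl => by
        rw [Finset.mem_Ico] at hl
        exact ((integrable_const _).add
          ((h.integrable_error (by omega) (by omega)).const_mul _)).const_mul _
      calc _ ≤ ∫ ω, 2 * κ.pairingLip
              * ∑ l ∈ Finset.Ico j t, η l * (κ.dirBound + κ.dirErr * e l ω) ∂ρ := by
            rw [← Real.norm_eq_abs]
            refine norm_integral_le_of_norm_le ((integrable_finsetSum _ hintegrable).const_mul _) ?_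
            filter_upwards [h.policy_mem, h.ae_reward_lt, h.norm_sub_le_sum m hj1 hjt hT]
              with ω hπ hr hn
            obtain ⟨θs, hs, hB⟩ := hst.realizable _ hπ
            refine (hst.abs_noise_sub_le h.discount_nonneg h.discount_lt.le hπ m hs
              (hB.linValue_eq_limsup h.discount_nonneg h.discount_lt (hst.admissible _ hπ))
              (evalIterate_mem hst.compact h.init_mem _ _ t)
              (evalIterate_mem hst.compact h.init_mem _ _ j) (hr t hT).le).trans ?_
            exact mul_le_mul_of_nonneg_left hn (by positivity)
        _ ≤ _ := by
            rw [integral_const_mul, integral_finsetSum _ hintegrable]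
            refine mul_le_mul_of_nonneg_left ?_ (by positivity)
            calc _ ≤ ∑ _l ∈ Finset.Ico j t, H * β t * κ.meanDirBound := by
                  refine Finset.sum_le_sum fun l hl => ?_
                  rw [Finset.mem_Ico] at hl
                  have hl1 : 1 ≤ l := by omega
                  have hlT : l ≤ T := by omega
                  rw [integral_const_mul, integral_add (integrable_const _)
                    ((h.integrable_error hl1 hlT).const_mul _), integral_const_mul]
                  refine mul_le_mul (hη l t hl1 (by omega) (by omega)) ?_ ?_ (by positivity)
                  · have := mul_le_mul_of_nonneg_left (h.integral_error_le_const hl1 hlT) hE.le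
                    simpa [Constants.meanDirBound] using this
                  · have : 0 ≤ ∫ ω, e l ω ∂ρ := integral_nonneg_of_ae
                      ((h.ae_direction m hl1 hlT).mono fun ω hω => hω.1)
                    simp only [integral_const, probReal_univ, one_smul]
                    positivity
              _ = _ := by
                  rw [Finset.sum_const, Nat.card_Ico, nsmul_eq_mul]
                  congr 2
                  omega
    have c3 := abs_sub_abs_le_abs_sub (∫ ω, M.noise m γ φ b μb (π ω) (M.valueLimsup γ (π ω))
          (evalIterate m γ φ b (π ω) C η θ₀ (fun l => z l ω) t) (z t ω) ∂ρ)
        (∫ ω, M.noise m γ φ b μb (π ω) (M.valueLimsup γ (π ω))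
          (evalIterate m γ φ b (π ω) C η θ₀ (fun l => z l ω) j) (z t ω) ∂ρ)
    have c4 : 8 * κ.radius * κ.dirBound * β t ≤ 8 * κ.radius * κ.dirBound * β t * i :=
      le_mul_of_one_le_right (by positivity) hlag'
    rw [Constants.noiseConst]
    linarith

end IsEvaluation

end Evaluation

/-! ### Step sizes -/

section Steps

/-- The normalized step `x = c * η t / 2` obeys `x ↦ x * exp (-x)`, a discrete version of `x' = -x ^
2`, hence decays like `1 / t`. -/
lemma contractionStep_bounds {c : ℝ} (hc : 0 < c) {η : ℕ → ℝ} (h : IsContractionStep c η) {t : ℕ}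
    (ht : 1 ≤ t) : 1 / (2 * (t : ℝ)) ≤ c * η t / 2 ∧ c * η t / 2 ≤ 1 / t := by
  obtain ⟨h1, h2, h3⟩ := h
  induction t, ht using Nat.le_induction with
  | base =>
    rw [div_le_iff₀ hc] at h1
    rw [le_div_iff₀ hc] at h2
    constructor <;> norm_num <;> linarith
  | succ t ht ih =>
    obtain ⟨a1, a2⟩ := ih
    have ht0 : (1 : ℝ) ≤ t := by exact_mod_cast ht
    set x := c * η t / 2 with hx
    have hx0 : 0 < x := lt_of_lt_of_le (by positivity) a1
    have hx1 : x ≤ 1 := a2.trans (by rw [div_le_one (by linarith)]; exact ht0)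
    have e1 : c * η (t + 1) / 2 = x / Real.exp x := by
      rw [h3 t ht, show -(1 / 2) * c * η t = -x by rw [hx]; ring, Real.exp_neg, hx]; ring
    have hexp : 0 < Real.exp x := Real.exp_pos x
    rw [div_le_iff₀ (by positivity)] at a1
    rw [le_div_iff₀ (by positivity)] at a2
    rw [e1]
    push_cast
    constructor
    -- From `exp x ≤ 1 + x + x ^ 2 ≤ 1 + 2 * x` for `0 ≤ x ≤ 1`, together with `1 ≤ 2 * t * x`.
    · have b1 := (abs_le.1 (Real.abs_exp_sub_one_sub_id_le (abs_le.2 ⟨by linarith, hx1⟩))).2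
      rw [div_le_div_iff₀ (by positivity) hexp]
      nlinarith
    -- From `exp x ≥ 1 + x`, together with `x * t ≤ 1`.
    · have b1 := Real.add_one_le_exp x
      rw [div_le_div_iff₀ hexp (by positivity)]
      nlinarith

lemma sum_inv_sqrt_le (T : ℕ) :
    ∑ t ∈ Finset.Icc 1 T, 1 / Real.sqrt t ≤ 2 * Real.sqrt T := by
  induction T with
  | zero => simp
  | succ T ih =>
    rw [Finset.sum_Icc_succ_top (by omega)]
    push_cast
    set a := Real.sqrt T with ha
    set q := Real.sqrt ((T : ℝ) + 1) with hq
    have ha0 : 0 ≤ a := Real.sqrt_nonneg _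
    have hq0 : 0 < q := Real.sqrt_pos.2 (by positivity)
    have haa : a * a = T := Real.mul_self_sqrt (by positivity)
    have hqq : q * q = T + 1 := Real.mul_self_sqrt (by positivity)
    have haq : a ≤ q := Real.sqrt_le_sqrt (by linarith)
    have : 1 / q ≤ 2 * (q - a) := by
      rw [div_le_iff₀ hq0]
      nlinarith
    linarith

lemma sum_inv_le (T : ℕ) :
    ∑ t ∈ Finset.Icc 1 T, 1 / (t : ℝ) ≤ 1 + Real.log T := by
  have := harmonic_le_one_add_log T
  rw [harmonic_eq_sum_Icc] at this
  push_cast at this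
  simpa using this

/-- Summation by parts: the increments of the square root are nonnegative, and each `D t` is at most
`L`. -/
lemma sum_sqrt_mul_sub_le {D : ℕ → ℝ} {L : ℝ} (h0 : ∀ t, 0 ≤ D t) (hL : ∀ t, D t ≤ L) (T : ℕ) :
    ∑ t ∈ Finset.Icc 1 T, Real.sqrt t * (D t - D (t + 1)) ≤ Real.sqrt T * L := by
  -- The boundary term is kept so that the induction closes.
  suffices h : ∑ t ∈ Finset.Icc 1 T, Real.sqrt t * (D t - D (t + 1)) + Real.sqrt T * D (T + 1)
      ≤ Real.sqrt T * L by
    nlinarith [mul_nonneg (Real.sqrt_nonneg T) (h0 (T + 1))]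
  induction T with
  | zero => simp
  | succ T ih =>
    rw [Finset.sum_Icc_succ_top (by omega)]
    have h1 : Real.sqrt T ≤ Real.sqrt (T + 1 : ℕ) := Real.sqrt_le_sqrt (by push_cast; linarith)
    nlinarith [mul_le_mul_of_nonneg_left (hL (T + 1)) (sub_nonneg.2 h1)]

end Steps

/-! ### The loss -/

section Loss

variable {S A : Type*} [Fintype S] [DecidableEq S] [Fintype A] [DecidableEq A] {R : Finset ℝ}
  {d : ℕ} {κ : Constants} {M : MDP S A R} {γ : ℝ} {b : S → A → ℝ} {μb : S → ℝ}
  {Adm : Set (S → A → ℝ)} {φ : S → EuclideanSpace ℝ (Fin d)}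
  {C : Set (EuclideanSpace ℝ (Fin d))} {π : S → A → ℝ}

lemma MDP.loss_nonneg {μ : S → ℝ} (hμ : ∀ s, 0 ≤ μ s) (θ : EuclideanSpace ℝ (Fin d)) :
    0 ≤ M.loss γ φ μ π θ :=
  Finset.sum_nonneg fun s _ => mul_nonneg (hμ s) (by positivity)

lemma Standing.loss_le [Nonempty S] (h : Standing κ M γ b μb Adm φ C) (h0 : 0 ≤ γ) (h1 : γ ≤ 1)
    (hπ : π ∈ Adm) {θ : EuclideanSpace ℝ (Fin d)} (hθ : θ ∈ C) :
    M.loss γ φ μb π θ ≤ (1 / 2) * κ.residualBound ^ 2 :=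
  calc M.loss γ φ μb π θ ≤ ∑ s, μb s * ((1 / 2) * κ.residualBound ^ 2) :=
        Finset.sum_le_sum fun s _ => mul_le_mul_of_nonneg_left (by
          have := sq_le_sq' (abs_le.1 (h.abs_residual_le h0 h1 hπ (h.bounded θ hθ) s)).1
            (abs_le.1 (h.abs_residual_le h0 h1 hπ (h.bounded θ hθ) s)).2
          linarith) (h.stationary.nonneg s)
    _ = _ := by rw [← Finset.sum_mul, h.stationary.sum_one, one_mul]

lemma Standing.loss_le_dist_sq [Nonempty S] (h : Standing κ M γ b μb Adm φ C) (h0 : 0 ≤ γ)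
    (h1 : γ ≤ 1) (hπ : π ∈ Adm) {θs : EuclideanSpace ℝ (Fin d)} (hs : M.SolvesBellman γ φ π θs)
    (θ : EuclideanSpace ℝ (Fin d)) :
    M.loss γ φ μb π θ ≤ 2 * κ.featureBound ^ 2 * ‖θ - θs‖ ^ 2 := by
  have key : ∀ s, |residual γ φ (M.meanReward π) (M.nextFeature φ π) θ s|
      ≤ (κ.featureBound + κ.featureBound) * ‖θ - θs‖ := fun s => by
    rw [residual_eq_of_solvesBellman hs, ← inner_sub_feature, ← inner_sub_nextFeature,
      ← inner_smul_right, ← inner_sub_right, real_inner_comm]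
    exact abs_inner_le_mul (norm_smul_sub_le h0 h1 (h.norm_nextFeature_le hπ s)
      (h.feature_bound s)) le_rfl
  calc M.loss γ φ μb π θ ≤ ∑ s, μb s * (2 * κ.featureBound ^ 2 * ‖θ - θs‖ ^ 2) :=
        Finset.sum_le_sum fun s _ => mul_le_mul_of_nonneg_left (by
          have := sq_le_sq' (abs_le.1 (key s)).1 (abs_le.1 (key s)).2
          linarith) (h.stationary.nonneg s)
    _ = _ := by rw [← Finset.sum_mul, h.stationary.sum_one, one_mul]

/-- Jensen's inequality: the residual is affine in the parameter, and the square is convex. -/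
lemma MDP.loss_average_le {μ : S → ℝ} (hμ : ∀ s, 0 ≤ μ s) (T : ℕ)
    (θ : ℕ → EuclideanSpace ℝ (Fin d)) :
    M.loss γ φ μ π ((1 / ((T : ℝ) + 1)) • ∑ t ∈ Finset.range (T + 1), θ t)
      ≤ (1 / ((T : ℝ) + 1)) * ∑ t ∈ Finset.range (T + 1), M.loss γ φ μ π (θ t) := by
  simp_rw [MDP.loss]
  rw [Finset.sum_comm, Finset.mul_sum]
  refine Finset.sum_le_sum fun s _ => ?_
  simp_rw [← Finset.mul_sum]
  rw [mul_left_comm (1 / ((T : ℝ) + 1)) (μ s)]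
  refine mul_le_mul_of_nonneg_left ?_ (hμ s)
  rw [mul_left_comm (1 / ((T : ℝ) + 1)) (1 / 2)]
  refine mul_le_mul_of_nonneg_left ?_ (by norm_num)
  have hT : (0 : ℝ) < (T : ℝ) + 1 := by positivity
  have e : residual γ φ (M.meanReward π) (M.nextFeature φ π)
      ((1 / ((T : ℝ) + 1)) • ∑ t ∈ Finset.range (T + 1), θ t) s
      = (1 / ((T : ℝ) + 1)) * ∑ t ∈ Finset.range (T + 1),
        residual γ φ (M.meanReward π) (M.nextFeature φ π) (θ t) s := by
    simp_rw [residual, inner_smul_right, inner_sum, Finset.sum_add_distrib, Finset.sum_const,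
      Finset.card_range, nsmul_eq_mul]
    push_cast
    field_simp
  rw [e, mul_pow]
  have := sq_sum_le_card_mul_sum_sq (s := Finset.range (T + 1))
    (f := fun t => residual γ φ (M.meanReward π) (M.nextFeature φ π) (θ t) s)
  rw [Finset.card_range] at this
  push_cast at this
  calc _ ≤ (1 / ((T : ℝ) + 1)) ^ 2 * (((T : ℝ) + 1) * ∑ t ∈ Finset.range (T + 1),
        residual γ φ (M.meanReward π) (M.nextFeature φ π) (θ t) s ^ 2) :=
        mul_le_mul_of_nonneg_left this (by positivity)
    _ = _ := by field_simp

/-- One state carries at least the fraction `1 / κ.shift` of the stationary mass, so the mean square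
controls the residual at each state. -/
lemma Standing.sq_residual_le (h : Standing κ M γ b μb Adm φ C) (hπ : π ∈ Adm)
    (θ : EuclideanSpace ℝ (Fin d)) (s : S) :
    residual γ φ (M.meanReward π) (M.nextFeature φ π) θ s ^ 2
      ≤ 2 * κ.shift * M.loss γ φ μb π θ := by
  have h1 : μb s * ((1 / 2) * residual γ φ (M.meanReward π) (M.nextFeature φ π) θ s ^ 2)
      ≤ M.loss γ φ μb π θ :=
    Finset.single_le_sum (f := fun s => μb s *
      ((1 / 2) * residual γ φ (M.meanReward π) (M.nextFeature φ π) θ s ^ 2))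
      (fun s _ => mul_nonneg (h.stationary.nonneg s) (by positivity)) (Finset.mem_univ s)
  have h2 := h.one_le_shift_mul hπ s
  have h3 := mul_le_mul_of_nonneg_left h1 κ.shift_pos.le
  nlinarith [mul_le_mul_of_nonneg_right h2
    (sq_nonneg (residual γ φ (M.meanReward π) (M.nextFeature φ π) θ s))]

/-- Quadratic growth of a strongly convex loss. -/
lemma MDP.dist_sq_le_loss {c : ℝ}
    (hc : StrongConvexOn Set.univ c (M.loss γ φ μb π)) {θs : EuclideanSpace ℝ (Fin d)}
    (hs : M.SolvesBellman γ φ π θs) (θ : EuclideanSpace ℝ (Fin d)) :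
    c * ‖θ - θs‖ ^ 2 ≤ 2 * M.loss γ φ μb π θ := by
  have h1 := hc.2 (Set.mem_univ θ) (Set.mem_univ θs) (by norm_num : (0 : ℝ) ≤ 1 / 2)
    (by norm_num : (0 : ℝ) ≤ 1 / 2) (by norm_num)
  have z1 : M.loss γ φ μb π θs = 0 :=
    Finset.sum_eq_zero fun s _ => by rw [residual_eq_of_solvesBellman hs]; simp
  -- The loss is a quadratic form centered at `θs`, so the midpoint has a quarter of the loss;
  -- strong convexity at the midpoint then gives the growth bound.
  have z2 : M.loss γ φ μb π ((1 / 2 : ℝ) • θ + (1 / 2 : ℝ) • θs) = (1 / 4) * M.loss γ φ μb π θ := by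
    rw [MDP.loss, MDP.loss, Finset.mul_sum]
    refine Finset.sum_congr rfl fun s _ => ?_
    have e1 : ∀ x, linValue φ ((1 / 2 : ℝ) • θ + (1 / 2 : ℝ) • θs) x - linValue φ θs x
        = (1 / 2) * (linValue φ θ x - linValue φ θs x) := fun x => by
      simp only [linValue, inner_add_right, inner_smul_right]; ring
    rw [residual_eq_of_solvesBellman hs, residual_eq_of_solvesBellman hs]
    simp_rw [e1, mul_left_comm _ (1 / 2 : ℝ), ← Finset.mul_sum]
    ring
  rw [z1, z2] at h1
  simp only [smul_eq_mul] at h1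
  linarith

end Loss

/-! ### Accuracy of one policy evaluation -/

section Accuracy

variable {S A : Type*} [Fintype S] [DecidableEq S] [Fintype A] [DecidableEq A] {R : Finset ℝ}
  {d : ℕ} {Ω : Type*} {mΩ : MeasurableSpace Ω}
  {κ : Constants} {M : MDP S A R} {γ : ℝ} {b : S → A → ℝ} {μb : S → ℝ}
  {Adm : Set (S → A → ℝ)} {φ : S → EuclideanSpace ℝ (Fin d)}
  {C : Set (EuclideanSpace ℝ (Fin d))} {η : ℕ → ℝ} {θ₀ : EuclideanSpace ℝ (Fin d)} {T : ℕ}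
  {ρ : Measure Ω} [IsProbabilityMeasure ρ] {ℱ : Filtration ℕ mΩ} {z : ℕ → Ω → Sample S A R}
  {π : Ω → S → A → ℝ} {e : ℕ → Ω → ℝ} [Nonempty S]

lemma integrable_linear_combination {f g k : Ω → ℝ} (hf : Integrable f ρ) (hg : Integrable g ρ)
    (hk : Integrable k ρ) (a₁ a₂ a₃ a₄ : ℝ) :
    Integrable (fun ω => a₁ * f ω + a₂ * g ω + a₃ * k ω + a₄) ρ :=
  (((hf.const_mul a₁).add (hg.const_mul a₂)).add (hk.const_mul a₃)).add (integrable_const a₄)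

lemma integral_linear_combination {f g k : Ω → ℝ} (hf : Integrable f ρ) (hg : Integrable g ρ)
    (hk : Integrable k ρ) (a₁ a₂ a₃ a₄ : ℝ) :
    ∫ ω, (a₁ * f ω + a₂ * g ω + a₃ * k ω + a₄) ∂ρ
      = a₁ * ∫ ω, f ω ∂ρ + a₂ * ∫ ω, g ω ∂ρ + a₃ * ∫ ω, k ω ∂ρ + a₄ := by
  have i1 := hf.const_mul a₁
  have i2 := hg.const_mul a₂
  have i3 := hk.const_mul a₃
  have e1 : ∫ ω, (a₁ * f ω + a₂ * g ω) ∂ρ = ∫ ω, a₁ * f ω ∂ρ + ∫ ω, a₂ * g ω ∂ρ :=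
    integral_add i1 i2
  have e2 : ∫ ω, (a₁ * f ω + a₂ * g ω + a₃ * k ω) ∂ρ
      = ∫ ω, (a₁ * f ω + a₂ * g ω) ∂ρ + ∫ ω, a₃ * k ω ∂ρ := integral_add (i1.add i2) i3
  have e3 : ∫ ω, (a₁ * f ω + a₂ * g ω + a₃ * k ω + a₄) ∂ρ
      = ∫ ω, (a₁ * f ω + a₂ * g ω + a₃ * k ω) ∂ρ + ∫ _, a₄ ∂ρ :=
    integral_add ((i1.add i2).add i3) (integrable_const a₄)
  rw [e3, e2, e1]
  simp_rw [integral_const_mul]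
  simp

/-- Constant in the accuracy of the evaluation in general. -/
def Constants.sqrtRate (κ : Constants) (η₀ : ℝ) : ℝ :=
  2 * κ.radius ^ 2 / η₀ + 2 * κ.noiseConst (2 * η₀) + 2 * κ.radius * κ.dirErr * (1 + κ.estError)
    + 2 * η₀ * (κ.dirBound ^ 2 + κ.dirErr ^ 2 * κ.estError)

/-- Constant in the mean square accuracy of the iterates under a contraction. -/
def Constants.contractionRate (κ : Constants) (c : ℝ) : ℝ :=
  16 * (κ.radius ^ 2 + 4 * κ.noiseConst (4 / c) / c + 10 * κ.dirErr ^ 2 * κ.estError / c ^ 2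
    + 8 * κ.dirBound ^ 2 / c ^ 2)

namespace IsEvaluation

lemma policy_measurable' (h : IsEvaluation κ M γ b μb Adm φ C η θ₀ T ρ ℱ z π e) (s : S) (a : A) :
    Measurable fun ω => π ω s a :=
  (h.policy_measurable s a).mono (ℱ.le 0) le_rfl

lemma noiseConst_nonneg (h : IsEvaluation κ M γ b μb Adm φ C η θ₀ T ρ ℱ z π e) {H : ℝ}
    (hH : 0 ≤ H) : 0 ≤ κ.noiseConst H := by
  have hG := h.standing.dirBound_pos
  have hE := h.standing.dirErr_pos
  have hr := κ.radius_pos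
  have hB := κ.estError_pos
  have hC := κ.shift_pos
  have hL : 0 ≤ κ.pairingLip := by
    rw [Constants.pairingLip, Constants.dirLip]; positivity
  have hD : 0 ≤ κ.meanDirBound := by rw [Constants.meanDirBound]; positivity
  rw [Constants.noiseConst]
  positivity

lemma integrable_loss_iterate (h : IsEvaluation κ M γ b μb Adm φ C η θ₀ T ρ ℱ z π e) (m : Method)
    {t : ℕ} (ht : t ≤ T) : Integrable (fun ω => M.loss γ φ μb (π ω)
      (evalIterate m γ φ b (π ω) C η θ₀ (fun l => z l ω) t)) ρ := by
  refine Integrable.of_bound (M.measurable_loss γ φ μb h.policy_measurable'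
    ((h.measurable_iterate m (ht.trans (Nat.le_succ T))).mono (ℱ.le t)
      le_rfl)).aestronglyMeasurable ((1 / 2) * κ.residualBound ^ 2) ?_
  filter_upwards [h.policy_mem] with ω hπ
  rw [Real.norm_eq_abs, abs_of_nonneg (M.loss_nonneg h.standing.stationary.nonneg _)]
  exact h.standing.loss_le h.discount_nonneg h.discount_lt.le hπ
    (evalIterate_mem h.standing.compact h.init_mem _ _ t)

lemma integrable_loss_output (h : IsEvaluation κ M γ b μb Adm φ C η θ₀ T ρ ℱ z π e) (m : Method) :
    Integrable (fun ω => M.loss γ φ μb (π ω)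
      (evalOutput m γ φ b (π ω) C η θ₀ (fun l => z l ω) T)) ρ := by
  have hintegrable : Integrable (fun ω => (1 / ((T : ℝ) + 1)) * ∑ t ∈ Finset.range (T + 1),
      M.loss γ φ μb (π ω) (evalIterate m γ φ b (π ω) C η θ₀ (fun l => z l ω) t)) ρ :=
    (integrable_finsetSum _ fun t ht =>
      h.integrable_loss_iterate m (Finset.mem_range_succ_iff.1 ht)).const_mul _
  refine hintegrable.mono' (M.measurable_loss γ φ μb h.policy_measurable'
    (measurable_evalOutput m γ φ b h.policy_measurable' h.standing.compact h.standing.convex η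
      h.init_mem fun l hl => h.data.measurable_sample' (by omega))).aestronglyMeasurable
    (ae_of_all _ fun ω => ?_)
  rw [Real.norm_eq_abs, abs_of_nonneg (M.loss_nonneg h.standing.stationary.nonneg _)]
  exact M.loss_average_le h.standing.stationary.nonneg T _

/-- The output averages the times `0, …, T`, but the recursion starts at time `1`. The iterates at
times `0` and `1` coincide, so the extra term at most doubles the sum. -/
lemma integral_loss_output_le (h : IsEvaluation κ M γ b μb Adm φ C η θ₀ T ρ ℱ z π e) (m : Method)
    (hT : 1 ≤ T) {L : ℝ} (hL : ∑ t ∈ Finset.Icc 1 T, ∫ ω, M.loss γ φ μb (π ω)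
      (evalIterate m γ φ b (π ω) C η θ₀ (fun l => z l ω) t) ∂ρ ≤ L) :
    ∫ ω, M.loss γ φ μb (π ω) (evalOutput m γ φ b (π ω) C η θ₀ (fun l => z l ω) T) ∂ρ
      ≤ 2 * L / T := by
  have hT0 : (0 : ℝ) < T := by exact_mod_cast hT
  have hnn : ∀ t, 0 ≤ ∫ ω, M.loss γ φ μb (π ω)
      (evalIterate m γ φ b (π ω) C η θ₀ (fun l => z l ω) t) ∂ρ := fun t =>
    integral_nonneg fun ω => M.loss_nonneg h.standing.stationary.nonneg _
  have hsplit : ∑ t ∈ Finset.range (T + 1), ∫ ω, M.loss γ φ μb (π ω)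
      (evalIterate m γ φ b (π ω) C η θ₀ (fun l => z l ω) t) ∂ρ ≤ 2 * L := by
    rw [Finset.range_eq_Ico, Finset.sum_eq_sum_Ico_succ_bot (by omega)]
    have e1 : Finset.Ico (0 + 1) (T + 1) = Finset.Icc 1 T := by
      ext t; simp only [Finset.mem_Ico, Finset.mem_Icc]; omega
    rw [e1]
    have e2 := Finset.single_le_sum (f := fun t => ∫ ω, M.loss γ φ μb (π ω)
      (evalIterate m γ φ b (π ω) C η θ₀ (fun l => z l ω) t) ∂ρ) (fun t _ => hnn t)
      (Finset.mem_Icc.2 ⟨le_rfl, hT⟩)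
    have e3 : ∫ ω, M.loss γ φ μb (π ω) (evalIterate m γ φ b (π ω) C η θ₀ (fun l => z l ω) 0) ∂ρ
        = ∫ ω, M.loss γ φ μb (π ω) (evalIterate m γ φ b (π ω) C η θ₀ (fun l => z l ω) 1) ∂ρ := rfl
    rw [e3]
    linarith
  calc _ ≤ ∫ ω, (1 / ((T : ℝ) + 1)) * ∑ t ∈ Finset.range (T + 1),
      M.loss γ φ μb (π ω) (evalIterate m γ φ b (π ω) C η θ₀ (fun l => z l ω) t) ∂ρ :=
        integral_mono (h.integrable_loss_output m) ((integrable_finsetSum _ fun t ht =>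
          h.integrable_loss_iterate m (Finset.mem_range_succ_iff.1 ht)).const_mul _)
          fun ω => M.loss_average_le h.standing.stationary.nonneg T _
    _ ≤ (1 / ((T : ℝ) + 1)) * (2 * L) := by
        rw [integral_const_mul, integral_finsetSum _ fun t ht =>
          h.integrable_loss_iterate m (Finset.mem_range_succ_iff.1 ht)]
        exact mul_le_mul_of_nonneg_left hsplit (by positivity)
    _ ≤ (1 / T) * (2 * L) := by
        refine mul_le_mul_of_nonneg_right (one_div_le_one_div_of_le hT0 (by linarith))
          ((Finset.sum_nonneg fun t _ => hnn t).trans hsplit)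
    _ = _ := by ring

/-- Accuracy of the SGD-based updates in general. -/
lemma integral_loss_le_sqrt {η₀ : ℝ} (hη₀ : 0 < η₀)
    (h : IsEvaluation κ M γ b μb Adm φ C (fun t => η₀ / Real.sqrt t) θ₀ T ρ ℱ z π e)
    {m : Method} (hm : m.IsSGD) (hT : 1 ≤ T) :
    ∫ ω, M.loss γ φ μb (π ω)
        (evalOutput m γ φ b (π ω) C (fun t => η₀ / Real.sqrt t) θ₀ (fun l => z l ω) T) ∂ρ
      ≤ 2 * κ.sqrtRate η₀ * κ.lag T / Real.sqrt T := by
  have hst := h.standing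
  have hG := hst.dirBound_pos
  have hE := hst.dirErr_pos
  have hr := κ.radius_pos
  have hB := κ.estError_pos
  have hN : 0 ≤ κ.noiseConst (2 * η₀) := h.noiseConst_nonneg (by positivity)
  have hlag : 1 ≤ κ.lag T := Nat.mul_pos (Nat.succ_pos _) (Nat.succ_pos _)
  have hlag' : (1 : ℝ) ≤ κ.lag T := by exact_mod_cast hlag
  have hT0 : (0 : ℝ) < T := by exact_mod_cast hT
  set η : ℕ → ℝ := fun t => η₀ / Real.sqrt t with hη
  set θ : ℕ → Ω → EuclideanSpace ℝ (Fin d) := fun t ω =>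
    evalIterate m γ φ b (π ω) C η θ₀ (fun l => z l ω) t with hθ
  set f : ℕ → Ω → ℝ := fun t ω => M.noise m γ φ b μb (π ω) (M.valueLimsup γ (π ω)) (θ t ω) (z t ω)
    with hf
  set q : ℕ → ℝ := fun t => Real.sqrt t with hq
  have hq1 : ∀ t, 1 ≤ t → 1 ≤ q t := fun t ht => Real.one_le_sqrt.2 (by exact_mod_cast ht)
  have hnoise : ∀ t, 1 ≤ t → t ≤ T →
      |∫ ω, f t ω ∂ρ| ≤ κ.noiseConst (2 * η₀) * κ.lag T * (1 / q t) := fun t h1 h2 => by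
    refine h.abs_integral_noise_le m (β := fun t => 1 / q t) (by positivity) (fun t ht => ?_)
      (fun l t hl hlt htl => ?_) h1 h2
    · have ht' : (0 : ℝ) < t := by exact_mod_cast ht
      refine one_div_le_one_div_of_le (by linarith [hq1 t ht]) ?_
      have := Real.mul_self_sqrt ht'.le
      nlinarith [hq1 t ht]
    · have a1 := hq1 l hl
      have a2 := hq1 t (hl.trans hlt)
      have a3 : q t ≤ 2 * q l := by
        have : q t ≤ Real.sqrt (2 ^ 2 * l) := Real.sqrt_le_sqrt (by
          have : (t : ℝ) ≤ 2 * l := by exact_mod_cast htl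
          have : (0 : ℝ) ≤ l := by positivity
          linarith)
        rwa [Real.sqrt_mul (by norm_num), Real.sqrt_sq (by norm_num)] at this
      rw [hη, mul_one_div]
      change η₀ / q l ≤ 2 * η₀ / q t
      rw [div_le_div_iff₀ (by linarith) (by linarith)]
      nlinarith
  -- Everything in the recursion other than the loss and the telescoping difference, after division
  -- by `η t`: noise, estimation error paired with a distance of at most `2 * κ.radius`, and squared
  -- step.
  set X : ℕ → Ω → ℝ := fun t ω => -2 * f t ω + 4 * κ.radius * κ.dirErr * e t ω
    + 2 * η t * κ.dirErr ^ 2 * e t ω ^ 2 + 2 * η t * κ.dirBound ^ 2 with hX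
  have hXint : ∀ t ∈ Finset.Icc 1 T, Integrable (X t) ρ := fun t ht => by
    obtain ⟨h1, h2⟩ := Finset.mem_Icc.1 ht
    exact integrable_linear_combination (h.integrable_noise m h2 h2) (h.integrable_error h1 h2)
      (h.integrable_error_sq h1 h2) _ _ _ _
  have hXle : ∀ t ∈ Finset.Icc 1 T, ∫ ω, X t ω ∂ρ ≤ (2 * κ.noiseConst (2 * η₀)
      + 2 * κ.radius * κ.dirErr * (1 + κ.estError)
      + 2 * η₀ * (κ.dirBound ^ 2 + κ.dirErr ^ 2 * κ.estError)) * κ.lag T * (1 / q t) := by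
    intro t ht
    obtain ⟨h1, h2⟩ := Finset.mem_Icc.1 ht
    have e1 : ∫ ω, X t ω ∂ρ = -2 * ∫ ω, f t ω ∂ρ + 4 * κ.radius * κ.dirErr * ∫ ω, e t ω ∂ρ
        + 2 * η t * κ.dirErr ^ 2 * ∫ ω, e t ω ^ 2 ∂ρ + 2 * η t * κ.dirBound ^ 2 :=
      integral_linear_combination (h.integrable_noise m h2 h2) (h.integrable_error h1 h2)
        (h.integrable_error_sq h1 h2) _ _ _ _
    have b1 := (abs_le.1 (hnoise t h1 h2)).1
    have b2 := mul_le_mul_of_nonneg_left (h.integral_error_le h1 h2)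
      (by positivity : 0 ≤ 4 * κ.radius * κ.dirErr)
    have ht0 : (1 : ℝ) ≤ t := by exact_mod_cast h1
    have b3 : ∫ ω, e t ω ^ 2 ∂ρ ≤ κ.estError :=
      (h.error_sq t h1 h2).trans (div_le_self hB.le ht0)
    have hq0 : 0 < 1 / q t := one_div_pos.2 (by linarith [hq1 t h1])
    have b4 : 2 * η t * κ.dirErr ^ 2 * ∫ ω, e t ω ^ 2 ∂ρ + 2 * η t * κ.dirBound ^ 2
        ≤ 2 * η₀ * (κ.dirBound ^ 2 + κ.dirErr ^ 2 * κ.estError) * (1 / q t) := by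
      have : η t = η₀ * (1 / q t) := by rw [hη, mul_one_div]
      rw [this]
      have b5 := mul_le_mul_of_nonneg_left b3 (by positivity : 0 ≤ 2 * κ.dirErr ^ 2)
      have b6 := mul_le_mul_of_nonneg_left b5 (by positivity : 0 ≤ η₀ * (1 / q t))
      linarith
    have b7 : 4 * κ.radius * κ.dirErr * ((1 + κ.estError) / 2 / Real.sqrt t)
        = 2 * κ.radius * κ.dirErr * (1 + κ.estError) * (1 / q t) := by
      rw [hq]; ring
    have b8 : (2 * κ.radius * κ.dirErr * (1 + κ.estError)
        + 2 * η₀ * (κ.dirBound ^ 2 + κ.dirErr ^ 2 * κ.estError)) * (1 / q t)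
        ≤ (2 * κ.radius * κ.dirErr * (1 + κ.estError)
        + 2 * η₀ * (κ.dirBound ^ 2 + κ.dirErr ^ 2 * κ.estError)) * (1 / q t) * κ.lag T :=
      le_mul_of_one_le_right (by positivity) hlag'
    rw [e1]
    linarith
  have path : ∀ᵐ ω ∂ρ, ∑ t ∈ Finset.Icc 1 T, 4 * M.loss γ φ μb (π ω) (θ t ω)
      ≤ 4 * κ.radius ^ 2 / η₀ * Real.sqrt T + ∑ t ∈ Finset.Icc 1 T, X t ω := by
    -- Dividing the recursion by `η t`; the drift `2 * loss` occurs with the factor `2`. The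
    -- solution is quantified inside the almost sure statement, and only after summation over `t`
    -- has removed it are expectations taken.
    have hall : ∀ᵐ ω ∂ρ, ∀ t ∈ Finset.Icc 1 T, ∀ θs ∈ C, M.SolvesBellman γ φ (π ω) θs →
        4 * M.loss γ φ μb (π ω) (θ t ω)
          ≤ 1 / η₀ * (q t * (‖θ t ω - θs‖ ^ 2 - ‖θ (t + 1) ω - θs‖ ^ 2)) + X t ω := by
      rw [ae_all_iff]
      intro t
      by_cases ht : t ∈ Finset.Icc 1 T
      · obtain ⟨h1, h2⟩ := Finset.mem_Icc.1 ht
        filter_upwards [h.dist_sq_succ_le m h1 h2, h.policy_mem, h.ae_direction m h1 h2]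
          with ω a1 a2 a3 _ θs hs hB
        have a4 := a1 θs hs hB
        rw [hst.stateMean_pairing_eq a2 hm hB
          (hB.linValue_eq_limsup h.discount_nonneg h.discount_lt (hst.admissible _ a2))] at a4
        have a5 : ‖θ t ω - θs‖ ≤ 2 * κ.radius :=
          hst.norm_sub_le_two_mul (evalIterate_mem hst.compact h.init_mem _ _ t) hs
        have hq0 : 0 < q t := by linarith [hq1 t h1]
        have a6 : η t = η₀ / q t := rfl
        have hη0 : 0 < η t := by rw [a6]; positivity
        have a7 := mul_le_mul_of_nonneg_right a5 (mul_nonneg hE.le a3.1)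
        have a8 : 1 / η₀ * (q t * (‖θ t ω - θs‖ ^ 2 - ‖θ (t + 1) ω - θs‖ ^ 2))
            = (‖θ t ω - θs‖ ^ 2 - ‖θ (t + 1) ω - θs‖ ^ 2) / η t := by
          rw [a6]; field_simp
        rw [a8, ← sub_le_iff_le_add, le_div_iff₀ hη0, hX]
        dsimp only
        have a9 := mul_le_mul_of_nonneg_left a7 hη0.le
        linarith
      · exact ae_of_all _ fun ω h => absurd h ht
    filter_upwards [hall, h.policy_mem] with ω a1 a2
    obtain ⟨θs, hs, hB⟩ := hst.realizable _ a2
    have a3 : ∀ t, ‖θ t ω - θs‖ ^ 2 ≤ 4 * κ.radius ^ 2 := fun t => by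
      have := pow_le_pow_left₀ (norm_nonneg _)
        (hst.norm_sub_le_two_mul (evalIterate_mem (m := m) (γ := γ) (φ := φ) (b := b) (η := η)
          hst.compact h.init_mem (π ω) (fun l => z l ω) t) hs) 2
      linarith
    have a4 := sum_sqrt_mul_sub_le (D := fun t => ‖θ t ω - θs‖ ^ 2) (fun t => sq_nonneg _) a3 T
    calc _ ≤ ∑ t ∈ Finset.Icc 1 T, (1 / η₀ * (q t * (‖θ t ω - θs‖ ^ 2 - ‖θ (t + 1) ω - θs‖ ^ 2))
          + X t ω) := Finset.sum_le_sum fun t ht => a1 t ht θs hs hB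
      _ = 1 / η₀ * ∑ t ∈ Finset.Icc 1 T, q t * (‖θ t ω - θs‖ ^ 2 - ‖θ (t + 1) ω - θs‖ ^ 2)
          + ∑ t ∈ Finset.Icc 1 T, X t ω := by rw [Finset.sum_add_distrib, Finset.mul_sum]
      _ ≤ 1 / η₀ * (Real.sqrt T * (4 * κ.radius ^ 2)) + ∑ t ∈ Finset.Icc 1 T, X t ω :=
          add_le_add_left (mul_le_mul_of_nonneg_left a4 (by positivity)) _
      _ = _ := by ring
  have hli : ∀ t ∈ Finset.Icc 1 T,
      Integrable (fun ω => 4 * M.loss γ φ μb (π ω) (θ t ω)) ρ := fun t ht =>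
    (h.integrable_loss_iterate m (Finset.mem_Icc.1 ht).2).const_mul _
  have fin := integral_mono_ae (integrable_finsetSum _ hli)
    ((integrable_const _).add (integrable_finsetSum _ hXint)) path
  have hXi : Integrable (fun ω => ∑ t ∈ Finset.Icc 1 T, X t ω) ρ := integrable_finsetSum _ hXint
  rw [integral_finsetSum _ hli, integral_add' (integrable_const _) hXi,
    integral_finsetSum _ hXint] at fin
  simp_rw [integral_const_mul] at fin
  rw [← Finset.mul_sum] at fin
  simp only [integral_const, probReal_univ, one_smul] at fin
  have hsum := Finset.sum_le_sum hXle
  rw [← Finset.mul_sum] at hsum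
  set Z := 2 * κ.noiseConst (2 * η₀)
      + 2 * κ.radius * κ.dirErr * (1 + κ.estError)
      + 2 * η₀ * (κ.dirBound ^ 2 + κ.dirErr ^ 2 * κ.estError) with hZ
  have hZ0 : 0 ≤ Z := by positivity
  have hs2 := mul_le_mul_of_nonneg_left (sum_inv_sqrt_le T)
    (by positivity : 0 ≤ Z * (κ.lag T : ℝ))
  have hs3 : 4 * κ.radius ^ 2 / η₀ * Real.sqrt T
      ≤ 4 * κ.radius ^ 2 / η₀ * Real.sqrt T * κ.lag T :=
    le_mul_of_one_le_right (by positivity) hlag'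
  have key : ∑ t ∈ Finset.Icc 1 T, ∫ ω, M.loss γ φ μb (π ω) (θ t ω) ∂ρ
      ≤ κ.sqrtRate η₀ * κ.lag T * Real.sqrt T := by
    have e1 : κ.sqrtRate η₀ = 2 * κ.radius ^ 2 / η₀ + Z := by
      rw [Constants.sqrtRate, hZ]; ring
    have e2 : 0 ≤ κ.radius ^ 2 / η₀ * Real.sqrt T * κ.lag T := by positivity
    have e3 : 0 ≤ Z * κ.lag T * Real.sqrt T := by positivity
    rw [e1]
    have hs4 : ∑ t ∈ Finset.Icc 1 T, ∫ ω, X t ω ∂ρ ≤ Z * κ.lag T * (2 * Real.sqrt T) :=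
      hsum.trans hs2
    have e4 : 4 * κ.radius ^ 2 / η₀ * Real.sqrt T * κ.lag T
      = 4 * (κ.radius ^ 2 / η₀ * Real.sqrt T * κ.lag T) := by ring
    have e5 : (2 * κ.radius ^ 2 / η₀ + Z) * κ.lag T * Real.sqrt T
      = 2 * (κ.radius ^ 2 / η₀ * Real.sqrt T * κ.lag T) + Z * κ.lag T * Real.sqrt T := by ring
    linarith
  refine (h.integral_loss_output_le m hT key).trans (le_of_eq ?_)
  have hsT : Real.sqrt T * Real.sqrt T = T := Real.mul_self_sqrt hT0.le
  have hsT0 : 0 < Real.sqrt T := Real.sqrt_pos.2 hT0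
  rw [div_eq_div_iff hT0.ne' hsT0.ne']
  calc _ = 2 * κ.sqrtRate η₀ * κ.lag T * (Real.sqrt T * Real.sqrt T) := by ring
    _ = _ := by rw [hsT]

end IsEvaluation

end Accuracy

/-! ### Accuracy of one policy evaluation under a contraction. -/

section ContractionAccuracy

variable {S A : Type*} [Fintype S] [DecidableEq S] [Fintype A] [DecidableEq A] {R : Finset ℝ}
  {d : ℕ} {Ω : Type*} {mΩ : MeasurableSpace Ω}
  {κ : Constants} {M : MDP S A R} {γ : ℝ} {b : S → A → ℝ} {μb : S → ℝ}
  {Adm : Set (S → A → ℝ)} {φ : S → EuclideanSpace ℝ (Fin d)}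
  {C : Set (EuclideanSpace ℝ (Fin d))} {η : ℕ → ℝ} {θ₀ : EuclideanSpace ℝ (Fin d)} {T : ℕ}
  {ρ : Measure Ω} [IsProbabilityMeasure ρ] {ℱ : Filtration ℕ mΩ} {z : ℕ → Ω → Sample S A R}
  {π : Ω → S → A → ℝ} {e : ℕ → Ω → ℝ} [Nonempty S]

namespace IsEvaluation

/-- Mean square accuracy of the iterates under a contraction. The solution `θs (π ω)` need not
depend measurably on `ω`, so the squared distance is dominated by an integrable `U`. -/
lemma exists_dist_sq_le {c : ℝ} (hc : 0 < c)
    (h : IsEvaluation κ M γ b μb Adm φ C η θ₀ T ρ ℱ z π e) (hη : IsContractionStep c η)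
    (m : Method) {θs : (S → A → ℝ) → EuclideanSpace ℝ (Fin d)}
    (hs : ∀ σ ∈ Adm, θs σ ∈ C ∧ M.SolvesBellman γ φ σ (θs σ) ∧
      ∀ θ, c * ‖θ - θs σ‖ ^ 2
        ≤ M.stateMean b μb (M.pairing m γ φ b μb σ (M.valueLimsup γ σ) θ))
    {t : ℕ} (ht : 1 ≤ t) (htT : t ≤ T) :
    ∃ U : Ω → ℝ, Integrable U ρ ∧
      (∀ᵐ ω ∂ρ, ‖evalIterate m γ φ b (π ω) C η θ₀ (fun l => z l ω) t - θs (π ω)‖ ^ 2 ≤ U ω) ∧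
      ∫ ω, U ω ∂ρ ≤ (c * η t / 2) ^ 2 * (κ.contractionRate c * κ.lag T * t) := by
  have hst := h.standing
  have hG := hst.dirBound_pos
  have hE := hst.dirErr_pos
  have hr := κ.radius_pos
  have hB := κ.estError_pos
  have hN : 0 ≤ κ.noiseConst (4 / c) := h.noiseConst_nonneg (by positivity)
  have hlag : 1 ≤ κ.lag T := Nat.mul_pos (Nat.succ_pos _) (Nat.succ_pos _)
  have hlag' : (1 : ℝ) ≤ κ.lag T := by exact_mod_cast hlag
  set Z := 4 * κ.noiseConst (4 / c) / c + 10 * κ.dirErr ^ 2 * κ.estError / c ^ 2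
    + 8 * κ.dirBound ^ 2 / c ^ 2 with hZ
  have hZ0 : 0 ≤ Z := by positivity
  have hW : κ.contractionRate c = 16 * (κ.radius ^ 2 + Z) := by
    rw [Constants.contractionRate, hZ]; ring
  rw [hW]
  -- The squared distance is measured in units of `x ^ 2` with `x = c * η t / 2`. The step rule
  -- multiplies `x ^ 2` by exactly `exp (-2 * x)`, which dominates the contraction factor `1 - 2 *
  -- x`. In these units the contraction disappears and each step adds a bounded amount, whence the
  -- linear growth in `t`.
  induction t, ht using Nat.le_induction with
  | base =>
    -- Here `x ≥ 1 / 2` and the squared distance is at most `4 * κ.radius ^ 2`, which accounts for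
    -- the factor `16` on `κ.radius ^ 2`.
    refine ⟨fun _ => 4 * κ.radius ^ 2, integrable_const _, ?_, ?_⟩
    · filter_upwards [h.policy_mem] with ω hω
      have := pow_le_pow_left₀ (norm_nonneg _)
        (hst.norm_sub_le_two_mul (evalIterate_mem (m := m) (γ := γ) (φ := φ) (b := b) (η := η)
          hst.compact h.init_mem (π ω) (fun l => z l ω) 1) (hs _ hω).1) 2
      linarith
    · have h1 := (contractionStep_bounds hc hη le_rfl).1
      norm_num at h1
      have h2 : (1 / 2) ^ 2 ≤ (c * η 1 / 2) ^ 2 := pow_le_pow_left₀ (by norm_num) h1 2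
      have h3 : 16 * κ.radius ^ 2 ≤ 16 * (κ.radius ^ 2 + Z) * κ.lag T * (1 : ℕ) := by
        rw [Nat.cast_one, mul_one]
        exact le_trans (by linarith) (le_mul_of_one_le_right (by positivity) hlag')
      have h4 := mul_le_mul h2 h3 (by positivity) (by positivity)
      simp only [integral_const, probReal_univ, one_smul]
      linarith
  | succ t ht ih =>
    have htT' : t ≤ T := by omega
    obtain ⟨U, hU, hD, hUle⟩ := ih htT'
    have ht0 : (1 : ℝ) ≤ t := by exact_mod_cast ht
    obtain ⟨x1, x2⟩ := contractionStep_bounds hc hη ht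
    have y1 := (contractionStep_bounds hc hη (Nat.le_add_left 1 t)).1
    have hη0 := h.step_nonneg t ht
    set x := c * η t / 2 with hx
    have hηx : η t = 2 * x / c := by rw [hx]; field_simp
    have hx0 : 0 < x := lt_of_lt_of_le (by positivity) x1
    have hrec : (c * η (t + 1) / 2) ^ 2 = Real.exp (-2 * x) * x ^ 2 := by
      rw [hη.2.2 t ht, show -(1 / 2) * c * η t = -x by rw [hx]; ring,
        show -2 * x = -x + -x by ring, Real.exp_add, hx]
      ring
    set f : Ω → ℝ := fun ω => M.noise m γ φ b μb (π ω) (M.valueLimsup γ (π ω))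
      (evalIterate m γ φ b (π ω) C η θ₀ (fun l => z l ω) t) (z t ω) with hf
    have hfint : Integrable f ρ := h.integrable_noise m htT' htT'
    have hnoise : |∫ ω, f ω ∂ρ| ≤ κ.noiseConst (4 / c) * κ.lag T * (1 / (t : ℝ)) :=
      h.abs_integral_noise_le m (β := fun t => 1 / (t : ℝ)) (by positivity) (fun t _ => le_rfl)
        (fun l t hl hlt htl => by
          have a1 := (contractionStep_bounds hc hη hl).2
          have hl0 : (0 : ℝ) < l := by exact_mod_cast hl
          have ht0 : (0 : ℝ) < t := by exact_mod_cast hl.trans hlt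
          have htl' : (t : ℝ) ≤ 2 * l := by exact_mod_cast htl
          rw [div_mul_div_comm, le_div_iff₀ (by positivity)]
          rw [div_le_div_iff₀ two_pos hl0] at a1
          have hηl : 0 ≤ c * η l := mul_nonneg hc.le (h.step_nonneg l hl)
          nlinarith [mul_le_mul_of_nonneg_left htl' hηl]) ht htT'
    refine ⟨fun ω => Real.exp (-2 * x) * U ω + (-2 * η t) * f ω
        + (η t * κ.dirErr ^ 2 / c + 2 * η t ^ 2 * κ.dirErr ^ 2) * e t ω ^ 2
        + 2 * η t ^ 2 * κ.dirBound ^ 2,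
      integrable_linear_combination hU hfint (h.integrable_error_sq ht htT') _ _ _ _, ?_, ?_⟩
    · filter_upwards [hD, h.policy_mem, h.dist_sq_succ_le m ht htT'] with ω a1 a2 a3
      obtain ⟨s1, s2, s3⟩ := hs _ a2
      have a4 := a3 _ s1 s2
      have a5 := s3 (evalIterate m γ φ b (π ω) C η θ₀ (fun l => z l ω) t)
      refine a4.trans ?_
      set D := ‖evalIterate m γ φ b (π ω) C η θ₀ (fun l => z l ω) t - θs (π ω)‖ with hDdef
      set q := M.stateMean b μb (M.pairing m γ φ b μb (π ω) (M.valueLimsup γ (π ω))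
        (evalIterate m γ φ b (π ω) C η θ₀ (fun l => z l ω) t)) with hq
      -- Young's inequality spends half of the contraction on the estimation error; the other half
      -- leaves the factor `1 - c * η t = 1 - 2 * x`.
      have a6 : 2 * (D * (κ.dirErr * e t ω)) ≤ c * D ^ 2 + κ.dirErr ^ 2 * e t ω ^ 2 / c := by
        have : c * D ^ 2 + κ.dirErr ^ 2 * e t ω ^ 2 / c - 2 * (D * (κ.dirErr * e t ω))
            = (c * D - κ.dirErr * e t ω) ^ 2 / c := by field_simp; ring
        have : 0 ≤ (c * D - κ.dirErr * e t ω) ^ 2 / c := by positivity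
        linarith
      have a7 := mul_le_mul_of_nonneg_left a6 hη0
      have a8 := mul_le_mul_of_nonneg_left a5 hη0
      have a9 : (1 - 2 * x) * D ^ 2 ≤ Real.exp (-2 * x) * U ω :=
        (mul_le_mul_of_nonneg_right (by linarith [Real.add_one_le_exp (-2 * x)])
          (sq_nonneg D)).trans (mul_le_mul_of_nonneg_left a1 (Real.exp_pos _).le)
      have a10 : (1 - 2 * x) * D ^ 2 = D ^ 2 - η t * (c * D ^ 2) := by rw [hx]; ring
      have a11 : η t * (κ.dirErr ^ 2 * e t ω ^ 2 / c) = η t * κ.dirErr ^ 2 / c * e t ω ^ 2 := by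
        ring
      have a12 : f ω = M.noise m γ φ b μb (π ω) (M.valueLimsup γ (π ω))
        (evalIterate m γ φ b (π ω) C η θ₀ (fun l => z l ω) t) (z t ω) := rfl
      rw [← a12]
      linarith
    · rw [integral_linear_combination hU hfint (h.integrable_error_sq ht htT'), hrec]
      have b1 := mul_le_mul_of_nonneg_left hUle (Real.exp_pos (-2 * x)).le
      have b2 : -2 * η t * ∫ ω, f ω ∂ρ
          ≤ 4 * κ.noiseConst (4 / c) / c * κ.lag T * (1 / (t : ℝ) ^ 2) := by
        have c1 := (abs_le.1 hnoise).1
        have c2 := mul_le_mul_of_nonneg_left c1 hη0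
        have c3 : η t ≤ 2 / c * (1 / t) := by
          rw [hηx, mul_div_assoc, mul_comm 2 (x / c), div_mul_eq_mul_div, mul_comm x 2,
            mul_div_right_comm]
          exact mul_le_mul_of_nonneg_left x2 (by positivity)
        have c4 := mul_le_mul_of_nonneg_right c3
          (by positivity : 0 ≤ κ.noiseConst (4 / c) * κ.lag T * (1 / (t : ℝ)))
        have c5 : 4 * κ.noiseConst (4 / c) / c * κ.lag T * (1 / (t : ℝ) ^ 2)
            = 2 * (2 / c * (1 / t) * (κ.noiseConst (4 / c) * κ.lag T * (1 / (t : ℝ)))) := by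
          field_simp; ring
        rw [c5]
        linarith
      have hx2 : x ^ 2 ≤ 1 / (t : ℝ) ^ 2 := by
        have := pow_le_pow_left₀ hx0.le x2 2
        rwa [one_div_pow] at this
      have b3 : (η t * κ.dirErr ^ 2 / c + 2 * η t ^ 2 * κ.dirErr ^ 2) * ∫ ω, e t ω ^ 2 ∂ρ
          ≤ 10 * κ.dirErr ^ 2 * κ.estError / c ^ 2 * (1 / (t : ℝ) ^ 2) := by
        have c1 := mul_le_mul_of_nonneg_left (h.error_sq t ht htT')
          (by positivity : 0 ≤ η t * κ.dirErr ^ 2 / c + 2 * η t ^ 2 * κ.dirErr ^ 2)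
        refine c1.trans ?_
        have c2 : x ^ 2 ≤ 1 / (t : ℝ) :=
          hx2.trans (one_div_le_one_div_of_le (by linarith) (by nlinarith))
        have c3 : η t * κ.dirErr ^ 2 / c + 2 * η t ^ 2 * κ.dirErr ^ 2
            = (2 * x + 8 * x ^ 2) * (κ.dirErr ^ 2 / c ^ 2) := by
          rw [hηx]; field_simp; ring
        have c4 : (2 * x + 8 * x ^ 2) ≤ 10 * (1 / (t : ℝ)) := by linarith
        rw [c3]
        calc _ ≤ 10 * (1 / (t : ℝ)) * (κ.dirErr ^ 2 / c ^ 2) * (κ.estError / t) := by gcongr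
          _ = _ := by field_simp
      have b4 : 2 * η t ^ 2 * κ.dirBound ^ 2
          ≤ 8 * κ.dirBound ^ 2 / c ^ 2 * (1 / (t : ℝ) ^ 2) := by
        calc _ = 8 * κ.dirBound ^ 2 / c ^ 2 * x ^ 2 := by rw [hηx]; field_simp; ring
          _ ≤ _ := mul_le_mul_of_nonneg_left hx2 (by positivity)
      have b5 : (10 * κ.dirErr ^ 2 * κ.estError / c ^ 2 + 8 * κ.dirBound ^ 2 / c ^ 2)
            * (1 / (t : ℝ) ^ 2)
          ≤ (10 * κ.dirErr ^ 2 * κ.estError / c ^ 2 + 8 * κ.dirBound ^ 2 / c ^ 2)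
            * (1 / (t : ℝ) ^ 2) * κ.lag T :=
        le_mul_of_one_le_right (by positivity) hlag'
      -- The perturbations of one step are `O(1 / t ^ 2)`, and the next unit `(c * η (t + 1) / 2) ^
      -- 2` is at least `1 / (16 * t ^ 2)`; this is the other reason for the factor `16`.
      have b6 : Z * κ.lag T * (1 / (t : ℝ) ^ 2)
          ≤ Real.exp (-2 * x) * x ^ 2 * (16 * (κ.radius ^ 2 + Z) * κ.lag T) := by
        have c1 : 1 / (16 * (t : ℝ) ^ 2) ≤ Real.exp (-2 * x) * x ^ 2 := by
          rw [← hrec]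
          have c2 : 1 / (4 * (t : ℝ)) ≤ c * η (t + 1) / 2 := by
            refine le_trans (one_div_le_one_div_of_le (by positivity) ?_) y1
            push_cast
            linarith
          have c3 := pow_le_pow_left₀ (by positivity) c2 2
          refine le_trans (le_of_eq ?_) c3
          rw [one_div_pow, mul_pow]; norm_num
        calc _ ≤ (κ.radius ^ 2 + Z) * κ.lag T * (1 / (t : ℝ) ^ 2) := by
              gcongr
              exact le_add_of_nonneg_left (sq_nonneg _)
          _ = 1 / (16 * (t : ℝ) ^ 2) * (16 * (κ.radius ^ 2 + Z) * κ.lag T) := by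
              field_simp
          _ ≤ _ := mul_le_mul_of_nonneg_right c1 (by positivity)
      have b7 : Z * κ.lag T * (1 / (t : ℝ) ^ 2)
          = 4 * κ.noiseConst (4 / c) / c * κ.lag T * (1 / (t : ℝ) ^ 2)
          + (10 * κ.dirErr ^ 2 * κ.estError / c ^ 2 + 8 * κ.dirBound ^ 2 / c ^ 2)
            * (1 / (t : ℝ) ^ 2) * κ.lag T := by
        rw [hZ]; ring
      push_cast
      linarith

/-- Accuracy of the evaluation under a contraction. -/
lemma integral_loss_le_contraction {c : ℝ} (hc : 0 < c)
    (h : IsEvaluation κ M γ b μb Adm φ C η θ₀ T ρ ℱ z π e) (hη : IsContractionStep c η)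
    (m : Method) (hs : ∀ σ ∈ Adm, ∃ θs ∈ C, M.SolvesBellman γ φ σ θs ∧
      ∀ θ, c * ‖θ - θs‖ ^ 2
        ≤ M.stateMean b μb (M.pairing m γ φ b μb σ (M.valueLimsup γ σ) θ)) (hT : 1 ≤ T) :
    ∫ ω, M.loss γ φ μb (π ω) (evalOutput m γ φ b (π ω) C η θ₀ (fun l => z l ω) T) ∂ρ
      ≤ 4 * κ.featureBound ^ 2 * κ.contractionRate c * κ.lag T * (1 + Real.log T) / T := by
  classical
  have hst := h.standing
  have hF := κ.featureBound_pos
  have hN : 0 ≤ κ.noiseConst (4 / c) := h.noiseConst_nonneg (by positivity)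
  have hB := κ.estError_pos
  have hW : 0 ≤ κ.contractionRate c := by rw [Constants.contractionRate]; positivity
  have hs' : ∃ θs : (S → A → ℝ) → EuclideanSpace ℝ (Fin d), ∀ σ ∈ Adm, θs σ ∈ C ∧
      M.SolvesBellman γ φ σ (θs σ) ∧ ∀ θ, c * ‖θ - θs σ‖ ^ 2
        ≤ M.stateMean b μb (M.pairing m γ φ b μb σ (M.valueLimsup γ σ) θ) :=
    ⟨fun σ => if hσ : σ ∈ Adm then (hs σ hσ).choose else 0, fun σ hσ => by
      simp only [dif_pos hσ]; exact (hs σ hσ).choose_spec⟩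
  obtain ⟨θs, hθs⟩ := hs'
  have key : ∀ t ∈ Finset.Icc 1 T, ∫ ω, M.loss γ φ μb (π ω)
      (evalIterate m γ φ b (π ω) C η θ₀ (fun l => z l ω) t) ∂ρ
        ≤ 2 * κ.featureBound ^ 2 * (κ.contractionRate c * κ.lag T) * (1 / (t : ℝ)) := by
    intro t ht
    obtain ⟨h1, h2⟩ := Finset.mem_Icc.1 ht
    obtain ⟨U, hU, hD, hle⟩ := h.exists_dist_sq_le hc hη m hθs h1 h2
    have ht0 : (0 : ℝ) < t := by exact_mod_cast h1
    calc _ ≤ ∫ ω, 2 * κ.featureBound ^ 2 * U ω ∂ρ := by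
          refine integral_mono_ae (h.integrable_loss_iterate m h2) (hU.const_mul _) ?_
          filter_upwards [hD, h.policy_mem] with ω a1 a2
          exact (hst.loss_le_dist_sq h.discount_nonneg h.discount_lt.le a2 (hθs _ a2).2.1 _).trans
            (mul_le_mul_of_nonneg_left a1 (by positivity))
      _ ≤ 2 * κ.featureBound ^ 2 * ((1 / t) ^ 2 * (κ.contractionRate c * κ.lag T * t)) := by
          rw [integral_const_mul]
          refine mul_le_mul_of_nonneg_left (hle.trans ?_) (by positivity)
          obtain ⟨x1, x2⟩ := contractionStep_bounds hc hη h1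
          exact mul_le_mul_of_nonneg_right
            (pow_le_pow_left₀ (le_trans (by positivity) x1) x2 2) (by positivity)
      _ = _ := by field_simp
  have hsum := Finset.sum_le_sum key
  rw [← Finset.mul_sum] at hsum
  refine (h.integral_loss_output_le m hT (hsum.trans (mul_le_mul_of_nonneg_left (sum_inv_le T)
    (by positivity)))).trans (le_of_eq ?_)
  ring

end IsEvaluation

end ContractionAccuracy

/-! ### Policy iteration -/

section PolicyIteration

variable {S A : Type*} [Fintype S] [DecidableEq S] [Fintype A] [DecidableEq A] {R : Finset ℝ}
  {d : ℕ} {Ω : Type*} {mΩ : MeasurableSpace Ω}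
  {κ : Constants} {M : MDP S A R} {γ : ℝ} {b : S → A → ℝ} {μb : S → ℝ}
  {Adm : Set (S → A → ℝ)} {φ : S → EuclideanSpace ℝ (Fin d)}
  {C : Set (EuclideanSpace ℝ (Fin d))} {η : ℕ → ℝ} {θ₀ : ℕ → EuclideanSpace ℝ (Fin d)} {T K : ℕ}
  {ρ : Measure Ω} [IsProbabilityMeasure ρ] {ℱ : Filtration ℕ mΩ} {z : ℕ → Ω → Sample S A R}
  {π : ℕ → Ω → S → A → ℝ} {m : Method}

lemma Standing.value_eq_bellman (h : Standing κ M γ b μb Adm φ C) (h0 : 0 ≤ γ) (h1 : γ < 1)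
    {σ : S → A → ℝ} (hσ : σ ∈ Adm) (s : S) :
    M.value γ σ s = M.bellman γ σ (M.value γ σ) s := by
  obtain ⟨θ, -, hB⟩ := h.realizable σ hσ
  have e : linValue φ θ = M.value γ σ :=
    funext (hB.linValue_eq h0 h1 (h.admissible σ hσ))
  rw [← e]
  exact hB s

lemma Standing.value_eq_limsup (h : Standing κ M γ b μb Adm φ C) (h0 : 0 ≤ γ) (h1 : γ < 1)
    {σ : S → A → ℝ} (hσ : σ ∈ Adm) (s : S) : M.value γ σ s = M.valueLimsup γ σ s := by
  obtain ⟨θ, -, hB⟩ := h.realizable σ hσ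
  rw [← hB.linValue_eq h0 h1 (h.admissible σ hσ), hB.linValue_eq_limsup h0 h1 (h.admissible σ hσ)]

/-- Realizability in a bounded set of parameters gives a bound uniform in `γ`, instead of one
growing like `1 / (1 - γ)`. -/
lemma Standing.abs_value_le (h : Standing κ M γ b μb Adm φ C) (h0 : 0 ≤ γ) (h1 : γ < 1)
    {σ : S → A → ℝ} (hσ : σ ∈ Adm) (s : S) :
    |M.value γ σ s| ≤ κ.featureBound * κ.radius := by
  obtain ⟨θ, hθ, hB⟩ := h.realizable σ hσ
  rw [← hB.linValue_eq h0 h1 (h.admissible σ hσ)]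
  exact abs_inner_le_mul (h.feature_bound s) (h.bounded θ hθ)

lemma Standing.abs_gap_le (h : Standing κ M γ b μb Adm φ C) (h0 : 0 ≤ γ) (h1 : γ < 1)
    {πs σ : S → A → ℝ} (hs : πs ∈ Adm) (hσ : σ ∈ Adm) {μs : S → ℝ}
    (hμ : IsStationary (M.trans πs) μs) :
    |∑ s, μs s * (M.value γ πs s - M.value γ σ s)| ≤ 2 * κ.featureBound * κ.radius :=
  calc _ ≤ ∑ s, |μs s * (M.value γ πs s - M.value γ σ s)| := Finset.abs_sum_le_sum_abs _ _
    _ ≤ ∑ s, μs s * (2 * κ.featureBound * κ.radius) := Finset.sum_le_sum fun s _ => by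
        rw [abs_mul, abs_of_nonneg (hμ.nonneg s)]
        refine mul_le_mul_of_nonneg_left ?_ (hμ.nonneg s)
        linarith [abs_sub (M.value γ πs s) (M.value γ σ s), h.abs_value_le h0 h1 hs s,
          h.abs_value_le h0 h1 hσ s]
    _ = _ := by rw [← Finset.sum_mul, hμ.sum_one, one_mul]

lemma IsPolicyIteration.ae_mem (h : IsPolicyIteration M γ b Adm φ C m η θ₀ T K ρ ℱ z π) {k : ℕ}
    (hk : k ≤ K) : ∀ᵐ ω ∂ρ, π k ω ∈ Adm := by
  cases k with
  | zero => exact h.initial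
  | succ k => exact (h.improve k (by omega)).mono fun ω hω => hω.1

/-- Almost surely the policy is admissible, and there the value coincides with its measurable upper
limit. -/
lemma IsPolicyIteration.integrable_gap (h : IsPolicyIteration M γ b Adm φ C m η θ₀ T K ρ ℱ z π)
    (hst : Standing κ M γ b μb Adm φ C) (h0 : 0 ≤ γ) (h1 : γ < 1) {πs : S → A → ℝ}
    (hs : πs ∈ Adm) {μs : S → ℝ} (hμ : IsStationary (M.trans πs) μs) {k : ℕ} (hk : k ≤ K) :
    Integrable (fun ω => ∑ s, μs s * (M.value γ πs s - M.value γ (π k ω) s)) ρ := by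
  have hmeas : Measurable fun ω => ∑ s, μs s * (M.value γ πs s - M.valueLimsup γ (π k ω) s) :=
    Finset.measurable_sum _ fun s _ => ((M.measurable_valueLimsup γ
      (fun s a => (h.adapted k hk s a).mono (ℱ.le _) le_rfl) s).const_sub _).const_mul _
  refine Integrable.of_bound (hmeas.aestronglyMeasurable.congr ?_)
    (2 * κ.featureBound * κ.radius) ?_
  · filter_upwards [h.ae_mem hk] with ω hω
    exact Finset.sum_congr rfl fun s _ => by rw [hst.value_eq_limsup h0 h1 hω]
  · filter_upwards [h.ae_mem hk] with ω hω
    exact hst.abs_gap_le h0 h1 hs hω hμ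

lemma IsPolicyIteration.exists_isEvaluation
    (h : IsPolicyIteration M γ b Adm φ C m η θ₀ T K ρ ℱ z π)
    (hst : Standing κ M γ b μb Adm φ C) (h0 : 0 ≤ γ) (h1 : γ < 1)
    (hdata : IsOfflineData M b T K ρ ℱ z) (hest : AccurateEstimates M μb T K ρ z π κ.estError)
    (hη : ∀ t, 1 ≤ t → 0 ≤ η t) {k : ℕ} (hk : k < K) :
    ∃ e : ℕ → Ω → ℝ, IsEvaluation κ M γ b μb Adm φ C η (θ₀ k) T ρ
      (shiftFiltration ℱ (k * (T + 1))) (fun t ω => batch z T k ω t) (π k) e := by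
  classical
  have hest' := hest k hk
  -- The error variables are chosen time by time; the value `0` outside `1 ≤ t ≤ T` is never
  -- consulted.
  refine ⟨fun t => if ht : 1 ≤ t ∧ t ≤ T then (hest' t ht.1 ht.2).choose else 0, ?_⟩
  have he : ∀ t (a1 : 1 ≤ t) (a2 : t ≤ T),
      (if ht : 1 ≤ t ∧ t ≤ T then (hest' t ht.1 ht.2).choose else 0)
        = (hest' t a1 a2).choose := fun t a1 a2 => dif_pos ⟨a1, a2⟩
  refine ⟨hst, h0, h1, hdata.batch hk, h.initial_param k, h.adapted k hk.le, h.ae_mem hk.le, hη,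
    fun t a1 a2 => ?_, fun t a1 a2 => ?_, fun t a1 a2 => ?_⟩
  · rw [he t a1 a2]; exact (hest' t a1 a2).choose_spec.1
  · rw [he t a1 a2]; exact (hest' t a1 a2).choose_spec.2.1
  · rw [he t a1 a2]; exact (hest' t a1 a2).choose_spec.2.2

/-- Policy iteration is accurate if the losses of all the evaluations are small. -/
lemma IsPolicyIteration.isAccurate [Nonempty S]
    (h : IsPolicyIteration M γ b Adm φ C m η θ₀ T K ρ ℱ z π)
    (hst : Standing κ M γ b μb Adm φ C) (h0 : 0 ≤ γ) (h1 : γ < 1) {πs : S → A → ℝ}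
    (hs : πs ∈ Adm) {μs : S → ℝ} (hμ : IsStationary (M.trans πs) μs) {q ε : ℝ} (hq : 0 < q)
    (hintegrable : ∀ k < K, Integrable (fun ω => M.loss γ φ μb (π k ω)
      (evalOutput m γ φ b (π k ω) C η (θ₀ k) (batch z T k ω) T)) ρ)
    (hloss : ∀ k < K, 2 * κ.shift * ∫ ω, M.loss γ φ μb (π k ω)
      (evalOutput m γ φ b (π k ω) C η (θ₀ k) (batch z T k ω) T) ∂ρ ≤ q ^ 2)
    (hε : γ ^ K * (2 * κ.featureBound * κ.radius) + 2 * q / (1 - γ) ^ 2 ≤ ε) :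
    M.IsAccurate γ πs μs ρ (π K) ε := by
  have hγ : 0 < 1 - γ := by linarith
  have main : ∀ k ≤ K, ∫ ω, ∑ s, μs s * (M.value γ πs s - M.value γ (π k ω) s) ∂ρ
      ≤ γ ^ k * (2 * κ.featureBound * κ.radius) + 2 * q / (1 - γ) ^ 2 := by
    intro k hk
    induction k with
    | zero =>
      have hb : ∫ ω, ∑ s, μs s * (M.value γ πs s - M.value γ (π 0 ω) s) ∂ρ
          ≤ ∫ _, 2 * κ.featureBound * κ.radius ∂ρ := by
        refine integral_mono_ae (h.integrable_gap hst h0 h1 hs hμ hk) (integrable_const _) ?_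
        filter_upwards [h.ae_mem hk] with ω hω
        exact (abs_le.1 (hst.abs_gap_le h0 h1 hs hω hμ)).2
      have : 0 ≤ 2 * q / (1 - γ) ^ 2 := by positivity
      simp only [integral_const, probReal_univ, one_smul] at hb
      rw [pow_zero, one_mul]
      linarith
    | succ k ih =>
      have hk' : k < K := by omega
      have ih' := ih hk'.le
      set L : Ω → ℝ := fun ω => M.loss γ φ μb (π k ω)
        (evalOutput m γ φ b (π k ω) C η (θ₀ k) (batch z T k ω) T) with hL
      have hLint : Integrable L ρ := hintegrable k hk'
      have hLle := hloss k hk'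
      set G : ℕ → Ω → ℝ := fun k ω => ∑ s, μs s * (M.value γ πs s - M.value γ (π k ω) s) with hG
      have hGint : ∀ k ≤ K, Integrable (G k) ρ := fun k hk => h.integrable_gap hst h0 h1 hs hμ hk
      have step : ∀ᵐ ω ∂ρ, G (k + 1) ω
          ≤ γ * G k ω + 2 * κ.shift / (q * (1 - γ)) * L ω + q / (1 - γ) := by
        filter_upwards [h.ae_mem hk'.le, h.ae_mem hk, h.improve k hk'] with ω a1 a2 a3
        -- The residual is at most the square root of `2 * κ.shift * L`. The inequality `√y ≤ (y / q
        -- + q) / 2` makes the bound linear in the loss, so only the mean loss is needed.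
        set ε' := (2 * κ.shift * L ω / q + q) / 2 with hε'
        have hres : ∀ s, |M.bellman γ (π k ω) (linValue φ (evalOutput m γ φ b (π k ω) C η (θ₀ k)
            (batch z T k ω) T)) s - linValue φ (evalOutput m γ φ b (π k ω) C η (θ₀ k)
            (batch z T k ω) T) s| ≤ ε' := fun s => by
          rw [← residual_eq_bellman_sub]
          have c1 := hst.sq_residual_le a1 (evalOutput m γ φ b (π k ω) C η (θ₀ k)
            (batch z T k ω) T) s
          set y := residual γ φ (M.meanReward (π k ω)) (M.nextFeature φ (π k ω))
            (evalOutput m γ φ b (π k ω) C η (θ₀ k) (batch z T k ω) T) s with hy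
          have c2 : |y| * (2 * q) ≤ 2 * κ.shift * L ω + q * q := by
            have : |y| ^ 2 = y ^ 2 := sq_abs y
            nlinarith [sq_nonneg (|y| - q)]
          have c3 : ε' = (2 * κ.shift * L ω + q * q) / (2 * q) := by
            rw [hε']; field_simp
          rw [c3, le_div_iff₀ (by positivity)]
          exact c2
        have c4 := M.policy_improvement h0 h1 a1 hs (hst.admissible _ a1) (hst.admissible _ hs)
          (hst.admissible _ a2) (hst.value_eq_bellman h0 h1 a1) (hst.value_eq_bellman h0 h1 hs)
          (hst.value_eq_bellman h0 h1 a2) hres a3 hμ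
        refine c4.trans (le_of_eq ?_)
        rw [hε', add_assoc]
        congr 1
        field_simp
      have i1 := integral_mono_ae (hGint (k + 1) hk) (((((hGint k hk'.le).const_mul γ).add
        (hLint.const_mul (2 * κ.shift / (q * (1 - γ))))).add (integrable_const (q / (1 - γ)))))
        step
      have i2 : ∫ ω, (γ * G k ω + 2 * κ.shift / (q * (1 - γ)) * L ω + q / (1 - γ)) ∂ρ
          = γ * ∫ ω, G k ω ∂ρ + 2 * κ.shift / (q * (1 - γ)) * ∫ ω, L ω ∂ρ + q / (1 - γ) := by
        have := integral_linear_combination (hGint k hk'.le) hLint hLint γ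
          (2 * κ.shift / (q * (1 - γ))) 0 (q / (1 - γ))
        simpa using this
      have i3 : 2 * κ.shift / (q * (1 - γ)) * ∫ ω, L ω ∂ρ ≤ q / (1 - γ) := by
        rw [div_mul_eq_mul_div, div_le_div_iff₀ (by positivity) hγ]
        nlinarith [mul_le_mul_of_nonneg_right hLle hγ.le]
      have i4 := mul_le_mul_of_nonneg_left ih' h0
      -- The accumulated error is the fixed point of `x ↦ γ * x + 2 * q / (1 - γ)`.
      have i5 : γ * (2 * q / (1 - γ) ^ 2) + q / (1 - γ) + q / (1 - γ) = 2 * q / (1 - γ) ^ 2 := by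
        field_simp; ring
      have i6 : ∫ ω, G (k + 1) ω ∂ρ
          ≤ γ * ∫ ω, G k ω ∂ρ + 2 * κ.shift / (q * (1 - γ)) * ∫ ω, L ω ∂ρ + q / (1 - γ) := by
        rw [← i2]; exact i1
      rw [pow_succ]
      linarith
  exact ⟨h.integrable_gap hst h0 h1 hs hμ le_rfl, (main K le_rfl).trans hε⟩

lemma IsPolicyIteration.isAccurate_zero
    (h : IsPolicyIteration M γ b Adm φ C m η θ₀ T 0 ρ ℱ z π)
    (hst : Standing κ M γ b μb Adm φ C) (h0 : 0 ≤ γ) (h1 : γ < 1) {πs : S → A → ℝ}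
    (hs : πs ∈ Adm) {μs : S → ℝ} (hμ : IsStationary (M.trans πs) μs) {ε : ℝ}
    (hε : 2 * κ.featureBound * κ.radius ≤ ε) : M.IsAccurate γ πs μs ρ (π 0) ε := by
  have hi := h.integrable_gap hst h0 h1 hs hμ le_rfl
  refine ⟨hi, ?_⟩
  have hb := integral_mono_ae hi (integrable_const (2 * κ.featureBound * κ.radius)) (by
    filter_upwards [h.ae_mem le_rfl] with ω hω
    exact (abs_le.1 (hst.abs_gap_le h0 h1 hs hω hμ)).2)
  simp only [integral_const, probReal_univ, one_smul] at hb
  linarith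

end PolicyIteration

/-! ### Choice of the batch size and of the number of batches -/

section Sizes

lemma Constants.lag_le (κ : Constants) {T : ℕ} (hT : 1 ≤ T) :
    (κ.lag T : ℝ) ≤ 2 * (κ.mixingTime + 1) * (1 + Real.log T) := by
  have h1 : ((2 : ℝ) ^ Nat.log 2 T) ≤ T := by
    exact_mod_cast Nat.pow_log_le_self 2 (by omega)
  have h2 := Real.log_le_log (by positivity) h1
  rw [Real.log_pow] at h2
  have h3 := Real.log_two_gt_d9
  have h4 : (0 : ℝ) ≤ Nat.log 2 T := by positivity
  rw [Constants.lag]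
  push_cast
  have h5 : (Nat.log 2 T : ℝ) + 1 ≤ 2 * (1 + Real.log T) := by nlinarith
  have h6 : (0 : ℝ) ≤ κ.mixingTime + 1 := by positivity
  nlinarith [mul_le_mul_of_nonneg_left h5 h6]

lemma one_le_logFactor {γ ε : ℝ} (h0 : 0 < γ) (h1 : γ < 1) (hε : 0 < ε) :
    1 ≤ logFactor γ ε ∧ Real.log (1 / (1 - γ)) ≤ logFactor γ ε ∧
      Real.log (1 / ε) ≤ logFactor γ ε := by
  have a1 : 0 ≤ Real.log (1 + 1 / ε) := Real.log_nonneg (by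
    have : 0 < 1 / ε := by positivity
    linarith)
  have a2 : 0 ≤ Real.log (1 / (1 - γ)) := Real.log_nonneg (by
    rw [le_div_iff₀ (by linarith)]; linarith)
  have a3 : Real.log (1 / ε) ≤ Real.log (1 + 1 / ε) :=
    Real.log_le_log (by positivity) (by linarith)
  rw [logFactor]
  refine ⟨?_, ?_, ?_⟩ <;> nlinarith [mul_nonneg a1 a2]

/-- A square of a logarithm grows slower than `x`. The constant `18` is the one produced by the
logarithm of the batch size in `exists_sizes`. -/
lemma exists_log_sq_le (q a : ℝ) : ∃ x : ℝ, 1 ≤ x ∧ a ≤ x ∧ q * (18 + 2 * Real.log x) ^ 2 ≤ x := by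
  -- With `x = u ^ 4` and `log u ≤ u`, the squared bracket is at most `(26 * u) ^ 2`, and `26 ^ 2 =
  -- 676`.
  set u := max 1 (max a (676 * |q|)) with hu
  have h1 : 1 ≤ u := le_max_left _ _
  have h2 : a ≤ u := (le_max_left _ _).trans (le_max_right _ _)
  have h3 : 676 * |q| ≤ u := (le_max_right _ _).trans (le_max_right _ _)
  have h4 : u ≤ u ^ 4 := le_self_pow₀ h1 (by norm_num)
  refine ⟨u ^ 4, h1.trans h4, h2.trans h4, ?_⟩
  have h5 : Real.log u ≤ u := (Real.log_le_sub_one_of_pos (by linarith)).trans (by linarith)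
  have h6 : 0 ≤ Real.log u := Real.log_nonneg h1
  rw [Real.log_pow]
  push_cast
  calc q * (18 + 2 * (4 * Real.log u)) ^ 2 ≤ |q| * (18 + 2 * (4 * Real.log u)) ^ 2 :=
        mul_le_mul_of_nonneg_right (le_abs_self q) (sq_nonneg _)
    _ ≤ |q| * (26 * u) ^ 2 := by gcongr; linarith
    _ = 676 * |q| * u ^ 2 := by ring
    _ ≤ u * u ^ 2 := by gcongr
    _ = u ^ 3 := by ring
    _ ≤ u ^ 4 := pow_le_pow_right₀ h1 (by norm_num)

/-- The sizes of the batches (`i = 2` in general, `i = 1` under a contraction). -/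
lemma exists_sizes (Q : ℝ) {V : ℝ} (hV : 0 < V) : ∃ K₀ : ℝ, 0 ≤ K₀ ∧ ∀ γ ε : ℝ, 0 < γ → γ < 1 →
    0 < ε → ε < V → ∀ i : ℕ, 1 ≤ i → i ≤ 2 → ∃ T K : ℕ, 1 ≤ T ∧
      ((K * (T + 1) : ℕ) : ℝ) ≤ K₀ * logFactor γ ε ^ 5 / ((1 - γ) ^ (4 * i + 1) * ε ^ (2 * i)) ∧
      γ ^ K * V ≤ ε / 2 ∧
      ∃ r : ℝ, 0 < r ∧ r ^ i ≤ T ∧ Q * (1 + Real.log T) ^ 2 / r ≤ ((1 - γ) ^ 2 * ε / 4) ^ 2 := by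
  obtain ⟨a, ha1, haV, haQ⟩ := exists_log_sq_le (16 * |Q|) (V ^ 2)
  set B := |Real.log (2 * V)| + 2 with hB
  have hB0 : 0 ≤ B := by positivity
  refine ⟨3 * B * a ^ 2, by positivity, fun γ ε h0 h1 hε hεV i hi1 hi2 => ?_⟩
  obtain ⟨l1, l2, l3⟩ := one_le_logFactor h0 h1 hε
  set Λ := logFactor γ ε with hΛ
  have hγ : 0 < 1 - γ := by linarith
  have hγ1 : 1 - γ ≤ 1 := by linarith
  set Y := 1 / ((1 - γ) ^ 4 * ε ^ 2) with hY
  have hY0 : 0 < Y := by positivity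
  have haY : 1 ≤ a * Y := by
    rw [hY, mul_one_div, le_div_iff₀ (by positivity), one_mul]
    calc (1 - γ) ^ 4 * ε ^ 2 ≤ 1 * V ^ 2 := by
          gcongr
          exact pow_le_one₀ hγ.le hγ1
      _ ≤ a := by rw [one_mul]; exact haV
  -- `16 * Y` is the reciprocal of the required accuracy. The factor `Λ ^ 2` pays for the squared
  -- logarithm of `T`, and `a` for the constants; `a ≥ V ^ 2` also ensures `X ≥ 1`.
  set X := a * Λ ^ 2 * Y with hX
  have hX1 : 1 ≤ X := by
    have : X = a * Y * Λ ^ 2 := by rw [hX]; ring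
    rw [this]
    exact one_le_mul_of_one_le_of_one_le haY (one_le_pow₀ l1)
  have hX0 : 0 < X := by linarith
  have hXi1 : 1 ≤ X ^ i := one_le_pow₀ hX1
  have hXi2 : X ^ i ≤ X ^ 2 := pow_le_pow_right₀ hX1 hi2
  set T := ⌈X ^ i⌉₊ with hTdef
  have hT1 : X ^ i ≤ T := Nat.le_ceil _
  have hT2 : (T : ℝ) ≤ X ^ i + 1 := (Nat.ceil_lt_add_one (by positivity)).le
  have hT0 : 1 ≤ T := by
    have : (1 : ℝ) ≤ T := hXi1.trans hT1
    exact_mod_cast this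
  have hTpos : (0 : ℝ) < T := by exact_mod_cast hT0
  set E := Real.log (2 * V / ε) with hE
  have hE0 : 0 ≤ E := Real.log_nonneg (by rw [le_div_iff₀ hε]; linarith)
  -- From `γ ^ K ≤ exp (-(1 - γ) * K)`, this many steps reduce the initial gap `V` to `ε / 2`.
  set K := ⌈E / (1 - γ)⌉₊ with hKdef
  have hK1 : E / (1 - γ) ≤ K := Nat.le_ceil _
  have hK2 : (K : ℝ) ≤ E / (1 - γ) + 1 := (Nat.ceil_lt_add_one (by positivity)).le
  have hK3 : (K : ℝ) ≤ B * Λ / (1 - γ) := by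
    refine hK2.trans ?_
    have e1 : E ≤ |Real.log (2 * V)| + Λ := by
      have : E = Real.log (2 * V) + Real.log (1 / ε) := by
        rw [hE, ← Real.log_mul (by positivity) (by positivity), mul_one_div]
      rw [this]
      exact add_le_add (le_abs_self _) l3
    have e2 : |Real.log (2 * V)| ≤ |Real.log (2 * V)| * Λ :=
      le_mul_of_one_le_right (abs_nonneg _) l1
    rw [div_add_one hγ.ne', hB]
    refine div_le_div_of_nonneg_right ?_ hγ.le
    linarith
  -- In the bound on the number of samples, `K` contributes one power of `Λ` and `X ^ i` contributes
  -- `2 * i ≤ 4`; together at most five.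
  refine ⟨T, K, hT0, ?_, ?_, X, hX0, hT1, ?_⟩
  · push_cast
    have e1 : (T : ℝ) + 1 ≤ 3 * X ^ i := by linarith
    have e2 : X ^ i = a ^ i * Λ ^ (2 * i) * Y ^ i := by rw [hX]; ring
    have e3 : Y ^ i = 1 / ((1 - γ) ^ (4 * i) * ε ^ (2 * i)) := by
      rw [hY, one_div_pow, mul_pow, ← pow_mul, ← pow_mul]
    calc (K : ℝ) * (T + 1) ≤ B * Λ / (1 - γ) * (3 * X ^ i) := by gcongr
      _ = 3 * B * a ^ i * Λ ^ (2 * i + 1) / ((1 - γ) ^ (4 * i + 1) * ε ^ (2 * i)) := by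
          rw [e2, e3]; field_simp; ring
      _ ≤ _ := by
          gcongr
          omega
  · have e1 : γ ^ K ≤ Real.exp (-E) := by
      calc γ ^ K ≤ Real.exp (-(1 - γ)) ^ K :=
            pow_le_pow_left₀ h0.le (by linarith [Real.add_one_le_exp (-(1 - γ))]) K
        _ = Real.exp (K * -(1 - γ)) := (Real.exp_nat_mul _ _).symm
        _ ≤ Real.exp (-E) := by
            rw [Real.exp_le_exp]
            rw [div_le_iff₀ hγ] at hK1
            linarith
    have e2 : Real.exp (-E) = ε / (2 * V) := by
      rw [Real.exp_neg, hE, Real.exp_log (by positivity), inv_div]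
    rw [e2] at e1
    calc γ ^ K * V ≤ ε / (2 * V) * V := by gcongr
      _ = ε / 2 := by field_simp
  · have e1 : Real.log T ≤ 1 + 2 * Real.log X := by
      have b1 : (T : ℝ) ≤ 2 * X ^ 2 := by linarith
      have b2 := Real.log_le_log hTpos b1
      rw [Real.log_mul (by norm_num) (by positivity), Real.log_pow] at b2
      have := Real.log_two_lt_d9
      push_cast at b2
      linarith
    have e2 : Real.log X ≤ Real.log a + 8 * Λ := by
      have b1 : Real.log X = Real.log a + 2 * Real.log Λ
          + (4 * Real.log (1 / (1 - γ)) + 2 * Real.log (1 / ε)) := by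
        have c1 : Y = (1 / (1 - γ)) ^ 4 * (1 / ε) ^ 2 := by rw [hY]; field_simp
        rw [hX, c1, Real.log_mul (by positivity) (by positivity),
          Real.log_mul (by positivity) (by positivity),
          Real.log_mul (by positivity) (by positivity), Real.log_pow, Real.log_pow, Real.log_pow]
        push_cast
        ring
      have b2 : Real.log Λ ≤ Λ := (Real.log_le_sub_one_of_pos (by linarith)).trans (by linarith)
      rw [b1]
      linarith
    have ha0 : 0 ≤ Real.log a := Real.log_nonneg ha1
    have hlT : 0 ≤ Real.log T := Real.log_nonneg (by exact_mod_cast hT0)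
    -- The four logarithmic terms of `log X` give at most `log a + 8 * Λ`; doubling and adding `2`
    -- produces `18`, and `a` was chosen to beat the square of this factor.
    have e3 : 1 + Real.log T ≤ (18 + 2 * Real.log a) * Λ := by
      have := mul_le_mul_of_nonneg_left l1 ha0
      nlinarith
    have e4 : |Q| * (1 + Real.log T) ^ 2 ≤ a / 16 * Λ ^ 2 := by
      calc |Q| * (1 + Real.log T) ^ 2 ≤ |Q| * ((18 + 2 * Real.log a) * Λ) ^ 2 := by gcongr
        _ = (16 * |Q| * (18 + 2 * Real.log a) ^ 2) / 16 * Λ ^ 2 := by ring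
        _ ≤ _ := by gcongr
    have e5 : ((1 - γ) ^ 2 * ε / 4) ^ 2 = 1 / (16 * Y) := by
      rw [hY]; field_simp; norm_num
    rw [e5, div_le_div_iff₀ hX0 (by positivity), hX]
    have e6 : Q * (1 + Real.log T) ^ 2 ≤ |Q| * (1 + Real.log T) ^ 2 :=
      mul_le_mul_of_nonneg_right (le_abs_self Q) (sq_nonneg _)
    have e7 := mul_le_mul_of_nonneg_right (e6.trans e4) (by positivity : 0 ≤ 16 * Y)
    linarith

end Sizes

/-! ### Sample complexity -/

/-- Constant in the mean loss of one evaluation, up to logarithms. -/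
def Constants.lossRate (κ : Constants) (η₀ c : ℝ) : ℝ :=
  8 * κ.shift * (κ.mixingTime + 1) * |κ.sqrtRate η₀|
    + 16 * κ.shift * (κ.mixingTime + 1) * κ.featureBound ^ 2 * |κ.contractionRate c|

section Complexity

variable {S A : Type*} [Fintype S] [DecidableEq S] [Fintype A] [DecidableEq A] {R : Finset ℝ}
  {d : ℕ} {Ω : Type*} {mΩ : MeasurableSpace Ω}
  {κ : Constants} {M : MDP S A R} {γ : ℝ} {b : S → A → ℝ} {μb : S → ℝ}
  {Adm : Set (S → A → ℝ)} {φ : S → EuclideanSpace ℝ (Fin d)}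
  {C : Set (EuclideanSpace ℝ (Fin d))} {T K : ℕ}

lemma IsStationary.nonempty {Q : Matrix S S ℝ} {μ : S → ℝ} (h : IsStationary Q μ) : Nonempty S := by
  by_contra hne
  rw [not_nonempty_iff] at hne
  simpa using h.sum_one

/-- Both sets of assumptions reduce to one coercivity bound: for the SGD-based updates the drift is
twice a loss of quadratic growth, and for TD(0) the drift is the inner product in the contraction
hypothesis. -/
lemma Standing.exists_drift (h : Standing κ M γ b μb Adm φ C) (h0 : 0 ≤ γ) (h1 : γ < 1) {c : ℝ}
    {m : Method}
    (hm : (m.IsSGD ∧ ∀ σ ∈ Adm, StrongConvexOn Set.univ c (M.loss γ φ μb σ)) ∨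
      (m = Method.td0 ∧ ∀ σ ∈ Adm, ∃ θs ∈ C, M.SolvesBellman γ φ σ θs ∧
        IsContraction c (M.meanDirection m γ φ b μb σ) θs)) :
    ∀ σ ∈ Adm, ∃ θs ∈ C, M.SolvesBellman γ φ σ θs ∧ ∀ θ, c * ‖θ - θs‖ ^ 2
      ≤ M.stateMean b μb (M.pairing m γ φ b μb σ (M.valueLimsup γ σ) θ) := by
  intro σ hσ
  have hp := h.admissible σ hσ
  rcases hm with ⟨hm, hc⟩ | ⟨-, hc⟩
  · obtain ⟨θs, hs, hB⟩ := h.realizable σ hσ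
    refine ⟨θs, hs, hB, fun θ => ?_⟩
    rw [h.stateMean_pairing_eq hσ hm hB (hB.linValue_eq_limsup h0 h1 hp)]
    exact M.dist_sq_le_loss (hc σ hσ) hB θ
  · obtain ⟨θs, hs, hB, hcon⟩ := hc σ hσ
    refine ⟨θs, hs, hB, fun θ => ?_⟩
    rw [← inner_meanDirection_eq_stateMean m (hB.linValue_eq_limsup h0 h1 hp)]
    exact hcon.1 θ

/-- Accuracy of policy iteration from bounds on the mean losses. -/
lemma IsPolicyIteration.isAccurate_of_rate [Nonempty S] {η : ℕ → ℝ}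
    {θ₀ : ℕ → EuclideanSpace ℝ (Fin d)} {ρ : Measure Ω} [IsProbabilityMeasure ρ]
    {ℱ : Filtration ℕ mΩ} {z : ℕ → Ω → Sample S A R} {π : ℕ → Ω → S → A → ℝ} {m : Method}
    (h : IsPolicyIteration M γ b Adm φ C m η θ₀ T K ρ ℱ z π)
    (hst : Standing κ M γ b μb Adm φ C) (h0 : 0 ≤ γ) (h1 : γ < 1)
    (hdata : IsOfflineData M b T K ρ ℱ z) (hest : AccurateEstimates M μb T K ρ z π κ.estError)
    (hη : ∀ t, 1 ≤ t → 0 ≤ η t) {πs : S → A → ℝ} (hs : πs ∈ Adm) {μs : S → ℝ}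
    (hμ : IsStationary (M.trans πs) μs) {ε L : ℝ} (hε : 0 < ε)
    (hrate : ∀ (k : ℕ) (e : ℕ → Ω → ℝ), IsEvaluation κ M γ b μb Adm φ C η (θ₀ k) T ρ
        (shiftFiltration ℱ (k * (T + 1))) (fun t ω => batch z T k ω t) (π k) e →
      ∫ ω, M.loss γ φ μb (π k ω)
        (evalOutput m γ φ b (π k ω) C η (θ₀ k) (batch z T k ω) T) ∂ρ ≤ L)
    (hL : 2 * κ.shift * L ≤ ((1 - γ) ^ 2 * ε / 4) ^ 2)
    (hK : γ ^ K * (2 * κ.featureBound * κ.radius) ≤ ε / 2) :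
    M.IsAccurate γ πs μs ρ (π K) ε := by
  have hγ : 0 < 1 - γ := by linarith
  have hC := κ.shift_pos
  -- With this `q` the accumulated evaluation error is exactly `ε / 2`, the other half being left
  -- for the initial gap.
  refine h.isAccurate hst h0 h1 hs hμ (q := (1 - γ) ^ 2 * ε / 4) (by positivity)
    (fun k hk => ?_) (fun k hk => ?_) ?_
  · obtain ⟨e, he⟩ := h.exists_isEvaluation hst h0 h1 hdata hest hη hk
    exact he.integrable_loss_output m
  · obtain ⟨e, he⟩ := h.exists_isEvaluation hst h0 h1 hdata hest hη hk
    exact (mul_le_mul_of_nonneg_left (hrate k e he) (by positivity)).trans hL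
  · have : 2 * ((1 - γ) ^ 2 * ε / 4) / (1 - γ) ^ 2 = ε / 2 := by field_simp; norm_num
    linarith

end Complexity

/-- The bounds on the mean losses are dominated by the common rate. -/
lemma Constants.sqrt_loss_le (κ : Constants) (η₀ c : ℝ) {T : ℕ} (hT : 1 ≤ T) {r q : ℝ} (hr : 0 < r)
    (hrT : r ^ 2 ≤ T) (hq : κ.lossRate η₀ c * (1 + Real.log T) ^ 2 / r ≤ q) :
    2 * κ.shift * (2 * κ.sqrtRate η₀ * κ.lag T / Real.sqrt T) ≤ q := by
  have hC := κ.shift_pos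
  have hl : 0 ≤ Real.log T := Real.log_nonneg (by exact_mod_cast hT)
  have hrT' : r ≤ Real.sqrt T := Real.le_sqrt_of_sq_le hrT
  refine le_trans ?_ hq
  calc 2 * κ.shift * (2 * κ.sqrtRate η₀ * κ.lag T / Real.sqrt T)
      ≤ 2 * κ.shift * (2 * |κ.sqrtRate η₀| * κ.lag T / Real.sqrt T) := by
        gcongr; exact le_abs_self _
    _ ≤ 2 * κ.shift * (2 * |κ.sqrtRate η₀|
          * (2 * (κ.mixingTime + 1) * (1 + Real.log T)) / r) := by
        gcongr; exact κ.lag_le hT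
    _ = 8 * κ.shift * (κ.mixingTime + 1) * |κ.sqrtRate η₀| * (1 + Real.log T) ^ 1 / r := by ring
    _ ≤ κ.lossRate η₀ c * (1 + Real.log T) ^ 2 / r := by
        gcongr
        · rw [Constants.lossRate]; positivity
        · rw [Constants.lossRate]
          exact le_add_of_nonneg_right (by positivity)
        · linarith
        · norm_num

lemma Constants.contraction_loss_le (κ : Constants) (η₀ c : ℝ) {T : ℕ} (hT : 1 ≤ T) {r q : ℝ}
    (hr : 0 < r) (hrT : r ≤ T) (hq : κ.lossRate η₀ c * (1 + Real.log T) ^ 2 / r ≤ q) :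
    2 * κ.shift * (4 * κ.featureBound ^ 2 * κ.contractionRate c * κ.lag T
      * (1 + Real.log T) / T) ≤ q := by
  have hC := κ.shift_pos
  have hl : 0 ≤ Real.log T := Real.log_nonneg (by exact_mod_cast hT)
  refine le_trans ?_ hq
  calc 2 * κ.shift * (4 * κ.featureBound ^ 2 * κ.contractionRate c * κ.lag T
        * (1 + Real.log T) / T)
      ≤ 2 * κ.shift * (4 * κ.featureBound ^ 2 * |κ.contractionRate c| * κ.lag T
        * (1 + Real.log T) / T) := by
        gcongr; exact le_abs_self _
    _ ≤ 2 * κ.shift * (4 * κ.featureBound ^ 2 * |κ.contractionRate c|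
          * (2 * (κ.mixingTime + 1) * (1 + Real.log T)) * (1 + Real.log T) / r) := by
        gcongr; exact κ.lag_le hT
    _ = 16 * κ.shift * (κ.mixingTime + 1) * κ.featureBound ^ 2 * |κ.contractionRate c|
          * (1 + Real.log T) ^ 2 / r := by ring
    _ ≤ κ.lossRate η₀ c * (1 + Real.log T) ^ 2 / r := by
        gcongr
        rw [Constants.lossRate]
        exact le_add_of_nonneg_left (by positivity)

end OfflineRL

end

theorem mainTheorem5 :
    ∃ p : ℕ, ∀ (κ : OfflineRL.Constants) (η₀ c : ℝ), 0 < η₀ → 0 < c →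
    ∃ K₀ : ℝ, ∀ γ ε : ℝ, 0 < γ → γ < 1 → 0 < ε →
      -- SGD-based updates in general
      (∃ T K : ℕ,
        ((K * (T + 1) : ℕ) : ℝ) ≤ K₀ * OfflineRL.logFactor γ ε ^ p / ((1 - γ) ^ 9 * ε ^ 4) ∧
        ∀ (S : Type u) (A : Type v) [Fintype S] [DecidableEq S] [Fintype A] [DecidableEq A]
          (R : Finset ℝ) (d : ℕ) (M : OfflineRL.MDP S A R) (b : S → A → ℝ) (μb : S → ℝ)
          (Adm : Set (S → A → ℝ)) (φ : S → EuclideanSpace ℝ (Fin d))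
          (C : Set (EuclideanSpace ℝ (Fin d))) (πs : S → A → ℝ) (μs : S → ℝ)
          (m : OfflineRL.Method) (θ₀ : ℕ → EuclideanSpace ℝ (Fin d))
          (Ω : Type w) (mΩ : MeasurableSpace Ω) (ρ : MeasureTheory.Measure Ω)
          [MeasureTheory.IsProbabilityMeasure ρ] (ℱ : MeasureTheory.Filtration ℕ mΩ)
          (z : ℕ → Ω → OfflineRL.Sample S A R) (π : ℕ → Ω → S → A → ℝ),
          OfflineRL.Standing κ M γ b μb Adm φ C →
          πs ∈ Adm → M.IsOptimal γ πs → OfflineRL.IsStationary (M.trans πs) μs →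
          m.IsSGD →
          OfflineRL.IsOfflineData M b T K ρ ℱ z →
          OfflineRL.IsPolicyIteration M γ b Adm φ C m (fun t => η₀ / Real.sqrt t) θ₀ T K ρ ℱ z π →
          OfflineRL.AccurateEstimates M μb T K ρ z π κ.estError →
          M.IsAccurate γ πs μs ρ (π K) ε) ∧
      -- SGD-based updates with a strongly convex loss, or TD(0) with a contraction
      (∃ T K : ℕ,
        ((K * (T + 1) : ℕ) : ℝ) ≤ K₀ * OfflineRL.logFactor γ ε ^ p / ((1 - γ) ^ 5 * ε ^ 2) ∧
        ∀ (S : Type u) (A : Type v) [Fintype S] [DecidableEq S] [Fintype A] [DecidableEq A]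
          (R : Finset ℝ) (d : ℕ) (M : OfflineRL.MDP S A R) (b : S → A → ℝ) (μb : S → ℝ)
          (Adm : Set (S → A → ℝ)) (φ : S → EuclideanSpace ℝ (Fin d))
          (C : Set (EuclideanSpace ℝ (Fin d))) (πs : S → A → ℝ) (μs : S → ℝ)
          (m : OfflineRL.Method) (η : ℕ → ℝ) (θ₀ : ℕ → EuclideanSpace ℝ (Fin d))
          (Ω : Type w) (mΩ : MeasurableSpace Ω) (ρ : MeasureTheory.Measure Ω)
          [MeasureTheory.IsProbabilityMeasure ρ] (ℱ : MeasureTheory.Filtration ℕ mΩ)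
          (z : ℕ → Ω → OfflineRL.Sample S A R) (π : ℕ → Ω → S → A → ℝ),
          OfflineRL.Standing κ M γ b μb Adm φ C →
          πs ∈ Adm → M.IsOptimal γ πs → OfflineRL.IsStationary (M.trans πs) μs →
          ((m.IsSGD ∧ ∀ σ ∈ Adm, StrongConvexOn Set.univ c (M.loss γ φ μb σ)) ∨
            (m = OfflineRL.Method.td0 ∧ ∀ σ ∈ Adm, ∃ θs ∈ C, M.SolvesBellman γ φ σ θs ∧
              OfflineRL.IsContraction c (M.meanDirection m γ φ b μb σ) θs)) →
          OfflineRL.IsContractionStep c η →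
          OfflineRL.IsOfflineData M b T K ρ ℱ z →
          OfflineRL.IsPolicyIteration M γ b Adm φ C m η θ₀ T K ρ ℱ z π →
          OfflineRL.AccurateEstimates M μb T K ρ z π κ.estError →
          M.IsAccurate γ πs μs ρ (π K) ε) := by
  refine ⟨5, fun κ η₀ c hη₀ hc => ?_⟩
  have hV : 0 < 2 * κ.featureBound * κ.radius :=
    mul_pos (mul_pos two_pos κ.featureBound_pos) κ.radius_pos
  obtain ⟨K₀, hK₀, hsizes⟩ := OfflineRL.exists_sizes (κ.lossRate η₀ c) hV
  refine ⟨K₀, fun γ ε h0 h1 hε => ?_⟩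
  have hΛ := (OfflineRL.one_le_logFactor h0 h1 hε).1
  have hγ : 0 < 1 - γ := by linarith
  -- Above this threshold the initial policy is already accurate and no samples are needed. Below
  -- it, `ε` is bounded, which keeps the batch sizes at least of order one.
  rcases lt_or_ge ε (2 * κ.featureBound * κ.radius) with hsmall | hlarge
  · constructor
    · obtain ⟨T, K, hT, hN, hK, r, hr, hrT, hq⟩ := hsizes γ ε h0 h1 hε hsmall 2 (by norm_num) le_rfl
      refine ⟨T, K, by simpa using hN, ?_⟩
      intro S A _ _ _ _ R d M b μb Adm φ C πs μs m θ₀ Ω mΩ ρ _ ℱ z π hst hs _ hμ hm hdata hPI hest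
      have := hμ.nonempty
      refine hPI.isAccurate_of_rate hst h0.le h1 hdata hest (fun t _ => by positivity) hs hμ hε
        (fun k e he => he.integral_loss_le_sqrt hη₀ hm hT)
        (κ.sqrt_loss_le η₀ c hT hr hrT hq) hK
    · obtain ⟨T, K, hT, hN, hK, r, hr, hrT, hq⟩ := hsizes γ ε h0 h1 hε hsmall 1 le_rfl (by norm_num)
      refine ⟨T, K, by simpa using hN, ?_⟩
      intro S A _ _ _ _ R d M b μb Adm φ C πs μs m η θ₀ Ω mΩ ρ _ ℱ z π hst hs _ hμ hm hη hdata hPI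
        hest
      have := hμ.nonempty
      have hη0 : ∀ t, 1 ≤ t → 0 ≤ η t := fun t ht => by
        have h2 := (OfflineRL.contractionStep_bounds hc hη ht).1
        have h3 : 0 ≤ c * η t / 2 := le_trans (by positivity) h2
        by_contra hneg
        nlinarith
      refine hPI.isAccurate_of_rate hst h0.le h1 hdata hest hη0 hs hμ hε
        (fun k e he => he.integral_loss_le_contraction hc hη m
          (hst.exists_drift h0.le h1 hm) hT)
        (κ.contraction_loss_le η₀ c hT hr (by simpa using hrT) hq) hK
  · constructor
    · refine ⟨0, 0, by simpa using by positivity, ?_⟩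
      intro S A _ _ _ _ R d M b μb Adm φ C πs μs m θ₀ Ω mΩ ρ _ ℱ z π hst hs _ hμ _ _ hPI _
      exact hPI.isAccurate_zero hst h0.le h1 hs hμ hlarge
    · refine ⟨0, 0, by simpa using by positivity, ?_⟩
      intro S A _ _ _ _ R d M b μb Adm φ C πs μs m η θ₀ Ω mΩ ρ _ ℱ z π hst hs _ hμ _ _ _ hPI _
      exact hPI.isAccurate_zero hst h0.le h1 hs hμ hlarge
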